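/- Let $V:\mathbb R^3\to\mathbb R$ be measurable with $V\in L^1(\mathbb R^3)$ and in the Rollnik class, i.e. $\iint_{\mathbb R^3\times\mathbb R^3}\frac{|V(x)|\,|V(y)|}{|x-y|^2}\,dx\,dy<\infty$. Let $\eta:[0,1]\to[0,+\infty)$ be smooth with $\eta(0)=\eta(1)=1$, let $\sigma\ge 0$, and for $\varepsilon\in(0,1]$ put $$V_\varepsilon(x):=\frac{\eta(\varepsilon)}{\varepsilon^\sigma}\,V\!\left(\frac{x}{\varepsilon}\right).$$ Let $H_\varepsilon:=-\Delta+V_\varepsilon$ be the form sum in $L^2(\mathbb R^3)$ with form domain $H^1(\mathbb R^3)$: $f\in\mathrm{dom}(H_\varepsilon)$ and $H_\varepsilon f=g$ iff $f\in H^1$, $g\in L^2$ and $\int\overline{\nabla\varphi}\cdot\nabla f+\int V_\varepsilon\overline{\varphi}f=\langle\varphi,g\rangle$ for all $\varphi\in H^1$. Then each $H_\varepsilon$, $\varepsilon\in(0,1]$, is self-adjoint and lower semi-bounded. Write $v:=\sqrt{|V|}$, $u:=\sqrt{|V|}\,\mathrm{sign}(V)$, and $((-\Delta)^{-1}g)(x):=\int_{\mathbb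 R^3}\frac{g(y)}{4\pi|x-y|}\,dy$. Self-adjoint operators $A_\varepsilon$ are said to converge to a self-adjoint operator $A$ as $\varepsilon\downarrow0$ in the norm (resp. strong) resolvent sense if $(A_\varepsilon-z)^{-1}\to(A-z)^{-1}$ in operator norm (resp. strongly) for all $z\in\mathbb C\setminus\mathbb R$. (i) Let $-\Delta$ be the self-adjoint negative Laplacian in $L^2(\mathbb R^3)$ with domain $H^2(\mathbb R^3)$. If $\sigma\in[0,2]$ and, in the case $\sigma=2$, $-1$ is not an eigenvalue of the operator $u(-\Delta)^{-1}v$ in $L^2(\mathbb R^3)$, then $H_\varepsilon\to-\Delta$ in the norm resolvent sense as $\varepsilon\downarrow0$. If $\sigma\in(2,3]$ and $V>0$ almost everywhere, then $H_\varepsilon\to-\Delta$ in the strong resolvent sense as $\varepsilon\downarrow0$. (ii) Let $\sigma=2$ and $(1+|\cdot|)V\in L^1(\mathbb R^3)$, and assume the resonance condition: there is $\phi\in L^2(\mathbb R^3)\setminus\{0\}$, unique up to multiples, with $u(-\Delta)^{-1}v\,\phi=-\phi$, and $\psi:=(-\Delta)^{-1}v\phi$ satisfies $\psi\in L^2_{\mathrm{loc}}(\mathbb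 R^3)\setminus L^2(\mathbb R^3)$. Normalise $\phi$ by $\int_{\mathbb R^3}\mathrm{sign}(V)|\phi|^2\,dx=-1$ and set $$\alpha:=-\frac{\eta'(0)}{\big|\int_{\mathbb R^3}V\psi\,dx\big|^2}.$$ Then $H_\varepsilon\to-\Delta_\alpha$ in the norm resolvent sense as $\varepsilon\downarrow0$. Here $-\Delta_\alpha$ is the self-adjoint point interaction Hamiltonian supported at the origin: with $G_\nu(x)=\frac{e^{-\sqrt\nu|x|}}{4\pi|x|}$, for any $\nu>0$ with $\alpha+\frac{\sqrt\nu}{4\pi}\ne0$, its domain consists of the $\xi\in L^2(\mathbb R^3)$ of the form $\xi=f+\frac{f(0)}{\alpha+\sqrt\nu/(4\pi)}\,G_\nu$ with $f\in H^2(\mathbb R^3)$ (represented by a continuous function), and $(-\Delta_\alpha+\nu)\xi=(-\Delta+\nu)f$. -/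

import Mathlib

open MeasureTheory Filter Topology Set
open scoped ContDiff ComplexConjugate LineDeriv Laplacian SchwartzMap

noncomputable section

namespace PointLimit

/-- Three-dimensional Euclidean space. -/
abbrev R3 := EuclideanSpace ℝ (Fin 3)

/-- The complex Hilbert space `L²(ℝ³)`. -/
abbrev L2 := Lp ℂ 2 (volume : Measure R3)

/-- An `L²` function regarded as a tempered distribution. -/
abbrev distr (f : L2) : 𝓢'(R3, ℂ) := Lp.toTemperedDistribution f

theorem distr_add (f g : L2) : distr (f + g) = distr f + distr g :=
  (Lp.toTemperedDistributionCLM ℂ (volume : Measure R3) 2).map_add f g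

theorem distr_smul (c : ℂ) (f : L2) : distr (c • f) = c • distr f :=
  (Lp.toTemperedDistributionCLM ℂ (volume : Measure R3) 2).map_smul c f

theorem distr_zero : distr 0 = 0 :=
  (Lp.toTemperedDistributionCLM ℂ (volume : Measure R3) 2).map_zero

/-- `f` belongs to the Sobolev space `H^s(ℝ³) = W^{s,2}(ℝ³)`. -/
def MemH (s : ℝ) (f : L2) : Prop := TemperedDistribution.MemSobolev s 2 (distr f)

theorem MemH.add {s : ℝ} {f g : L2} (hf : MemH s f) (hg : MemH s g) : MemH s (f + g) := by
  unfold MemH at *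
  rw [distr_add]
  exact TemperedDistribution.MemSobolev.add hf hg

theorem MemH.smul {s : ℝ} {f : L2} (c : ℂ) (hf : MemH s f) : MemH s (c • f) := by
  unfold MemH at *
  rw [distr_smul]
  exact TemperedDistribution.MemSobolev.smul c hf

theorem MemH.zero (s : ℝ) : MemH s 0 := by
  unfold MemH
  rw [distr_zero]
  exact TemperedDistribution.memSobolev_fun_zero R3 ℂ s 2

/-- `F = (F₁, F₂, F₃)` is the (weak) gradient of `f`, all components being in `L²`. -/
def HasGradient (f : L2) (F : Fin 3 → L2) : Prop :=
  ∀ i, ∂_{EuclideanSpace.single i (1 : ℝ)} (distr f) = distr (F i)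

theorem HasGradient.add {f g : L2} {F G : Fin 3 → L2} (hf : HasGradient f F)
    (hg : HasGradient g G) : HasGradient (f + g) (F + G) := by
  intro i
  rw [distr_add, LineDeriv.lineDerivOp_add, hf i, hg i, Pi.add_apply, distr_add]

theorem HasGradient.smul {f : L2} {F : Fin 3 → L2} (c : ℂ) (hf : HasGradient f F) :
    HasGradient (c • f) (c • F) := by
  intro i
  rw [distr_smul, LineDeriv.lineDerivOp_smul, hf i, Pi.smul_apply, distr_smul]

theorem HasGradient.zero : HasGradient 0 0 := by
  simpa using HasGradient.smul (f := 0) (F := 0) 0 (fun i => by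
    rw [Pi.zero_apply, distr_zero, LineDeriv.lineDerivOp_zero])

/-! ### The self-adjoint operators -/

/-- The graph of the negative Laplacian with domain `H²(ℝ³)`. -/
def negLaplacianGraph : Submodule ℂ (L2 × L2) where
  carrier := {p | MemH 2 p.1 ∧ -(Δ (distr p.1)) = distr p.2}
  zero_mem' := by
    refine ⟨MemH.zero 2, ?_⟩
    simp only [Prod.fst_zero, Prod.snd_zero, distr_zero]
    rw [← TemperedDistribution.laplacianCLM_apply, map_zero, neg_zero]
  add_mem' := by
    rintro p q ⟨hp, hp'⟩ ⟨hq, hq'⟩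
    refine ⟨hp.add hq, ?_⟩
    simp only [Prod.fst_add, Prod.snd_add, distr_add]
    rw [← hp', ← hq', ← TemperedDistribution.laplacianCLM_apply,
      ← TemperedDistribution.laplacianCLM_apply, ← TemperedDistribution.laplacianCLM_apply,
      map_add, neg_add]
  smul_mem' := by
    rintro c p ⟨hp, hp'⟩
    refine ⟨hp.smul c, ?_⟩
    simp only [Prod.smul_fst, Prod.smul_snd, distr_smul]
    rw [← hp', ← TemperedDistribution.laplacianCLM_apply,
      ← TemperedDistribution.laplacianCLM_apply, map_smul, smul_neg]

/-- The negative Laplacian `-Δ` in `L²(ℝ³)` with domain `H²(ℝ³)`. -/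
def negLaplacian : L2 →ₗ.[ℂ] L2 := negLaplacianGraph.toLinearPMap

/-- The graph of the form sum `-Δ + W`, with form domain `H¹(ℝ³)`: `p = (f, g)` belongs to it iff
`f ∈ H¹` and `∫ ∇φ̄ · ∇f + ∫ W φ̄ f = ⟨φ, g⟩` for all `φ ∈ H¹`, the second integral being
absolutely convergent. -/
def formSumGraph (W : R3 → ℝ) : Submodule ℂ (L2 × L2) where
  carrier := {p | MemH 1 p.1 ∧ ∃ F, HasGradient p.1 F ∧
    ∀ (φ : L2) (Φ : Fin 3 → L2), MemH 1 φ → HasGradient φ Φ →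
      Integrable (fun x => (W x : ℂ) * conj (φ x) * p.1 x) ∧
      ∑ i, inner ℂ (Φ i) (F i) + ∫ x, (W x : ℂ) * conj (φ x) * p.1 x = inner ℂ φ p.2}
  zero_mem' := by
    refine ⟨MemH.zero 1, 0, HasGradient.zero, fun φ Φ _ _ => ?_⟩
    have h : (fun x => (W x : ℂ) * conj (φ x) * (0 : L2) x) =ᵐ[volume] 0 := by
      filter_upwards [Lp.coeFn_zero ℂ 2 (volume : Measure R3)] with x hx
      rw [hx]
      simp
    simp only [Prod.fst_zero, Prod.snd_zero, Pi.zero_apply, inner_zero_right,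
      Finset.sum_const_zero, zero_add]
    refine ⟨(integrable_zero R3 ℂ volume).congr h.symm, ?_⟩
    rw [integral_congr_ae h]
    simp
  add_mem' := by
    rintro p q ⟨hp, F, hF, hp'⟩ ⟨hq, G, hG, hq'⟩
    refine ⟨hp.add hq, F + G, hF.add hG, fun φ Φ hφ hΦ => ?_⟩
    obtain ⟨i₁, e₁⟩ := hp' φ Φ hφ hΦ
    obtain ⟨i₂, e₂⟩ := hq' φ Φ hφ hΦ
    have h : (fun x => (W x : ℂ) * conj (φ x) * (p + q).1 x) =ᵐ[volume]
        fun x => (W x : ℂ) * conj (φ x) * p.1 x + (W x : ℂ) * conj (φ x) * q.1 x := by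
      filter_upwards [Lp.coeFn_add p.1 q.1] with x hx
      simp only [Prod.fst_add, hx, Pi.add_apply]
      ring
    refine ⟨(i₁.add i₂).congr h.symm, ?_⟩
    rw [integral_congr_ae h, integral_add i₁ i₂, Prod.snd_add, inner_add_right, ← e₁, ← e₂]
    simp only [Pi.add_apply, inner_add_right, Finset.sum_add_distrib]
    ring
  smul_mem' := by
    rintro c p ⟨hp, F, hF, hp'⟩
    refine ⟨hp.smul c, c • F, hF.smul c, fun φ Φ hφ hΦ => ?_⟩
    obtain ⟨i₁, e₁⟩ := hp' φ Φ hφ hΦ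
    have h : (fun x => (W x : ℂ) * conj (φ x) * (c • p).1 x) =ᵐ[volume]
        fun x => c * ((W x : ℂ) * conj (φ x) * p.1 x) := by
      filter_upwards [Lp.coeFn_smul c p.1] with x hx
      simp only [Prod.smul_fst, hx, Pi.smul_apply, smul_eq_mul]
      ring
    refine ⟨(i₁.const_mul c).congr h.symm, ?_⟩
    rw [integral_congr_ae h, integral_const_mul, Prod.smul_snd, inner_smul_right, ← e₁]
    simp only [Pi.smul_apply, inner_smul_right, ← Finset.mul_sum]
    ring

/-- The form sum `-Δ + W` as an operator in `L²(ℝ³)`. -/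
def formSum (W : R3 → ℝ) : L2 →ₗ.[ℂ] L2 := (formSumGraph W).toLinearPMap

/-- The Green function `G_ν(x) = exp(-√ν |x|) / (4π|x|)` of `-Δ + ν`. -/
def green (ν : ℝ) (x : R3) : ℝ := Real.exp (-(‖x‖ * √ν)) / (4 * Real.pi * ‖x‖)

/-- The graph of the point interaction Hamiltonian `-Δ_α`, presented through a number `ν > 0` with
`α + √ν / (4π) ≠ 0`: the pairs `(ψ, g)` with `ψ = f + f(0) / (α + √ν / (4π)) G_ν` for some
`f ∈ H²(ℝ³)` and `g + ν ψ = (-Δ + ν) f`. The value `f(0)` is that of the continuous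
representative `c` of `f`. -/
def pointInteractionGraph (α ν : ℝ) : Submodule ℂ (L2 × L2) where
  carrier := {p | ∃ q ∈ negLaplacianGraph, ∃ c : R3 → ℂ, Continuous c ∧ q.1 =ᵐ[volume] c ∧
    (p.1 =ᵐ[volume] fun x => q.1 x + c 0 / ((α + √ν / (4 * Real.pi) : ℝ) : ℂ) * (green ν x : ℂ)) ∧
    p.2 + (ν : ℂ) • p.1 = q.2 + (ν : ℂ) • q.1}
  zero_mem' := by
    refine ⟨0, negLaplacianGraph.zero_mem, 0, continuous_zero, Lp.coeFn_zero _ _ _, ?_, rfl⟩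
    filter_upwards with x
    simp
  add_mem' := by
    rintro p p' ⟨q, hq, c, hc, hqc, hp, e⟩ ⟨q', hq', c', hc', hqc', hp', e'⟩
    refine ⟨q + q', negLaplacianGraph.add_mem hq hq', c + c', hc.add hc', ?_, ?_, ?_⟩
    · exact (Lp.coeFn_add q.1 q'.1).trans (hqc.add hqc')
    · filter_upwards [Lp.coeFn_add q.1 q'.1, Lp.coeFn_add p.1 p'.1, hp, hp'] with x h₁ h₂ h₃ h₄
      simp only [Prod.fst_add, h₁, h₂, Pi.add_apply, h₃, h₄]
      ring
    · simp only [Prod.fst_add, Prod.snd_add, smul_add]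
      rw [add_add_add_comm, e, e', add_add_add_comm]
  smul_mem' := by
    rintro a p ⟨q, hq, c, hc, hqc, hp, e⟩
    refine ⟨a • q, negLaplacianGraph.smul_mem a hq, a • c, hc.const_smul a, ?_, ?_, ?_⟩
    · exact (Lp.coeFn_smul a q.1).trans (hqc.const_smul a)
    · filter_upwards [Lp.coeFn_smul a q.1, Lp.coeFn_smul a p.1, hp] with x h₁ h₂ h₃
      simp only [Prod.smul_fst, h₁, h₂, Pi.smul_apply, h₃, smul_eq_mul]
      ring
    · simp only [Prod.smul_fst, Prod.smul_snd]
      rw [smul_comm (ν : ℂ) a, smul_comm (ν : ℂ) a, ← smul_add, e, smul_add]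

/-- The point interaction Hamiltonian `-Δ_α` supported at the origin. -/
def pointInteraction (α ν : ℝ) : L2 →ₗ.[ℂ] L2 := (pointInteractionGraph α ν).toLinearPMap

/-! ### Resolvent convergence -/

/-- The operator `A` is bounded from below. -/
def LowerSemibounded (A : L2 →ₗ.[ℂ] L2) : Prop :=
  ∃ m : ℝ, ∀ f : A.domain, m * ‖(f : L2)‖ ^ 2 ≤ (inner ℂ (f : L2) (A f)).re

/-- The bounded operator `R` is the resolvent `(A - z)⁻¹`. -/
def IsResolvent (A : L2 →ₗ.[ℂ] L2) (z : ℂ) (R : L2 →L[ℂ] L2) : Prop :=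
  (∀ f : L2, ∃ h : R f ∈ A.domain, A ⟨R f, h⟩ - z • R f = f) ∧
    ∀ f : A.domain, R (A f - z • (f : L2)) = f

/-- Convergence, as `ε ↓ 0`, of self-adjoint operators in the norm resolvent sense. -/
def NormResolventConverges (A : ℝ → L2 →ₗ.[ℂ] L2) (B : L2 →ₗ.[ℂ] L2) : Prop :=
  (∀ᶠ ε in 𝓝[>] 0, IsSelfAdjoint (A ε)) ∧ IsSelfAdjoint B ∧
  ∀ z : ℂ, z.im ≠ 0 → ∃ (R : ℝ → L2 →L[ℂ] L2) (S : L2 →L[ℂ] L2),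
    (∀ᶠ ε in 𝓝[>] 0, IsResolvent (A ε) z (R ε)) ∧ IsResolvent B z S ∧
    Tendsto R (𝓝[>] 0) (𝓝 S)

/-- Convergence, as `ε ↓ 0`, of self-adjoint operators in the strong resolvent sense. -/
def StrongResolventConverges (A : ℝ → L2 →ₗ.[ℂ] L2) (B : L2 →ₗ.[ℂ] L2) : Prop :=
  (∀ᶠ ε in 𝓝[>] 0, IsSelfAdjoint (A ε)) ∧ IsSelfAdjoint B ∧
  ∀ z : ℂ, z.im ≠ 0 → ∃ (R : ℝ → L2 →L[ℂ] L2) (S : L2 →L[ℂ] L2),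
    (∀ᶠ ε in 𝓝[>] 0, IsResolvent (A ε) z (R ε)) ∧ IsResolvent B z S ∧
    ∀ f : L2, Tendsto (fun ε => R ε f) (𝓝[>] 0) (𝓝 (S f))

/-! ### Potentials and the resonance condition -/

/-- The Rollnik class: `∬ |V(x)| |V(y)| / |x - y|² dx dy < ∞`. -/
def Rollnik (V : R3 → ℝ) : Prop :=
  AEMeasurable V ∧ ∫⁻ x, ∫⁻ y, ‖V x‖ₑ * ‖V y‖ₑ / ‖x - y‖ₑ ^ 2 < ⊤

/-- The scaled potential `V_ε(x) = η(ε) ε^{-σ} V(x / ε)`. -/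
def scaledPotential (V : R3 → ℝ) (η : ℝ → ℝ) (σ ε : ℝ) (x : R3) : ℝ :=
  η ε / ε ^ σ * V (ε⁻¹ • x)

/-- `(-Δ)⁻¹ g`, that is, the convolution of `g` with `1 / (4π|x|)`. -/
def newtonPotential (g : R3 → ℂ) (x : R3) : ℂ :=
  ∫ y, ((4 * Real.pi * ‖x - y‖)⁻¹ : ℝ) * g y

/-- `ψ = (-Δ)⁻¹ v φ`, where `v = √|V|`. -/
def resonanceFunction (V : R3 → ℝ) (φ : L2) : R3 → ℂ :=
  newtonPotential fun y => ((√|V y| : ℝ) : ℂ) * φ y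

/-- `u (-Δ)⁻¹ v φ = -φ`, where `v = √|V|` and `u = √|V| sign V`. -/
def IsBirmanSchwingerSolution (V : R3 → ℝ) (φ : L2) : Prop :=
  ∀ᵐ x, ((√|V x| * Real.sign (V x) : ℝ) : ℂ) * resonanceFunction V φ x = -φ x

/-- `-1` is an eigenvalue of the Birman-Schwinger operator `u (-Δ)⁻¹ v`. -/
def HasEigenvalueNegOne (V : R3 → ℝ) : Prop :=
  ∃ φ : L2, φ ≠ 0 ∧ IsBirmanSchwingerSolution V φ

/-- The resonance condition, with `φ` the eigenfunction: `-1` is a simple eigenvalue of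
`u (-Δ)⁻¹ v`, the eigenspace is spanned by `φ`, and `ψ = (-Δ)⁻¹ v φ` is in `L²_loc` but not
in `L²`. -/
def ResonanceCondition (V : R3 → ℝ) (φ : L2) : Prop :=
  φ ≠ 0 ∧ IsBirmanSchwingerSolution V φ ∧
  (∀ χ : L2, IsBirmanSchwingerSolution V χ → ∃ c : ℂ, χ = c • φ) ∧
  (∀ K : Set R3, IsCompact K → MemLp (resonanceFunction V φ) 2 (volume.restrict K)) ∧
  ¬ MemLp (resonanceFunction V φ) 2 volume

end PointLimit

end

open PointLimit

open MeasureTheory Filter Topology Set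
open scoped ContDiff ComplexConjugate LineDeriv Laplacian SchwartzMap

noncomputable section

namespace PointLimit

/-! ### Self-adjoint operators given by a resolvent at a real point -/

section Bounded

variable {H : Type*} [NormedAddCommGroup H] [InnerProductSpace ℂ H] [CompleteSpace H]

/-! Everything is reduced to bounded operators at one real point `-κ²` below the spectrum. If `R` is
bounded, self-adjoint and injective and `g` is the graph of `R⁻¹ + a`, then `g` is the graph of a
self-adjoint operator, its resolvent at a non-real `z` is `R (1 - (z - a) R)⁻¹`, and norm or strong
convergence of such `R` passes to all these resolvents (`HasRealResolvent` and the lemmas on it).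

Let `J = (-Δ + κ²)^{-1/2}`, whose range is `H¹`. If the form of `W` pulled back by `J` is given by a
bounded self-adjoint `C`, then `-Δ + W` has resolvent `J (1 + C)⁻¹ J` at `-κ²` as soon as `1 + C` is
invertible (`hasRealResolvent_formSum`). For `W = c V(·/ε)` a unitary dilation gives `C = l T* S T`,
where `l = c ε²`, `S` is multiplication by `sign V`, `T T* = B_{κε} = v (-Δ + κ²ε²)⁻¹ v`, and `T J =
√ε A_ε` with `A_ε` of kernel `v(x) G_κ(εx - y)`. The push-through identity then yields Krein's
formula (`krein_formula`) `(H_ε + κ²)⁻¹ = (-Δ + κ²)⁻¹ - l ε A_ε* (1 + l S B_{κε})⁻¹ S A_ε`. The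
Rollnik condition makes `B_{κε}` Hilbert–Schmidt up to `κε = 0`, with `B_{κε} → B₀`; `V ∈ L¹` makes
`A_ε` Hilbert–Schmidt with a norm bound independent of `ε`. Since `B_κ → 0` as `κ → ∞`, a large `κ`
gives self-adjointness and semiboundedness for every fixed `ε`.

Here `l = η(ε) ε^{2-σ}`. For `σ ≤ 2` it converges, `1 + l₀ S B₀` is invertible (trivially if `l₀ =
0`, by the Fredholm alternative if `l₀ = 1`), and the factor `l ε` kills the correction. For `V > 0`
and `σ ≤ 3` one has `S = 1` and `C = X* X`, so `(1 + X* X)⁻¹` is a contraction that moves `k` by at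
most `‖X k‖`. For `k = J f` with `f ⊥ G_κ` this is `√(l ε) ‖A_ε f‖ → 0`, and such `k` are dense
because `G_κ` is not in the range of `J`.

In the resonant case `1 + S B₀` has the simple kernel spanned by `φ`, and `1 + η S B_{κε} = (1 + S
B₀) + ε S (η'(0) B₀ - (κ/4π) |v⟩⟨v|) + o(ε)`. Hence `ε` times the inverse tends to `d⁻¹ |φ⟩⟨Sφ|`
with `d = η'(0) - (κ/4π) |⟨v, φ⟩|²` (`tendsto_smul_inverse_of_simple_kernel`). Since `A_ε →
|v⟩⟨G_κ|`, the correction tends to `(α + κ/4π)⁻¹ |G_κ⟩⟨G_κ|`, which is Krein's formula for `-Δ_α`.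
The number `⟨v, φ⟩ = -∫ Vψ` is nonzero, since otherwise `ψ` would be square integrable
(`memLp_resonanceFunction`). -/

theorem isUnit_one_sub_smul_of_isSelfAdjoint {R : H →L[ℂ] H} (hR : IsSelfAdjoint R) {w : ℂ}
    (hw : w.im ≠ 0) : IsUnit (1 - w • R) := by
  have hw0 : w ≠ 0 := fun h => hw (by simp [h])
  have h : w⁻¹ ∉ spectrum ℂ R := fun hmem => by
    have h1 := hR.mem_spectrum_eq_re hmem
    have h2 : (w⁻¹).im = 0 := by rw [h1]; simp
    rw [Complex.inv_im, div_eq_zero_iff] at h2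
    rcases h2 with h2 | h2
    · exact hw (neg_eq_zero.1 h2)
    · exact hw0 (Complex.normSq_eq_zero.1 h2)
  rw [spectrum.notMem_iff] at h
  have h3 : 1 - w • R = (algebraMap ℂ (H →L[ℂ] H) w) * (algebraMap ℂ (H →L[ℂ] H) w⁻¹ - R) := by
    rw [mul_sub, ← map_mul, mul_inv_cancel₀ hw0, map_one, ← Algebra.smul_def]
  rw [h3]
  exact ((IsUnit.mk0 w hw0).map (algebraMap ℂ (H →L[ℂ] H))).mul h

theorem inverse_apply_sub_smul {R : H →L[ℂ] H} (hR : IsSelfAdjoint R) {w : ℂ} (hw : w.im ≠ 0)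
    (f : H) : Ring.inverse (1 - w • R) f - w • R (Ring.inverse (1 - w • R) f) = f := by
  have := congrArg (fun B : H →L[ℂ] H => B f)
    (Ring.mul_inverse_cancel _ (isUnit_one_sub_smul_of_isSelfAdjoint hR hw))
  simpa using this

theorem inverse_one_sub_smul_apply {R : H →L[ℂ] H} (hR : IsSelfAdjoint R) {w : ℂ} (hw : w.im ≠ 0)
    (f : H) : Ring.inverse (1 - w • R) (f - w • R f) = f := by
  have := congrArg (fun B : H →L[ℂ] H => B f)
    (Ring.inverse_mul_cancel _ (isUnit_one_sub_smul_of_isSelfAdjoint hR hw))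
  simpa using this

theorem im_inner_self_eq_zero {R : H →L[ℂ] H} (hR : IsSelfAdjoint R) (f : H) :
    (inner ℂ f (R f)).im = 0 := by
  have h := hR.isSymmetric f f
  have h2 := inner_conj_symm f (R f) (𝕜 := ℂ)
  simp only [ContinuousLinearMap.coe_coe] at h
  rw [h] at h2
  exact Complex.conj_eq_iff_im.1 h2

/-- After multiplication by `conj w`, the coefficient of `⟪f, R f⟫` becomes the real number `‖w‖²`,
so the imaginary part of `⟪f, (1 - w R) f⟫ conj w` sees only `‖f‖²`. The bound does not depend on
`R`. -/
theorem norm_le_of_isSelfAdjoint {R : H →L[ℂ] H} (hR : IsSelfAdjoint R) {w : ℂ}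
    (hw : w.im ≠ 0) (f : H) : ‖f‖ ≤ ‖w‖ / |w.im| * ‖(1 - w • R) f‖ := by
  have hw0 : w ≠ 0 := fun h => hw (by simp [h])
  have hn : 0 < ‖w‖ := norm_pos_iff.2 hw0
  have hi : 0 < |w.im| := abs_pos.2 hw
  have e : inner ℂ f ((1 - w • R) f) * conj w
      = conj w * ((‖f‖ ^ 2 : ℝ) : ℂ) - ((‖w‖ ^ 2 : ℝ) : ℂ) * inner ℂ f (R f) := by
    have h1 : conj w * w = ((‖w‖ ^ 2 : ℝ) : ℂ) := by
      rw [mul_comm, Complex.mul_conj, Complex.normSq_eq_norm_sq]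
    have h2 : inner ℂ f f = ((‖f‖ ^ 2 : ℝ) : ℂ) := by
      rw [inner_self_eq_norm_sq_to_K]; simp
    simp only [sub_apply, one_apply_eq_self, smul_apply, inner_sub_right,
      inner_smul_right, h2, ← h1]
    ring
  have him : |w.im| * ‖f‖ ^ 2 = |(inner ℂ f ((1 - w • R) f) * conj w).im| := by
    rw [e, Complex.sub_im, Complex.im_mul_ofReal, Complex.im_ofReal_mul,
      im_inner_self_eq_zero hR]
    simp [abs_mul]
  have hle : |w.im| * ‖f‖ ^ 2 ≤ ‖f‖ * ‖(1 - w • R) f‖ * ‖w‖ := by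
    rw [him]
    refine (Complex.abs_im_le_norm _).trans ?_
    rw [norm_mul, RCLike.norm_conj]
    gcongr
    exact norm_inner_le_norm _ _
  rcases (norm_nonneg f).eq_or_lt with h0 | h0
  · rw [← h0]; positivity
  · rw [div_mul_eq_mul_div, le_div_iff₀ hi]
    nlinarith

/-- Strong convergence of bounded self-adjoint operators is inherited by
`R ↦ R (1 - w R)⁻¹` for non-real `w`. -/
theorem tendsto_apply_inverse_one_sub {ι : Type*} {l : Filter ι} {R : ι → H →L[ℂ] H}
    {S : H →L[ℂ] H} (hR : ∀ᶠ i in l, IsSelfAdjoint (R i)) (hS : IsSelfAdjoint S)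
    (h : ∀ f, Tendsto (fun i => R i f) l (𝓝 (S f))) {w : ℂ} (hw : w.im ≠ 0) (f : H) :
    Tendsto (fun i => (R i * Ring.inverse (1 - w • R i)) f) l
      (𝓝 ((S * Ring.inverse (1 - w • S)) f)) := by
  -- This reduces the claim to strong convergence of the inverses themselves.
  have key : ∀ A : H →L[ℂ] H, IsSelfAdjoint A → w • (A * Ring.inverse (1 - w • A))
      = Ring.inverse (1 - w • A) - 1 := fun A hA => by
    have h1 := Ring.mul_inverse_cancel _ (isUnit_one_sub_smul_of_isSelfAdjoint hA hw)
    rw [sub_mul, one_mul, smul_mul_assoc] at h1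
    rw [eq_sub_iff_add_eq, add_comm, ← eq_sub_iff_add_eq]; exact h1.symm
  have hw0 : w ≠ 0 := fun h => hw (by simp [h])
  have main : Tendsto (fun i => Ring.inverse (1 - w • R i) f) l
      (𝓝 (Ring.inverse (1 - w • S) f)) := by
    rw [tendsto_iff_norm_sub_tendsto_zero]
    set u := Ring.inverse (1 - w • S) f with hu
    have h0 : Tendsto (fun i => ‖w‖ / |w.im| * ‖w • (R i u - S u)‖) l (𝓝 0) := by
      have := ((h u).sub_const (S u)).const_smul w
      simpa using this.norm.const_mul (‖w‖ / |w.im|)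
    refine squeeze_zero' (Eventually.of_forall fun _ => norm_nonneg _) ?_ h0
    filter_upwards [hR] with i hi
    -- Second resolvent identity: `1 - w R i` applied to the difference of the two inverses at `f`
    -- is `w (R i - S) u`, with `u` fixed.
    refine (norm_le_of_isSelfAdjoint hi hw _).trans_eq ?_
    congr 2
    have h1 := Ring.mul_inverse_cancel _ (isUnit_one_sub_smul_of_isSelfAdjoint hi hw)
    have h2 := Ring.mul_inverse_cancel _ (isUnit_one_sub_smul_of_isSelfAdjoint hS hw)
    have h3 : (1 - w • R i) (Ring.inverse (1 - w • R i) f) = f := by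
      rw [← mul_apply_eq_comp, h1, one_apply_eq_self]
    have h4 : (1 - w • S) u = f := by
      rw [hu, ← mul_apply_eq_comp, h2, one_apply_eq_self]
    rw [map_sub, h3, ← h4]
    simp only [sub_apply, one_apply_eq_self, smul_apply, smul_sub]
    abel
  have e : ∀ A : H →L[ℂ] H, IsSelfAdjoint A → (A * Ring.inverse (1 - w • A)) f
      = w⁻¹ • (Ring.inverse (1 - w • A) f - f) := fun A hA => by
    have := congrArg (fun B : H →L[ℂ] H => w⁻¹ • B f) (key A hA)
    simpa [smul_smul, hw0] using this
  rw [e S hS]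
  refine ((main.sub_const f).const_smul w⁻¹).congr' ?_
  filter_upwards [hR] with i hi
  rw [e _ hi]

end Bounded

/-- The real number `a` is in the resolvent set of the self-adjoint operator with graph `g`, and `R`
is the resolvent. -/
structure HasRealResolvent (g : Submodule ℂ (L2 × L2)) (a : ℝ) (R : L2 →L[ℂ] L2) : Prop where
  selfAdjoint : IsSelfAdjoint R
  injective : ∀ f, R f = 0 → f = 0
  mem_iff : ∀ p : L2 × L2, p ∈ g ↔ p.1 = R (p.2 - (a : ℂ) • p.1)

namespace HasRealResolvent

variable {g : Submodule ℂ (L2 × L2)} {a : ℝ} {R : L2 →L[ℂ] L2}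

/-- Injectivity of `R` is what makes the relation `g` single-valued. -/
theorem snd_eq_zero (h : HasRealResolvent g a R) (x : L2 × L2) (hx : x ∈ g) (hx' : x.1 = 0) :
    x.2 = 0 := by
  have := (h.mem_iff x).1 hx
  rw [hx', smul_zero, sub_zero] at this
  exact h.injective _ this.symm

theorem graph_eq (h : HasRealResolvent g a R) : g.toLinearPMap.graph = g :=
  Submodule.toLinearPMap_graph_eq g h.snd_eq_zero

theorem mem (h : HasRealResolvent g a R) (y : L2) : (R y, y + (a : ℂ) • R y) ∈ g := by
  rw [h.mem_iff]
  simp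

theorem inner_symm (h : HasRealResolvent g a R) (x y : L2) :
    inner ℂ (R x) y = inner ℂ x (R y) :=
  h.selfAdjoint.isSymmetric x y

/-- The domain contains the range of `R`; a vector `x` orthogonal to it satisfies `‖R x‖² = ⟪R (R
x), x⟫ = 0`. -/
theorem dense_domain (h : HasRealResolvent g a R) : Dense (g.toLinearPMap.domain : Set L2) := by
  rw [Submodule.dense_iff_topologicalClosure_eq_top, Submodule.topologicalClosure_eq_top_iff,
    Submodule.eq_bot_iff]
  intro x hx
  apply h.injective
  rw [Submodule.mem_orthogonal] at hx
  have h1 : R (R x) ∈ g.toLinearPMap.domain := by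
    rw [Submodule.toLinearPMap_domain, Submodule.mem_map]
    exact ⟨_, h.mem (R x), rfl⟩
  have h2 := hx _ h1
  rwa [h.inner_symm, inner_self_eq_zero] at h2

/-- Testing the adjoint relation on the pairs `(R y, y + a R y)` and moving `R` across the inner
product gives the very equation that characterises membership in `g`. -/
theorem isSelfAdjoint (h : HasRealResolvent g a R) : IsSelfAdjoint g.toLinearPMap := by
  rw [LinearPMap.isSelfAdjoint_def]
  apply LinearPMap.eq_of_eq_graph
  rw [LinearPMap.adjoint_graph_eq_graph_adjoint h.dense_domain, h.graph_eq]
  ext x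
  rw [Submodule.mem_adjoint_iff]
  constructor
  · intro hx
    rw [h.mem_iff]
    refine ext_inner_left ℂ fun y => ?_
    have h1 := hx _ _ (h.mem y)
    rw [← h.inner_symm, inner_sub_right, inner_smul_right]
    rw [inner_add_left, inner_smul_left, Complex.conj_ofReal] at h1
    linear_combination h1
  · intro hx b c hbc
    have h1 := (h.mem_iff _).1 hbc
    have h2 := (h.mem_iff _).1 hx
    have h3 := h.inner_symm (c - (a : ℂ) • b) (x.2 - (a : ℂ) • x.1)
    simp only at h1
    rw [← h1, ← h2, inner_sub_left, inner_sub_right, inner_smul_left, inner_smul_right,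
      Complex.conj_ofReal] at h3
    linear_combination -h3

/-- Formally `A - z = R⁻¹ - (z - a) = (1 - (z - a) R) R⁻¹`; the bounded factor is invertible because
`R` has real spectrum. -/
theorem isResolvent (h : HasRealResolvent g a R) {z : ℂ} (hz : z.im ≠ 0) :
    IsResolvent g.toLinearPMap z (R * Ring.inverse (1 - (z - a) • R)) := by
  have hw : (z - (a : ℂ)).im ≠ 0 := by simpa using hz
  constructor
  · intro f
    have hf := inverse_apply_sub_smul h.selfAdjoint hw f
    rw [mul_apply_eq_comp]
    set u := Ring.inverse (1 - (z - a) • R) f with hu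
    have hmem : (R u, f + z • R u) ∈ g := by
      have e : f + z • R u - (a : ℂ) • R u = u := by
        rw [sub_smul] at hf
        rw [add_sub_assoc, ← sub_eq_iff_eq_add.1 hf]
      rw [h.mem_iff]
      exact congrArg R e.symm
    have hd : R u ∈ g.toLinearPMap.domain := by
      rw [Submodule.toLinearPMap_domain, Submodule.mem_map]
      exact ⟨_, hmem, rfl⟩
    refine ⟨hd, ?_⟩
    have h3 := LinearPMap.mem_graph g.toLinearPMap ⟨R u, hd⟩
    rw [← h.graph_eq] at hmem
    have h4 : g.toLinearPMap ⟨R u, hd⟩ = f + z • R u :=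
      LinearPMap.mem_graph_snd_inj' _ h3 hmem rfl
    rw [h4, add_sub_cancel_right]
  · intro f
    have h3 := LinearPMap.mem_graph g.toLinearPMap f
    rw [h.graph_eq, h.mem_iff] at h3
    simp only at h3
    have e : g.toLinearPMap f - z • (f : L2) = (g.toLinearPMap f - (a : ℂ) • (f : L2))
        - (z - (a : ℂ)) • R (g.toLinearPMap f - (a : ℂ) • (f : L2)) := by
      rw [← h3, sub_smul]
      abel
    rw [e, mul_apply_eq_comp, inverse_one_sub_smul_apply h.selfAdjoint hw, ← h3]

end HasRealResolvent

/-- Convergence at one common real point suffices, because inversion is norm continuous at the unit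
`1 - (z - a) S`. -/
theorem normResolventConverges_of_hasRealResolvent {g : ℝ → Submodule ℂ (L2 × L2)}
    {g₀ : Submodule ℂ (L2 × L2)} {a : ℝ} {R : ℝ → L2 →L[ℂ] L2} {S : L2 →L[ℂ] L2}
    (hR : ∀ᶠ ε in 𝓝[>] 0, HasRealResolvent (g ε) a (R ε)) (hS : HasRealResolvent g₀ a S)
    (h : Tendsto R (𝓝[>] 0) (𝓝 S)) :
    NormResolventConverges (fun ε => (g ε).toLinearPMap) g₀.toLinearPMap := by
  refine ⟨hR.mono fun _ h => h.isSelfAdjoint, hS.isSelfAdjoint, fun z hz =>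
    ⟨fun ε => R ε * Ring.inverse (1 - (z - a) • R ε), S * Ring.inverse (1 - (z - a) • S),
      hR.mono fun _ h => h.isResolvent hz, hS.isResolvent hz, ?_⟩⟩
  obtain ⟨u, hu⟩ := isUnit_one_sub_smul_of_isSelfAdjoint hS.selfAdjoint (w := z - a)
    (by simpa using hz)
  refine h.mul ?_
  have h1 := NormedRing.inverse_continuousAt u
  rw [hu] at h1
  exact h1.tendsto.comp ((h.const_smul (z - (a : ℂ))).const_sub 1)

theorem strongResolventConverges_of_hasRealResolvent {g : ℝ → Submodule ℂ (L2 × L2)}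
    {g₀ : Submodule ℂ (L2 × L2)} {a : ℝ} {R : ℝ → L2 →L[ℂ] L2} {S : L2 →L[ℂ] L2}
    (hR : ∀ᶠ ε in 𝓝[>] 0, HasRealResolvent (g ε) a (R ε)) (hS : HasRealResolvent g₀ a S)
    (h : ∀ f, Tendsto (fun ε => R ε f) (𝓝[>] 0) (𝓝 (S f))) :
    StrongResolventConverges (fun ε => (g ε).toLinearPMap) g₀.toLinearPMap :=
  ⟨hR.mono fun _ h => h.isSelfAdjoint, hS.isSelfAdjoint, fun z hz =>
    ⟨fun ε => R ε * Ring.inverse (1 - (z - a) • R ε), S * Ring.inverse (1 - (z - a) • S),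
      hR.mono fun _ h => h.isResolvent hz, hS.isResolvent hz,
      tendsto_apply_inverse_one_sub (hR.mono fun _ h => h.selfAdjoint) hS.selfAdjoint h
        (by simpa using hz)⟩⟩

/-! ### Inverses of perturbed operators -/

/-- The push-through identity: `1 + x y` and `1 + y x` are invertible together. It trades the form
perturbation for the Birman–Schwinger operator. -/
theorem one_add_mul_woodbury {A : Type*} [Ring A] {x y n : A} (h₁ : (1 + y * x) * n = 1)
    (h₂ : n * (1 + y * x) = 1) :
    (1 + x * y) * (1 - x * n * y) = 1 ∧ (1 - x * n * y) * (1 + x * y) = 1 := by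
  constructor
  · calc (1 + x * y) * (1 - x * n * y) = 1 + x * y - x * ((1 + y * x) * n) * y := by noncomm_ring
      _ = 1 := by rw [h₁]; noncomm_ring
  · calc (1 - x * n * y) * (1 + x * y) = 1 + x * y - x * (n * (1 + y * x)) * y := by noncomm_ring
      _ = 1 := by rw [h₂]; noncomm_ring

section RankOne

variable {H : Type*} [NormedAddCommGroup H] [InnerProductSpace ℂ H]

/-- The rank one operator `f ↦ ⟪b, f⟫ a`. -/
def rankOne (a b : H) : H →L[ℂ] H := (innerSL ℂ b).smulRight a

@[simp]
theorem rankOne_apply (a b f : H) : rankOne a b f = inner ℂ b f • a := by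
  simp [rankOne]

theorem tendsto_rankOne {ι : Type*} {l : Filter ι} {a : ι → H} {a₀ : H}
    (h : Tendsto a l (𝓝 a₀)) (b : H) :
    Tendsto (fun i => rankOne (a i) b) l (𝓝 (rankOne a₀ b)) :=
  ((ContinuousLinearMap.smulRightL ℂ H H (innerSL ℂ b)).continuous.tendsto a₀).comp h

theorem isCompactOperator_rankOne (a b : H) : IsCompactOperator (rankOne a b) := by
  have h : IsCompactOperator (ContinuousLinearMap.toSpanSingleton ℂ a) :=
    isCompactOperator_of_locallyCompactSpace_rng _
  exact h.comp_clm (innerSL ℂ b)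

end RankOne

section Abstract

variable {H : Type*} [NormedAddCommGroup H] [InnerProductSpace ℂ H] [CompleteSpace H]

/-- Fredholm alternative at the spectral value `-1`. -/
theorem isUnit_one_add_of_isCompactOperator {C : H →L[ℂ] H} (hC : IsCompactOperator C)
    (h : ∀ f, f + C f = 0 → f = 0) : IsUnit (1 + C) := by
  rcases hC.hasEigenvalue_or_mem_resolventSet (μ := (-1 : ℂ)) (by simp) with h1 | h1
  · obtain ⟨f, hf⟩ := h1.exists_hasEigenvector
    refine absurd (h f ?_) hf.2
    have := hf.apply_eq_smul
    simp only [ContinuousLinearMap.coe_coe] at this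
    rw [this]
    simp
  · have h2 : IsUnit (-(algebraMap ℂ (H →L[ℂ] H) (-1) - C)) := IsUnit.neg h1
    convert h2 using 1
    rw [map_neg, map_one]
    abel

/-- Inversion of `M₀ + e N` near a simple pole: `M₀` has one-dimensional kernel spanned by `φ`, its
adjoint annihilates `χ`, and `⟪χ, φ⟫ = -1`. -/
theorem tendsto_smul_inverse_of_simple_kernel {ι : Type*} {l : Filter ι} {M₀ N : H →L[ℂ] H}
    {M n : ι → H →L[ℂ] H} {e : ι → ℂ} {φ χ : H} (hχφ : inner ℂ χ φ = (-1 : ℂ)) (hφ : M₀ φ = 0)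
    (hχ : ∀ f, inner ℂ χ (M₀ f) = (0 : ℂ)) (hunit : IsUnit (M₀ - rankOne φ χ))
    (hn : Tendsto n l (𝓝 N)) (he : Tendsto e l (𝓝 0)) (he0 : ∀ᶠ i in l, e i ≠ 0)
    (hM : ∀ᶠ i in l, M i = M₀ + e i • n i) (hN : inner ℂ χ (N φ) ≠ (0 : ℂ)) :
    (∀ᶠ i in l, IsUnit (M i)) ∧
      Tendsto (fun i => e i • Ring.inverse (M i)) l
        (𝓝 ((inner ℂ χ (N φ) : ℂ)⁻¹ • rankOne φ χ)) := by
  set K := M₀ - rankOne φ χ with hK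
  set k : ι → H →L[ℂ] H := fun i => M₀ + e i • n i - rankOne φ χ with hk
  set q : ι → H →L[ℂ] H := fun i => Ring.inverse (k i) with hq
  have hkK : Tendsto k l (𝓝 K) := by
    have := ((he.smul hn).const_add M₀).sub_const (rankOne φ χ)
    simpa [hK] using this
  obtain ⟨u, hu⟩ := hunit
  have hunit : IsUnit K := ⟨u, hu⟩
  have hku : ∀ᶠ i in l, IsUnit (k i) := by
    refine hkK.eventually (p := IsUnit) ?_
    exact Units.isOpen.mem_nhds hunit
  have hqQ : Tendsto q l (𝓝 (Ring.inverse K)) := by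
    have h1 := NormedRing.inverse_continuousAt u
    rw [hu] at h1
    exact h1.tendsto.comp hkK
  -- The normalisation `⟪χ, φ⟫ = -1` makes `φ` a fixed vector of `K` and `⟪χ, ·⟫` a fixed
  -- functional; both properties pass to `K⁻¹`.
  have hKφ : K φ = φ := by simp [hK, hφ, hχφ]
  have hKχ : ∀ f, inner ℂ χ (K f) = (inner ℂ χ f : ℂ) := fun f => by
    simp [hK, hχ, hχφ]
  have hKQ : ∀ f, K (Ring.inverse K f) = f := fun f => by
    rw [← mul_apply_eq_comp, Ring.mul_inverse_cancel _ hunit, one_apply_eq_self]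
  have hQK : ∀ f, Ring.inverse K (K f) = f := fun f => by
    rw [← mul_apply_eq_comp, Ring.inverse_mul_cancel _ hunit, one_apply_eq_self]
  have hQφ : Ring.inverse K φ = φ := by
    nth_rewrite 1 [← hKφ]; exact hQK φ
  have hQχ : ∀ f, inner ℂ χ (Ring.inverse K f) = (inner ℂ χ f : ℂ) := fun f => by
    rw [← hKχ, hKQ]
  set c : ℂ := inner ℂ χ (N φ) with hc
  set d : ι → ℂ := fun i => 1 + inner ℂ χ (q i φ) with hd
  set t : ι → ℂ := fun i => inner ℂ χ (q i (n i φ)) with ht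
  have htc : Tendsto t l (𝓝 c) := by
    have h1 : Tendsto (fun i => (q i * n i) φ) l (𝓝 ((Ring.inverse K * N) φ)) :=
      ((ContinuousLinearMap.apply ℂ H φ).continuous.tendsto _).comp (hqQ.mul hn)
    have h2 := Tendsto.inner (𝕜 := ℂ) (tendsto_const_nhds (x := χ)) h1
    rw [mul_apply_eq_comp, hQχ] at h2
    exact h2
  -- `d i` is the Sherman–Morrison denominator for `M i = k i + rankOne φ χ`. Pairing `q i (k i φ) =
  -- φ` with `χ` shows that it vanishes exactly to first order in `e i`.
  have hdt : ∀ᶠ i in l, d i = -(e i * t i) := by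
    filter_upwards [hku] with i hi
    have h1 : q i (k i φ) = φ := by
      rw [← mul_apply_eq_comp, hq]; simp only
      rw [Ring.inverse_mul_cancel _ hi, one_apply_eq_self]
    have h2 : k i φ = φ + e i • n i φ := by
      simp [hk, hφ, hχφ, add_comm]
    rw [h2, map_add, map_smul] at h1
    have h3 := congrArg (fun x => (inner ℂ χ x : ℂ)) h1
    simp only [inner_add_right, inner_smul_right, hχφ] at h3
    simp only [hd, ht]
    linear_combination h3
  have ht0 : ∀ᶠ i in l, t i ≠ 0 := htc.eventually_ne hN
  -- Sherman–Morrison: the factor `e i` cancels the one in `d i` and leaves `(t i)⁻¹`, which has a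
  -- limit.
  have hinv : ∀ᶠ i in l, IsUnit (M i) ∧
      e i • Ring.inverse (M i) = e i • q i + (t i)⁻¹ • (rankOne (q i φ) χ * q i) := by
    filter_upwards [hku, hdt, ht0, he0, hM] with i h1 h2 h3 h4 h5
    have hd0 : d i ≠ 0 := by rw [h2]; exact neg_ne_zero.2 (mul_ne_zero h4 h3)
    have hMk : M i = k i + rankOne φ χ := by rw [h5, hk]; simp
    have hkq : k i * q i = 1 := Ring.mul_inverse_cancel _ h1
    have hqk : q i * k i = 1 := Ring.inverse_mul_cancel _ h1
    have hkq' : ∀ f, k i (q i f) = f := fun f => by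
      rw [← mul_apply_eq_comp, hkq, one_apply_eq_self]
    have hqk' : ∀ f, q i (k i f) = f := fun f => by
      rw [← mul_apply_eq_comp, hqk, one_apply_eq_self]
    have e1 : M i * (q i - (d i)⁻¹ • (rankOne (q i φ) χ * q i)) = 1 := by
      ext f
      have hx : (inner ℂ χ (q i φ) : ℂ) = d i - 1 := by simp [hd]
      simp only [hMk, mul_apply_eq_comp, add_apply, sub_apply, smul_apply, rankOne_apply, map_sub,
        map_smul, hkq', one_apply_eq_self, smul_smul, hx]
      match_scalars
      · simp
      · field_simp
        ring
    have e2 : (q i - (d i)⁻¹ • (rankOne (q i φ) χ * q i)) * M i = 1 := by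
      ext f
      have hx : (inner ℂ χ (q i φ) : ℂ) = d i - 1 := by simp [hd]
      simp only [hMk, mul_apply_eq_comp, add_apply, sub_apply, smul_apply, rankOne_apply, map_add,
        map_smul, hqk', one_apply_eq_self, smul_smul, hx]
      match_scalars
      · simp
      · field_simp
        ring
    have hval : Ring.inverse (M i) = q i - (d i)⁻¹ • (rankOne (q i φ) χ * q i) :=
      Ring.inverse_unit ⟨M i, _, e1, e2⟩
    refine ⟨⟨⟨M i, _, e1, e2⟩, rfl⟩, ?_⟩
    rw [hval, smul_sub, smul_smul, h2, sub_eq_add_neg, ← neg_smul]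
    congr 2
    field_simp
  refine ⟨hinv.mono fun _ h => h.1, ?_⟩
  have hlim : Tendsto (fun i => e i • q i + (t i)⁻¹ • (rankOne (q i φ) χ * q i)) l
      (𝓝 ((0 : ℂ) • Ring.inverse K + c⁻¹ • (rankOne (Ring.inverse K φ) χ * Ring.inverse K))) := by
    refine (he.smul hqQ).add ((htc.inv₀ hN).smul (Tendsto.mul (tendsto_rankOne ?_ χ) hqQ))
    exact ((ContinuousLinearMap.apply ℂ H φ).continuous.tendsto _).comp hqQ
  have hfin : (0 : ℂ) • Ring.inverse K + c⁻¹ • (rankOne (Ring.inverse K φ) χ * Ring.inverse K)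
      = c⁻¹ • rankOne φ χ := by
    rw [hQφ, zero_smul, zero_add]
    congr 1
    ext f
    simp [hQχ]
  rw [hfin] at hlim
  exact hlim.congr' (hinv.mono fun _ h => h.2.symm)

/-- If `M₀ f = ⟪χ, f⟫ φ`, pairing with `χ` kills the left side, so `⟪χ, f⟫ = 0` and `f` is in the
kernel of `M₀`. Then `f = c φ`, and `⟪χ, φ⟫ = -1` forces `c = 0`. The Fredholm alternative does the
rest. -/
theorem isUnit_sub_rankOne_of_simple_kernel {M₀ C : H →L[ℂ] H} {φ χ : H}
    (hC : IsCompactOperator C) (hM : M₀ = 1 + C) (hχφ : inner ℂ χ φ = (-1 : ℂ))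
    (hχ : ∀ f, inner ℂ χ (M₀ f) = (0 : ℂ)) (hker : ∀ f, M₀ f = 0 → ∃ c : ℂ, f = c • φ) :
    IsUnit (M₀ - rankOne φ χ) := by
  have e : M₀ - rankOne φ χ = 1 + (C - rankOne φ χ) := by rw [hM]; abel
  rw [e]
  refine isUnit_one_add_of_isCompactOperator (hC.sub (isCompactOperator_rankOne φ χ)) fun f hf => ?_
  have h1 : M₀ f = inner ℂ χ f • φ := by
    rw [hM]
    simp only [add_apply, one_apply_eq_self, sub_apply, rankOne_apply] at hf ⊢
    rw [← sub_eq_zero, ← hf]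
    abel
  have h2 : (inner ℂ χ f : ℂ) = 0 := by
    have h3 := hχ f
    rw [h1, inner_smul_right, hχφ] at h3
    simpa using h3
  rw [h2, zero_smul] at h1
  obtain ⟨c, rfl⟩ := hker f h1
  rw [inner_smul_right, hχφ] at h2
  have : c = 0 := by simpa using h2
  simp [this]

/-! ### Operators of the form `1 + X* X`. -/

section Positive

variable (X : H →L[ℂ] H)

theorem re_inner_one_add_adjoint_mul (f : H) :
    (inner ℂ f ((1 + star X * X) f)).re = ‖f‖ ^ 2 + ‖X f‖ ^ 2 := by
  have h : inner ℂ f (star X (X f)) = ((‖X f‖ ^ 2 : ℝ) : ℂ) := by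
    rw [ContinuousLinearMap.star_eq_adjoint, ContinuousLinearMap.adjoint_inner_right,
      inner_self_eq_norm_sq_to_K]
    simp
  have h2 : inner ℂ f f = ((‖f‖ ^ 2 : ℝ) : ℂ) := by
    rw [inner_self_eq_norm_sq_to_K]; simp
  rw [add_apply, one_apply_eq_self, inner_add_right, mul_apply_eq_comp, h, h2]
  simp only [Complex.add_re, Complex.ofReal_re]

theorem isUnit_one_add_adjoint_mul : IsUnit (1 + star X * X) := by
  refine ContinuousLinearMap.isUnit_of_forall_le_norm_inner_map _ (c := 1) one_pos fun f => ?_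
  have h1 := re_inner_one_add_adjoint_mul X f
  have h2 : (inner ℂ ((1 + star X * X) f) f).re = (inner ℂ f ((1 + star X * X) f)).re := by
    rw [← inner_conj_symm, Complex.conj_re]
  rw [NNReal.coe_one, mul_one]
  refine le_trans ?_ ((le_abs_self _).trans (Complex.abs_re_le_norm _))
  rw [h2, h1]
  nlinarith [sq_nonneg ‖X f‖]

theorem norm_inverse_one_add_adjoint_mul_le (f : H) :
    ‖Ring.inverse (1 + star X * X) f‖ ≤ ‖f‖ := by
  set u := Ring.inverse (1 + star X * X) f with hu
  have h1 : (1 + star X * X) u = f := by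
    rw [hu, ← mul_apply_eq_comp, Ring.mul_inverse_cancel _ (isUnit_one_add_adjoint_mul X),
      one_apply_eq_self]
  have h2 := re_inner_one_add_adjoint_mul X u
  rw [h1] at h2
  have h3 : (inner ℂ u f).re ≤ ‖u‖ * ‖f‖ :=
    ((le_abs_self _).trans (Complex.abs_re_le_norm _)).trans (norm_inner_le_norm _ _)
  have h4 : ‖u‖ * ‖u‖ ≤ ‖u‖ * ‖f‖ := by nlinarith [sq_nonneg ‖X u‖]
  rcases (norm_nonneg u).eq_or_lt with h0 | h0
  · rw [← h0]; positivity
  · exact le_of_mul_le_mul_left h4 h0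

/-- The difference `u` solves `(1 + X* X) u = X* X f`. Pairing with `u` gives `‖u‖² + ‖X u‖² ≤ ‖X u‖
‖X f‖`, and the term `‖X u‖²` absorbs the product. -/
theorem norm_sub_inverse_one_add_adjoint_mul_le (f : H) :
    ‖f - Ring.inverse (1 + star X * X) f‖ ≤ ‖X f‖ := by
  have hL := Ring.mul_inverse_cancel _ (isUnit_one_add_adjoint_mul X)
  set u := f - Ring.inverse (1 + star X * X) f with hu
  have h1 : (1 + star X * X) u = star X (X f) := by
    rw [hu, map_sub, ← mul_apply_eq_comp (1 + star X * X), hL, one_apply_eq_self, add_apply,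
      one_apply_eq_self, mul_apply_eq_comp]
    abel
  have h2 := re_inner_one_add_adjoint_mul X u
  rw [h1, ContinuousLinearMap.star_eq_adjoint, ContinuousLinearMap.adjoint_inner_right] at h2
  have h3 : (inner ℂ (X u) (X f)).re ≤ ‖X u‖ * ‖X f‖ :=
    ((le_abs_self _).trans (Complex.abs_re_le_norm _)).trans (norm_inner_le_norm _ _)
  refine le_of_sq_le_sq ?_ (norm_nonneg _)
  nlinarith [sq_nonneg (‖X u‖ - ‖X f‖), sq_nonneg ‖X u‖, sq_nonneg ‖X f‖]

end Positive

/-- If `X i k → 0` for `k` in a dense set then `(1 + X i* X i)⁻¹ → 1` strongly. -/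
theorem tendsto_inverse_one_add_adjoint_mul {ι : Type*} {l : Filter ι} {X : ι → H →L[ℂ] H}
    {D : Set H} (hD : Dense D) (h : ∀ k ∈ D, Tendsto (fun i => X i k) l (𝓝 0)) (f : H) :
    Tendsto (fun i => Ring.inverse (1 + star (X i) * X i) f) l (𝓝 f) := by
  rw [Metric.tendsto_nhds]
  intro δ hδ
  obtain ⟨k, hkD, hk⟩ := Metric.dense_iff.1 hD f (δ / 3) (by positivity)
  rw [Metric.mem_ball, dist_eq_norm] at hkD
  have h1 := (Metric.tendsto_nhds.1 (h k hk)) (δ / 3) (by positivity)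
  filter_upwards [h1] with i hi
  rw [dist_zero_right] at hi
  rw [dist_comm, dist_eq_norm]
  -- The two outer terms are at most `‖f - k‖` because the inverse is a contraction; only the middle
  -- one uses the convergence at `k`.
  have e : f - Ring.inverse (1 + star (X i) * X i) f = (f - k)
      + (k - Ring.inverse (1 + star (X i) * X i) k)
      + Ring.inverse (1 + star (X i) * X i) (k - f) := by
    rw [map_sub]; abel
  rw [e]
  have h2 := norm_sub_inverse_one_add_adjoint_mul_le (X i) k
  have h3 := norm_inverse_one_add_adjoint_mul_le (X i) (k - f)
  have h4 := norm_add₃_le (a := f - k) (b := k - Ring.inverse (1 + star (X i) * X i) k)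
    (c := Ring.inverse (1 + star (X i) * X i) (k - f))
  rw [norm_sub_rev] at h4
  linarith

end Abstract

open scoped FourierTransform

/-! ### Multiplication operators and Fourier multipliers -/

/-- Multiplication by an essentially bounded function, as an operator on `L²`. -/
def mulOp (m : R3 → ℂ) : L2 →L[ℂ] L2 := by
  classical
  exact if h : MemLp m ⊤ volume then
    (ContinuousLinearMap.mul ℂ ℂ).holderL volume ⊤ 2 2 (h.toLp m) else 0

theorem mulOp_coeFn {m : R3 → ℂ} (hm : MemLp m ⊤ volume) (f : L2) :
    mulOp m f =ᵐ[volume] fun x => m x * f x := by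
  rw [mulOp, dif_pos hm]
  filter_upwards [(ContinuousLinearMap.mul ℂ ℂ).coeFn_holder (r := 2) (hm.toLp m) f,
    hm.coeFn_toLp] with x h1 h2
  rw [← h2]
  exact h1

theorem memLp_top_of_continuous {m : R3 → ℂ} (hm : Continuous m) {C : ℝ} (hC : ∀ x, ‖m x‖ ≤ C) :
    MemLp m ⊤ volume :=
  memLp_top_of_bound hm.aestronglyMeasurable C (Eventually.of_forall hC)

theorem inner_eq_integral (f g : L2) : inner ℂ f g = ∫ x, conj (f x) * g x := by
  rw [L2.inner_def]
  congr 1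
  ext x
  rw [RCLike.inner_apply, mul_comm]

theorem integrable_conj_mul (f g : L2) : Integrable fun x => conj (f x) * g x := by
  refine (L2.integrable_inner (𝕜 := ℂ) f g).congr (Eventually.of_forall fun x => ?_)
  simp only [RCLike.inner_apply, mul_comm]

theorem star_mulOp {m : R3 → ℂ} (hm : MemLp m ⊤ volume) :
    star (mulOp m) = mulOp fun x => conj (m x) := by
  have hm' : MemLp (fun x => conj (m x)) ⊤ volume := hm.star
  rw [ContinuousLinearMap.star_eq_adjoint, eq_comm, ContinuousLinearMap.eq_adjoint_iff]
  intro f g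
  rw [inner_eq_integral, inner_eq_integral]
  refine integral_congr_ae ?_
  filter_upwards [mulOp_coeFn hm g, mulOp_coeFn hm' f] with x h1 h2
  rw [h1, h2, map_mul, Complex.conj_conj]
  ring

theorem isSelfAdjoint_mulOp_ofReal {m : R3 → ℝ} (hm : MemLp (fun x => (m x : ℂ)) ⊤ volume) :
    IsSelfAdjoint (mulOp fun x => (m x : ℂ)) := by
  rw [IsSelfAdjoint, star_mulOp hm]
  simp

theorem norm_mulOp_le {m : R3 → ℂ} (hm : MemLp m ⊤ volume) {C : ℝ} (hC0 : 0 ≤ C)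
    (hC : ∀ᵐ x, ‖m x‖ ≤ C) : ‖mulOp m‖ ≤ C := by
  refine ContinuousLinearMap.opNorm_le_bound _ hC0 fun f => ?_
  refine Lp.norm_le_mul_norm_of_ae_le_mul ?_
  filter_upwards [mulOp_coeFn hm f, hC] with x h1 h2
  rw [h1, norm_mul]
  gcongr

/-- The Fourier multiplier with bounded symbol `m`. -/
def fourierMul (m : R3 → ℂ) : L2 →L[ℂ] L2 :=
  ((Lp.fourierTransformₗᵢ R3 ℂ).symm.toContinuousLinearEquiv : L2 →L[ℂ] L2) ∘L mulOp m ∘L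
    ((Lp.fourierTransformₗᵢ R3 ℂ).toContinuousLinearEquiv : L2 →L[ℂ] L2)

theorem fourier_fourierMul (m : R3 → ℂ) (f : L2) : 𝓕 (fourierMul m f) = mulOp m (𝓕 f) :=
  (Lp.fourierTransformₗᵢ R3 ℂ).apply_symm_apply _

theorem fourier_fourierMul_coeFn {m : R3 → ℂ} (hm : MemLp m ⊤ volume) (f : L2) :
    (𝓕 (fourierMul m f) : L2) =ᵐ[volume] fun ξ => m ξ * (𝓕 f : L2) ξ := by
  rw [fourier_fourierMul]
  exact mulOp_coeFn hm _

theorem fourier_injective {f g : L2} (h : (𝓕 f : L2) = 𝓕 g) : f = g :=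
  (Lp.fourierTransformₗᵢ R3 ℂ).injective h

theorem fourier_injective_ae {f g : L2} (h : (𝓕 f : L2) =ᵐ[volume] (𝓕 g : L2)) : f = g :=
  fourier_injective (Lp.ext h)

theorem exists_fourier_eq (g : L2) : ∃ f : L2, (𝓕 f : L2) = g :=
  ⟨𝓕⁻ g, (Lp.fourierTransformₗᵢ R3 ℂ).apply_symm_apply g⟩

theorem fourierMul_mul {m m' : R3 → ℂ} (hm : MemLp m ⊤ volume) (hm' : MemLp m' ⊤ volume)
    (hmm' : MemLp (fun x => m x * m' x) ⊤ volume) :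
    fourierMul m * fourierMul m' = fourierMul fun x => m x * m' x := by
  ext1 f
  apply fourier_injective_ae
  filter_upwards [fourier_fourierMul_coeFn hm (fourierMul m' f), fourier_fourierMul_coeFn hm' f,
    fourier_fourierMul_coeFn hmm' f] with x h1 h2 h3
  rw [mul_apply_eq_comp, h1, h2, h3, mul_assoc]

theorem isSelfAdjoint_fourierMul_ofReal {m : R3 → ℝ}
    (hm : MemLp (fun x => (m x : ℂ)) ⊤ volume) :
    IsSelfAdjoint (fourierMul fun x => (m x : ℂ)) := by
  rw [ContinuousLinearMap.isSelfAdjoint_iff', eq_comm, ContinuousLinearMap.eq_adjoint_iff]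
  intro f g
  have h := (isSelfAdjoint_mulOp_ofReal hm).isSymmetric (𝓕 f) (𝓕 g)
  simp only [ContinuousLinearMap.coe_coe] at h
  rwa [← fourier_fourierMul, ← fourier_fourierMul, Lp.inner_fourier_eq, Lp.inner_fourier_eq] at h

/-! ### Sobolev spaces in Fourier space -/

theorem fourier_distr (f : L2) : 𝓕 (distr f) = distr (𝓕 f) :=
  Lp.fourier_toTemperedDistribution_eq f

theorem distr_eq_iff_fourier {f : 𝓢'(R3, ℂ)} {g : L2} :
    f = distr g ↔ 𝓕 f = distr (𝓕 g) := by
  rw [← fourier_distr]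
  refine ⟨fun h => by rw [h], fun h => ?_⟩
  have := congrArg (fun u : 𝓢'(R3, ℂ) => 𝓕⁻ u) h
  simpa using this

/-- Both sides are locally integrable, so equality against smooth compactly supported functions is
equality almost everywhere. Through this, distributional conditions become pointwise ones in Fourier
space. -/
theorem smulLeftCLM_distr_eq_iff {m : R3 → ℂ} (hm : m.HasTemperateGrowth) (f g : L2) :
    TemperedDistribution.smulLeftCLM ℂ m (distr f) = distr g ↔
      ∀ᵐ x, g x = m x * f x := by
  have hmf : LocallyIntegrable (fun x => m x * f x) (volume : Measure R3) := by
    have h1 : LocallyIntegrable (fun x => f x) (volume : Measure R3) :=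
      (Lp.memLp f).locallyIntegrable (by norm_num)
    rw [← locallyIntegrableOn_univ] at h1 ⊢
    exact h1.continuousOn_mul hm.1.continuous.continuousOn isOpen_univ.isLocallyClosed
  have hg : LocallyIntegrable (fun x => g x) (volume : Measure R3) :=
    (Lp.memLp g).locallyIntegrable (by norm_num)
  constructor
  · intro h
    apply ae_eq_of_integral_contDiff_smul_eq hg hmf
    intro u u_smooth u_cpt
    have hu₁ : HasCompactSupport (Complex.ofRealCLM ∘ u) := u_cpt.comp_left rfl
    have hu₂ : ContDiff ℝ ∞ (Complex.ofRealCLM ∘ u) := by fun_prop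
    have h1 := congrArg (fun T : 𝓢'(R3, ℂ) => T (hu₁.toSchwartzMap hu₂)) h
    simp only [TemperedDistribution.smulLeftCLM_apply_apply, Lp.toTemperedDistribution_apply,
      SchwartzMap.smulLeftCLM_apply_apply hm] at h1
    rw [eq_comm] at h1
    refine Eq.trans ?_ (h1.trans ?_) <;> congr 1 <;> ext x <;> simp
    ring
  · intro h
    ext u
    simp only [TemperedDistribution.smulLeftCLM_apply_apply, Lp.toTemperedDistribution_apply,
      SchwartzMap.smulLeftCLM_apply_apply hm]
    refine integral_congr_ae ?_
    filter_upwards [h] with x hx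
    rw [hx]
    simp
    ring

theorem memH_iff {s : ℝ} {f : L2} :
    MemH s f ↔ MemLp (fun ξ => (((1 + ‖ξ‖ ^ 2) ^ (s / 2) : ℝ) : ℂ) * (𝓕 f : L2) ξ) 2 := by
  have hm : (fun ξ : R3 => (((1 + ‖ξ‖ ^ 2) ^ (s / 2) : ℝ) : ℂ)).HasTemperateGrowth := by fun_prop
  rw [MemH, TemperedDistribution.memSobolev_iff_exists_smulLeftCLM_fourier]
  constructor
  · rintro ⟨g, hg⟩
    rw [fourier_distr] at hg
    have h2 := (smulLeftCLM_distr_eq_iff hm _ _).1 hg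
    exact (Lp.memLp g).ae_eq h2
  · intro h
    refine ⟨h.toLp _, ?_⟩
    rw [fourier_distr]
    exact (smulLeftCLM_distr_eq_iff hm _ _).2 h.coeFn_toLp

theorem smul_smulLeftCLM {m : R3 → ℂ} (hm : m.HasTemperateGrowth) (c : ℂ) (u : 𝓢'(R3, ℂ)) :
    c • TemperedDistribution.smulLeftCLM ℂ m u
      = TemperedDistribution.smulLeftCLM ℂ (fun x => c * m x) u :=
  (congrArg (fun L : 𝓢'(R3, ℂ) →L[ℂ] 𝓢'(R3, ℂ) => L u)
    (TemperedDistribution.smulLeftCLM_smul hm c)).symm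

theorem hasGradient_iff {f : L2} {F : Fin 3 → L2} :
    HasGradient f F ↔ ∀ i, ∀ᵐ ξ, (𝓕 (F i) : L2) ξ
      = (2 * Real.pi * Complex.I * (ξ i : ℂ)) * (𝓕 f : L2) ξ := by
  refine forall_congr' fun i => ?_
  have hm :
      (fun ξ : R3 => ((inner ℝ ξ (EuclideanSpace.single i (1 : ℝ)) : ℝ) : ℂ)).HasTemperateGrowth
    := by fun_prop
  have hm' : (fun ξ : R3 => 2 * Real.pi * Complex.I *
    ((inner ℝ ξ (EuclideanSpace.single i (1 : ℝ)) : ℝ) : ℂ)).HasTemperateGrowth := by fun_prop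
  rw [distr_eq_iff_fourier, TemperedDistribution.lineDeriv_eq_fourierMultiplierCLM,
    TemperedDistribution.fourierMultiplierCLM_apply, FourierTransform.fourier_smul,
    FourierTransform.fourier_fourierInv_eq, fourier_distr, smul_smulLeftCLM hm,
    smulLeftCLM_distr_eq_iff hm']
  simp [EuclideanSpace.inner_single_right]

theorem neg_laplacian_distr_eq_iff {f g : L2} :
    -(Δ (distr f)) = distr g ↔
      ∀ᵐ ξ, (𝓕 g : L2) ξ = (((2 * Real.pi) ^ 2 * ‖ξ‖ ^ 2 : ℝ) : ℂ) * (𝓕 f : L2) ξ := by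
  have hm : (fun ξ : R3 => ((‖ξ‖ ^ 2 : ℝ) : ℂ)).HasTemperateGrowth := by fun_prop
  have hm' : (fun ξ : R3 => (((2 * Real.pi) ^ 2 * ‖ξ‖ ^ 2 : ℝ) : ℂ)).HasTemperateGrowth := by
    fun_prop
  have e : -(Δ (distr f)) = (((2 * Real.pi) ^ 2 : ℝ) : ℂ) •
      TemperedDistribution.fourierMultiplierCLM ℂ (fun ξ => ((‖ξ‖ ^ 2 : ℝ) : ℂ)) (distr f) := by
    rw [TemperedDistribution.laplacian_eq_fourierMultiplierCLM, Complex.coe_smul]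
    simp
  rw [e, distr_eq_iff_fourier, TemperedDistribution.fourierMultiplierCLM_apply,
    FourierTransform.fourier_smul, FourierTransform.fourier_fourierInv_eq, fourier_distr,
    smul_smulLeftCLM hm]
  simp_rw [← Complex.ofReal_mul]
  rw [smulLeftCLM_distr_eq_iff hm']

/-! ### The free resolvent and its square root -/

/-- The symbol `4π²|ξ|² + κ²` of `-Δ + κ²`. -/
def symbol (κ : ℝ) (ξ : R3) : ℝ := (2 * Real.pi) ^ 2 * ‖ξ‖ ^ 2 + κ ^ 2

theorem symbol_pos {κ : ℝ} (hκ : 0 < κ) (ξ : R3) : 0 < symbol κ ξ := by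
  unfold symbol; positivity

theorem continuous_symbol (κ : ℝ) : Continuous (symbol κ) := by
  unfold symbol; fun_prop

theorem sq_le_symbol (κ : ℝ) (ξ : R3) : κ ^ 2 ≤ symbol κ ξ := by
  unfold symbol
  nlinarith [sq_nonneg (2 * Real.pi * ‖ξ‖)]

/-- The operator `(-Δ + κ²)^{-1/2}`. -/
def sqrtRes (κ : ℝ) : L2 →L[ℂ] L2 := fourierMul fun ξ => (((√(symbol κ ξ))⁻¹ : ℝ) : ℂ)

/-- The free resolvent `(-Δ + κ²)⁻¹`. -/
def freeRes (κ : ℝ) : L2 →L[ℂ] L2 := fourierMul fun ξ => (((symbol κ ξ)⁻¹ : ℝ) : ℂ)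

variable {κ : ℝ}

theorem memLp_top_inv_sqrt_symbol (hκ : 0 < κ) :
    MemLp (fun ξ => (((√(symbol κ ξ))⁻¹ : ℝ) : ℂ)) ⊤ (volume : Measure R3) := by
  refine memLp_top_of_continuous (C := κ⁻¹) ?_ fun ξ => ?_
  · refine Complex.continuous_ofReal.comp (Continuous.inv₀ (continuous_symbol κ).sqrt fun ξ => ?_)
    exact (Real.sqrt_pos.2 (symbol_pos hκ ξ)).ne'
  · rw [Complex.norm_real, norm_inv, Real.norm_of_nonneg (Real.sqrt_nonneg _)]
    exact inv_anti₀ hκ (Real.le_sqrt_of_sq_le (sq_le_symbol κ ξ))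

theorem memLp_top_inv_symbol (hκ : 0 < κ) :
    MemLp (fun ξ => (((symbol κ ξ)⁻¹ : ℝ) : ℂ)) ⊤ (volume : Measure R3) := by
  refine memLp_top_of_continuous (C := (κ ^ 2)⁻¹) ?_ fun ξ => ?_
  · exact Complex.continuous_ofReal.comp
      ((continuous_symbol κ).inv₀ fun ξ => (symbol_pos hκ ξ).ne')
  · rw [Complex.norm_real, norm_inv, Real.norm_of_nonneg (symbol_pos hκ ξ).le]
    exact inv_anti₀ (by positivity) (sq_le_symbol κ ξ)

theorem sqrtRes_mul_self (hκ : 0 < κ) : sqrtRes κ * sqrtRes κ = freeRes κ := by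
  have e : (fun ξ => (((√(symbol κ ξ))⁻¹ : ℝ) : ℂ) * (((√(symbol κ ξ))⁻¹ : ℝ) : ℂ))
      = fun ξ => (((symbol κ ξ)⁻¹ : ℝ) : ℂ) := by
    ext ξ
    rw [← Complex.ofReal_mul, ← mul_inv, Real.mul_self_sqrt (symbol_pos hκ ξ).le]
  unfold sqrtRes freeRes
  rw [fourierMul_mul (memLp_top_inv_sqrt_symbol hκ) (memLp_top_inv_sqrt_symbol hκ), e]
  rw [e]
  exact memLp_top_inv_symbol hκ

theorem isSelfAdjoint_sqrtRes (hκ : 0 < κ) : IsSelfAdjoint (sqrtRes κ) :=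
  isSelfAdjoint_fourierMul_ofReal (memLp_top_inv_sqrt_symbol hκ)

theorem isSelfAdjoint_freeRes (hκ : 0 < κ) : IsSelfAdjoint (freeRes κ) :=
  isSelfAdjoint_fourierMul_ofReal (memLp_top_inv_symbol hκ)

theorem fourier_sqrtRes (hκ : 0 < κ) (f : L2) :
    ∀ᵐ ξ, (𝓕 (sqrtRes κ f) : L2) ξ = (((√(symbol κ ξ))⁻¹ : ℝ) : ℂ) * (𝓕 f : L2) ξ :=
  fourier_fourierMul_coeFn (memLp_top_inv_sqrt_symbol hκ) f

theorem fourier_freeRes (hκ : 0 < κ) (f : L2) :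
    ∀ᵐ ξ, (𝓕 (freeRes κ f) : L2) ξ = (((symbol κ ξ)⁻¹ : ℝ) : ℂ) * (𝓕 f : L2) ξ :=
  fourier_fourierMul_coeFn (memLp_top_inv_symbol hκ) f

theorem fourier_zero_ae : ∀ᵐ ξ, (𝓕 (0 : L2) : L2) ξ = 0 := by
  rw [show (𝓕 (0 : L2) : L2) = 0 from (Lp.fourierTransformₗᵢ R3 ℂ).map_zero]
  exact Lp.coeFn_zero ℂ 2 volume

theorem freeRes_injective (hκ : 0 < κ) (f : L2) (hf : freeRes κ f = 0) : f = 0 := by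
  apply fourier_injective_ae
  have h := fourier_freeRes hκ f
  rw [hf] at h
  filter_upwards [h, fourier_zero_ae] with ξ h1 h2
  rw [h2, eq_comm, mul_eq_zero] at h1
  rw [h2]
  refine h1.resolve_left ?_
  exact_mod_cast (inv_pos.2 (symbol_pos hκ ξ)).ne'

theorem sqrtRes_injective (hκ : 0 < κ) (f : L2) (hf : sqrtRes κ f = 0) : f = 0 := by
  apply freeRes_injective hκ
  rw [← sqrtRes_mul_self hκ, mul_apply_eq_comp, hf, map_zero]

theorem inner_sqrtRes (hκ : 0 < κ) (f g : L2) :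
    inner ℂ (sqrtRes κ f) g = inner ℂ f (sqrtRes κ g) :=
  (isSelfAdjoint_sqrtRes hκ).isSymmetric f g

/-- The weights `1 + |ξ|²` and `4π²|ξ|² + κ²` bound each other up to the constants `κ² + 4π²` and `1
+ κ⁻²`, the second because `2π ≥ 1`. -/
theorem memH_one_iff (hκ : 0 < κ) {f : L2} : MemH 1 f ↔ ∃ h, f = sqrtRes κ h := by
  have hpow : ∀ ξ : R3, (1 + ‖ξ‖ ^ 2) ^ ((1 : ℝ) / 2) = √(1 + ‖ξ‖ ^ 2) := fun ξ =>
    (Real.sqrt_eq_rpow _).symm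
  rw [memH_iff]
  simp_rw [hpow]
  constructor
  · intro h
    have h1 : MemLp (fun ξ => ((√(symbol κ ξ) : ℝ) : ℂ) * (𝓕 f : L2) ξ) 2 := by
      refine h.of_le_mul (c := √(κ ^ 2 + (2 * Real.pi) ^ 2)) ?_ (Eventually.of_forall fun ξ => ?_)
      · exact (Complex.continuous_ofReal.comp (continuous_symbol κ).sqrt).aestronglyMeasurable.mul
          (Lp.aestronglyMeasurable _)
      · rw [norm_mul, norm_mul, Complex.norm_real, Complex.norm_real,
          Real.norm_of_nonneg (Real.sqrt_nonneg _), Real.norm_of_nonneg (Real.sqrt_nonneg _),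
          ← mul_assoc, ← Real.sqrt_mul (by positivity)]
        gcongr
        unfold symbol
        nlinarith [mul_nonneg (sq_nonneg κ) (sq_nonneg ‖ξ‖), sq_nonneg (2 * Real.pi)]
    obtain ⟨g, hg⟩ := exists_fourier_eq (h1.toLp _)
    refine ⟨g, fourier_injective_ae ?_⟩
    filter_upwards [fourier_sqrtRes hκ g, h1.coeFn_toLp] with ξ h2 h3
    rw [h2, hg, h3, ← mul_assoc, ← Complex.ofReal_mul,
      inv_mul_cancel₀ (Real.sqrt_pos.2 (symbol_pos hκ ξ)).ne']
    simp
  · rintro ⟨h, rfl⟩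
    refine (Lp.memLp (𝓕 h : L2)).of_le_mul (c := √(1 + (κ ^ 2)⁻¹)) ?_ ?_
    · exact (Complex.continuous_ofReal.comp (by fun_prop)).aestronglyMeasurable.mul
        (Lp.aestronglyMeasurable _)
    · filter_upwards [fourier_sqrtRes hκ h] with ξ h1
      rw [h1, norm_mul, norm_mul, Complex.norm_real, Complex.norm_real, norm_inv,
        Real.norm_of_nonneg (Real.sqrt_nonneg _), Real.norm_of_nonneg (Real.sqrt_nonneg _),
        ← mul_assoc]
      gcongr
      rw [← div_eq_mul_inv, div_le_iff₀ (Real.sqrt_pos.2 (symbol_pos hκ ξ)),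
        ← Real.sqrt_mul (by positivity)]
      gcongr
      unfold symbol
      have hp : (1 : ℝ) ≤ (2 * Real.pi) ^ 2 := by nlinarith [Real.pi_gt_three]
      have h2 : (κ ^ 2)⁻¹ * κ ^ 2 = 1 := inv_mul_cancel₀ (by positivity)
      have h3 : 0 ≤ (κ ^ 2)⁻¹ * ((2 * Real.pi) ^ 2 * ‖ξ‖ ^ 2) := by positivity
      nlinarith [mul_le_mul_of_nonneg_right hp (sq_nonneg ‖ξ‖), sq_nonneg κ]

/-- In Fourier space the graph equation is division by the symbol. For `f` and `g` in `L²` it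
already makes the `H²` weight of `f` square integrable. -/
theorem hasRealResolvent_negLaplacian (hκ : 0 < κ) :
    HasRealResolvent negLaplacianGraph (-κ ^ 2) (freeRes κ) := by
  refine ⟨isSelfAdjoint_freeRes hκ, freeRes_injective hκ, fun p => ?_⟩
  have hF : ∀ᵐ ξ, (𝓕 (p.2 - ((-κ ^ 2 : ℝ) : ℂ) • p.1) : L2) ξ
      = (𝓕 p.2 : L2) ξ + (κ : ℂ) ^ 2 * (𝓕 p.1 : L2) ξ := by
    have e : (𝓕 (p.2 - ((-κ ^ 2 : ℝ) : ℂ) • p.1) : L2)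
        = (𝓕 p.2 : L2) + ((κ : ℂ) ^ 2) • (𝓕 p.1 : L2) := by
      have h1 := (Lp.fourierTransformₗᵢ R3 ℂ).map_sub p.2 (((-κ ^ 2 : ℝ) : ℂ) • p.1)
      have h2 := (Lp.fourierTransformₗᵢ R3 ℂ).map_smul ((-κ ^ 2 : ℝ) : ℂ) p.1
      refine h1.trans ?_
      rw [h2, Complex.ofReal_neg, neg_smul, sub_neg_eq_add, Complex.ofReal_pow]
      rfl
    rw [e]
    filter_upwards [Lp.coeFn_add (𝓕 p.2 : L2) (((κ : ℂ) ^ 2) • (𝓕 p.1 : L2)),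
      Lp.coeFn_smul ((κ : ℂ) ^ 2) (𝓕 p.1 : L2)] with ξ h1 h2
    rw [h1, Pi.add_apply, h2, Pi.smul_apply, smul_eq_mul]
  have hmem : p ∈ negLaplacianGraph ↔ MemH 2 p.1 ∧ -(Δ (distr p.1)) = distr p.2 := Iff.rfl
  rw [hmem, neg_laplacian_distr_eq_iff]
  constructor
  · rintro ⟨-, h⟩
    apply fourier_injective_ae
    filter_upwards [fourier_freeRes hκ (p.2 - ((-κ ^ 2 : ℝ) : ℂ) • p.1), hF, h] with ξ h1 h2 h3
    rw [h1, h2, h3, ← add_mul, ← mul_assoc]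
    have : (((symbol κ ξ)⁻¹ : ℝ) : ℂ) *
        ((((2 * Real.pi) ^ 2 * ‖ξ‖ ^ 2 : ℝ) : ℂ) + (κ : ℂ) ^ 2) = 1 := by
      rw [← Complex.ofReal_pow, ← Complex.ofReal_add, ← Complex.ofReal_mul]
      have := inv_mul_cancel₀ (symbol_pos hκ ξ).ne'
      exact_mod_cast this
    rw [this, one_mul]
  · intro h
    have key : ∀ᵐ ξ, (symbol κ ξ : ℂ) * (𝓕 p.1 : L2) ξ
        = (𝓕 p.2 : L2) ξ + (κ : ℂ) ^ 2 * (𝓕 p.1 : L2) ξ := by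
      have h0 := fourier_freeRes hκ (p.2 - ((-κ ^ 2 : ℝ) : ℂ) • p.1)
      rw [← h] at h0
      filter_upwards [h0, hF] with ξ h1 h2
      rw [← h2, h1, ← mul_assoc, ← Complex.ofReal_mul,
        mul_inv_cancel₀ (symbol_pos hκ ξ).ne', Complex.ofReal_one, one_mul]
    constructor
    · rw [memH_iff]
      have h1 : MemLp (fun ξ => (symbol κ ξ : ℂ) * (𝓕 p.1 : L2) ξ) 2 :=
        (((Lp.memLp (𝓕 p.2 : L2)).add ((Lp.memLp (𝓕 p.1 : L2)).const_mul ((κ : ℂ) ^ 2)))).ae_eq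
          (by filter_upwards [key] with ξ hξ; exact hξ.symm)
      refine h1.of_le_mul (c := 1 + (κ ^ 2)⁻¹) ?_ (Eventually.of_forall fun ξ => ?_)
      · have hc : Continuous fun ξ : R3 => (1 + ‖ξ‖ ^ 2) ^ ((2 : ℝ) / 2) := by
          simp only [div_self (two_ne_zero' ℝ), Real.rpow_one]
          fun_prop
        exact (Complex.continuous_ofReal.comp hc).aestronglyMeasurable.mul
          (Lp.aestronglyMeasurable _)
      · rw [div_self two_ne_zero, Real.rpow_one, norm_mul, norm_mul, Complex.norm_real,
          Complex.norm_real, Real.norm_of_nonneg (symbol_pos hκ ξ).le,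
          Real.norm_of_nonneg (by positivity), ← mul_assoc]
        gcongr
        unfold symbol
        have hp : (1 : ℝ) ≤ (2 * Real.pi) ^ 2 := by nlinarith [Real.pi_gt_three]
        have h2 : (κ ^ 2)⁻¹ * κ ^ 2 = 1 := inv_mul_cancel₀ (by positivity)
        have h3 : 0 ≤ (κ ^ 2)⁻¹ * ((2 * Real.pi) ^ 2 * ‖ξ‖ ^ 2) := by positivity
        nlinarith [mul_le_mul_of_nonneg_right hp (sq_nonneg ‖ξ‖), sq_nonneg κ]
    · filter_upwards [key] with ξ hξ
      unfold symbol at hξ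
      push_cast at hξ ⊢
      linear_combination -hξ

/-! ### The kinetic form -/

/-- The multiplier `2πi ξᵢ / √(4π²|ξ|² + κ²)` is bounded by `1`. -/
theorem exists_hasGradient_sqrtRes (hκ : 0 < κ) (h : L2) : ∃ F, HasGradient (sqrtRes κ h) F := by
  have hb : ∀ i : Fin 3, MemLp (fun ξ : R3 => 2 * Real.pi * Complex.I * (ξ i : ℂ) *
      (((√(symbol κ ξ))⁻¹ : ℝ) : ℂ)) ⊤ (volume : Measure R3) := fun i => by
    refine memLp_top_of_continuous (C := 1) ?_ fun ξ => ?_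
    · refine Continuous.mul (by fun_prop) (Complex.continuous_ofReal.comp
        (Continuous.inv₀ (continuous_symbol κ).sqrt fun ξ => ?_))
      exact (Real.sqrt_pos.2 (symbol_pos hκ ξ)).ne'
    · have hi : |ξ i| ≤ ‖ξ‖ := PiLp.norm_apply_le ξ i
      simp only [norm_mul, Complex.norm_real, Complex.norm_I, norm_inv, Real.norm_eq_abs,
        Complex.norm_ofNat, mul_one, abs_of_pos Real.pi_pos, abs_of_nonneg (Real.sqrt_nonneg _)]
      rw [← div_eq_mul_inv, div_le_one (Real.sqrt_pos.2 (symbol_pos hκ ξ))]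
      refine Real.le_sqrt_of_sq_le ?_
      unfold symbol
      have h2 : |ξ i| ^ 2 ≤ ‖ξ‖ ^ 2 := by gcongr
      have h3 : 0 ≤ (2 * Real.pi) ^ 2 := by positivity
      nlinarith [mul_le_mul_of_nonneg_left h2 h3, sq_nonneg κ]
  refine ⟨fun i => fourierMul (fun ξ : R3 => 2 * Real.pi * Complex.I * (ξ i : ℂ) *
      (((√(symbol κ ξ))⁻¹ : ℝ) : ℂ)) h, hasGradient_iff.2 fun i => ?_⟩
  filter_upwards [fourier_fourierMul_coeFn (hb i) h, fourier_sqrtRes hκ h] with ξ h1 h2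
  rw [h1, h2, mul_assoc]

/-- Plancherel, with `∑ |2πξᵢ|² = symbol - κ²`: in the coordinate `h` of `f = J h`, the kinetic form
plus `κ²` is the plain inner product. -/
theorem sum_inner_gradient (hκ : 0 < κ) {h k : L2} {F Φ : Fin 3 → L2}
    (hF : HasGradient (sqrtRes κ h) F) (hΦ : HasGradient (sqrtRes κ k) Φ) :
    ∑ i, inner ℂ (Φ i) (F i)
      = inner ℂ k h - (κ : ℂ) ^ 2 * inner ℂ (sqrtRes κ k) (sqrtRes κ h) := by
  rw [eq_sub_iff_add_eq]
  have e : ∀ f g : L2, inner ℂ f g = ∫ ξ, conj ((𝓕 f : L2) ξ) * (𝓕 g : L2) ξ := fun f g => by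
    rw [← Lp.inner_fourier_eq, inner_eq_integral]
  simp_rw [e]
  rw [← integral_const_mul, ← integral_finsetSum _ fun i _ => integrable_conj_mul _ _,
    ← integral_add (integrable_finsetSum _ fun i _ => integrable_conj_mul _ _)
      ((integrable_conj_mul _ _).const_mul _)]
  refine integral_congr_ae ?_
  rw [hasGradient_iff] at hF hΦ
  filter_upwards [ae_all_iff.2 hF, ae_all_iff.2 hΦ, fourier_sqrtRes hκ h, fourier_sqrtRes hκ k]
    with ξ h1 h2 h3 h4
  simp only [h1, h2, h3, h4, map_mul, Complex.conj_ofReal, Complex.conj_I, map_ofNat,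
    Fin.sum_univ_three]
  have hs : ‖ξ‖ ^ 2 = ξ 0 ^ 2 + ξ 1 ^ 2 + ξ 2 ^ 2 := by
    rw [EuclideanSpace.norm_sq_eq, Fin.sum_univ_three]
    simp
  have h5 : ((√(symbol κ ξ))⁻¹ * (√(symbol κ ξ))⁻¹) * symbol κ ξ = 1 := by
    rw [← mul_inv, Real.mul_self_sqrt (symbol_pos hκ ξ).le, inv_mul_cancel₀ (symbol_pos hκ ξ).ne']
  have h6 : ((√(symbol κ ξ))⁻¹ : ℂ) * ((√(symbol κ ξ))⁻¹ : ℂ) *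
      ((2 * Real.pi) ^ 2 * ((ξ 0 : ℂ) ^ 2 + (ξ 1 : ℂ) ^ 2 + (ξ 2 : ℂ) ^ 2) + (κ : ℂ) ^ 2) = 1 := by
    have := congrArg (fun t : ℝ => (t : ℂ)) h5
    rw [show symbol κ ξ = (2 * Real.pi) ^ 2 * (ξ 0 ^ 2 + ξ 1 ^ 2 + ξ 2 ^ 2) + κ ^ 2 by
      rw [← hs]; rfl] at this ⊢
    push_cast at this ⊢
    exact this
  have hI : Complex.I * Complex.I = -1 := Complex.I_mul_I
  push_cast
  linear_combination (conj ((𝓕 k : L2) ξ) * (𝓕 h : L2) ξ) * h6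
    - conj ((𝓕 k : L2) ξ) * (𝓕 h : L2) ξ * ((√(symbol κ ξ))⁻¹ : ℂ) * ((√(symbol κ ξ))⁻¹ : ℂ) *
      (2 * Real.pi) ^ 2 * ((ξ 0 : ℂ) ^ 2 + (ξ 1 : ℂ) ^ 2 + (ξ 2 : ℂ) ^ 2) * hI

/-! ### Form sums -/

theorem isSelfAdjoint_mul_inverse_one_add_mul {A : Type*} [Ring A] [StarRing A] {j c : A}
    (hj : IsSelfAdjoint j) (hc : IsSelfAdjoint c) :
    IsSelfAdjoint (j * Ring.inverse (1 + c) * j) := by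
  rw [IsSelfAdjoint, star_mul, star_mul, hj.star_eq, ← Ring.inverse_star, star_add, star_one,
    hc.star_eq, mul_assoc]

theorem apply_inverse_apply {H : Type*} [NormedAddCommGroup H] [NormedSpace ℂ H]
    {L : H →L[ℂ] H} (hL : IsUnit L) (f : H) : L (Ring.inverse L f) = f := by
  rw [← mul_apply_eq_comp, Ring.mul_inverse_cancel _ hL, one_apply_eq_self]

theorem inverse_apply_apply {H : Type*} [NormedAddCommGroup H] [NormedSpace ℂ H]
    {L : H →L[ℂ] H} (hL : IsUnit L) (f : H) : Ring.inverse L (L f) = f := by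
  rw [← mul_apply_eq_comp, Ring.inverse_mul_cancel _ hL, one_apply_eq_self]

/-- The bounded operator `C` represents the form `∫ W f̄ g` on `H¹` with the norm of
`(-Δ + κ²)^{1/2}`. -/
def RepresentsPotential (κ : ℝ) (W : R3 → ℝ) (C : L2 →L[ℂ] L2) : Prop :=
  ∀ k h : L2, Integrable (fun x => (W x : ℂ) * conj (sqrtRes κ k x) * sqrtRes κ h x) ∧
    ∫ x, (W x : ℂ) * conj (sqrtRes κ k x) * sqrtRes κ h x = inner ℂ k (C h)

/-- Every test function in `H¹` is `J k`. Substituting it turns the weak equation into an identity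
of inner products with arbitrary `k ∈ L²`, hence into an equation between vectors. -/
theorem mem_formSumGraph_iff (hκ : 0 < κ) {W : R3 → ℝ} {C : L2 →L[ℂ] L2}
    (hC : RepresentsPotential κ W C) (p : L2 × L2) :
    p ∈ formSumGraph W ↔ ∃ h, p.1 = sqrtRes κ h ∧
      (1 + C) h = sqrtRes κ (p.2 - ((-κ ^ 2 : ℝ) : ℂ) • p.1) := by
  have hmem : p ∈ formSumGraph W ↔ MemH 1 p.1 ∧ ∃ F, HasGradient p.1 F ∧
    ∀ (φ : L2) (Φ : Fin 3 → L2), MemH 1 φ → HasGradient φ Φ →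
      Integrable (fun x => (W x : ℂ) * conj (φ x) * p.1 x) ∧
      ∑ i, inner ℂ (Φ i) (F i) + ∫ x, (W x : ℂ) * conj (φ x) * p.1 x = inner ℂ φ p.2 := Iff.rfl
  have hinner : ∀ k h, inner ℂ k (sqrtRes κ (p.2 - ((-κ ^ 2 : ℝ) : ℂ) • sqrtRes κ h))
      = inner ℂ (sqrtRes κ k) p.2 + (κ : ℂ) ^ 2 * inner ℂ (sqrtRes κ k) (sqrtRes κ h) :=
    fun k h => by
      rw [← inner_sqrtRes hκ, inner_sub_right, inner_smul_right]
      push_cast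
      ring
  rw [hmem, memH_one_iff hκ]
  constructor
  · rintro ⟨⟨h, hh⟩, F, hF, H⟩
    refine ⟨h, hh, ?_⟩
    rw [hh] at hF H ⊢
    refine ext_inner_left ℂ fun k => ?_
    obtain ⟨Φ, hΦ⟩ := exists_hasGradient_sqrtRes hκ k
    have h1 := (H _ Φ ((memH_one_iff hκ).2 ⟨k, rfl⟩) hΦ).2
    rw [sum_inner_gradient hκ hF hΦ, (hC k h).2] at h1
    rw [hinner, add_apply, one_apply_eq_self, inner_add_right, ← h1]
    ring
  · rintro ⟨h, hh, H⟩
    obtain ⟨F, hF⟩ := exists_hasGradient_sqrtRes hκ h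
    rw [hh] at H ⊢
    refine ⟨⟨h, rfl⟩, F, hF, fun φ Φ hφ hΦ => ?_⟩
    obtain ⟨k, rfl⟩ := (memH_one_iff hκ).1 hφ
    refine ⟨(hC k h).1, ?_⟩
    have h1 := congrArg (fun x => (inner ℂ k x : ℂ)) H
    simp only [hinner, add_apply, one_apply_eq_self, inner_add_right] at h1
    rw [sum_inner_gradient hκ hF hΦ, (hC k h).2]
    linear_combination h1

theorem hasRealResolvent_formSum (hκ : 0 < κ) {W : R3 → ℝ} {C : L2 →L[ℂ] L2}
    (hC : RepresentsPotential κ W C) (hCs : IsSelfAdjoint C) (hu : IsUnit (1 + C)) :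
    HasRealResolvent (formSumGraph W) (-κ ^ 2)
      (sqrtRes κ * Ring.inverse (1 + C) * sqrtRes κ) := by
  have hL1 := apply_inverse_apply hu
  have hL2 := inverse_apply_apply hu
  refine ⟨isSelfAdjoint_mul_inverse_one_add_mul (isSelfAdjoint_sqrtRes hκ) hCs, fun f hf => ?_,
    fun p => ?_⟩
  · rw [mul_apply_eq_comp, mul_apply_eq_comp] at hf
    have h1 := sqrtRes_injective hκ _ hf
    have h2 := hL1 (sqrtRes κ f)
    rw [h1, map_zero] at h2
    exact sqrtRes_injective hκ _ h2.symm
  · rw [mem_formSumGraph_iff hκ hC, mul_apply_eq_comp, mul_apply_eq_comp]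
    constructor
    · rintro ⟨h, h1, h2⟩
      rw [← h2, hL2, ← h1]
    · intro h
      exact ⟨_, h, hL1 _⟩

/-- With `f = J h`, the number `⟪h, (1 + C) h⟫` is the energy of `f` plus `κ² ‖f‖²`, so `-κ²` is a
lower bound. -/
theorem lowerSemibounded_formSum (hκ : 0 < κ) {W : R3 → ℝ} {C : L2 →L[ℂ] L2}
    (hC : RepresentsPotential κ W C) (hCs : IsSelfAdjoint C) (hu : IsUnit (1 + C))
    (hpos : ∀ h, 0 ≤ (inner ℂ h ((1 + C) h)).re) : LowerSemibounded (formSum W) := by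
  refine ⟨-κ ^ 2, fun f => ?_⟩
  have h1 := LinearPMap.mem_graph (formSum W) f
  have hg : (formSum W).graph = formSumGraph W := (hasRealResolvent_formSum hκ hC hCs hu).graph_eq
  rw [hg, mem_formSumGraph_iff hκ hC] at h1
  obtain ⟨h, h1, h2⟩ := h1
  simp only at h1 h2
  have h3 : inner ℂ h ((1 + C) h) = inner ℂ (f : L2) (formSum W f)
      + ((κ ^ 2 * ‖(f : L2)‖ ^ 2 : ℝ) : ℂ) := by
    rw [h2, ← inner_sqrtRes hκ, ← h1, inner_sub_right, inner_smul_right,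
      inner_self_eq_norm_sq_to_K]
    push_cast
    simp only [formSum]
    norm_num
  have h4 := hpos h
  rw [h3, Complex.add_re, Complex.ofReal_re] at h4
  linarith

/-! ### The Yukawa potential and its Fourier transform -/

/-- The kernel `exp(-κ|x|) / (4π|x|)` of `(-Δ + κ²)⁻¹`. -/
def yukawa (κ : ℝ) (x : R3) : ℝ := Real.exp (-(κ * ‖x‖)) / (4 * Real.pi * ‖x‖)

theorem green_eq_yukawa (ν : ℝ) : green ν = yukawa √ν := by
  ext x
  rw [green, yukawa, mul_comm]

theorem yukawa_nonneg (κ : ℝ) (x : R3) : 0 ≤ yukawa κ x := by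
  unfold yukawa; positivity

theorem yukawa_neg (κ : ℝ) (x : R3) : yukawa κ (-x) = yukawa κ x := by
  simp [yukawa]

theorem measurable_yukawa (κ : ℝ) : Measurable (yukawa κ) := by
  unfold yukawa; fun_prop

theorem finrank_R3 : Module.finrank ℝ R3 = 3 := by simp

theorem integrable_yukawa (hκ : 0 < κ) : Integrable (yukawa κ) := by
  have h := (integrable_fun_norm_addHaar (volume : Measure R3)
    (f := fun r : ℝ => Real.exp (-(κ * r)) / (4 * Real.pi * r))).2 ?_
  · exact h
  · rw [finrank_R3]
    have h1 := (integrableOn_rpow_mul_exp_neg_mul_rpow (p := 1) (s := 1) (by norm_num)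
      (by norm_num) hκ).const_mul (4 * Real.pi)⁻¹
    refine IntegrableOn.congr_fun h1 (fun r (hr : 0 < r) => ?_) measurableSet_Ioi
    simp only [Real.rpow_one, smul_eq_mul]
    rw [neg_mul]
    field_simp

/-- In dimension three the radial weight `r²` cancels the singularity `1/r²` and leaves a decaying
exponential. -/
theorem integrable_yukawa_sq (hκ : 0 < κ) : Integrable fun x => yukawa κ x ^ 2 := by
  have h := (integrable_fun_norm_addHaar (volume : Measure R3)
    (f := fun r : ℝ => (Real.exp (-(κ * r)) / (4 * Real.pi * r)) ^ 2)).2 ?_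
  · exact h
  · rw [finrank_R3]
    have h1 := (exp_neg_integrableOn_Ioi 0 (b := 2 * κ) (by positivity)).const_mul
      ((4 * Real.pi) ^ 2)⁻¹
    refine IntegrableOn.congr_fun h1 (fun r (hr : 0 < r) => ?_) measurableSet_Ioi
    simp only [smul_eq_mul]
    rw [div_pow, ← Real.exp_nat_mul]
    rw [show ((2 : ℕ) : ℝ) * -(κ * r) = -(2 * κ) * r by push_cast; ring]
    field_simp

theorem memLp_yukawa (hκ : 0 < κ) : MemLp (yukawa κ) 2 :=
  (memLp_two_iff_integrable_sq (measurable_yukawa κ).aestronglyMeasurable).2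
    (integrable_yukawa_sq hκ)

/-- Integration of the Yukawa potential over the plane at height `t`. In polar coordinates the
factor `r` makes the integrand an exact derivative. -/
theorem integral_radial_section (hκ : 0 < κ) {t : ℝ} (ht : t ≠ 0) :
    ∫ p : ℝ × ℝ, Real.exp (-(κ * √(t ^ 2 + p.1 ^ 2 + p.2 ^ 2))) /
      (4 * Real.pi * √(t ^ 2 + p.1 ^ 2 + p.2 ^ 2)) = Real.exp (-(κ * |t|)) / (2 * κ) := by
  rw [← integral_comp_polarCoord_symm, polarCoord_target]
  have e : ∀ p : ℝ × ℝ, t ^ 2 + (polarCoord.symm p).1 ^ 2 + (polarCoord.symm p).2 ^ 2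
      = t ^ 2 + p.1 ^ 2 := fun p => by
    simp only [polarCoord_symm_apply]
    linear_combination p.1 ^ 2 * Real.cos_sq_add_sin_sq p.2
  simp_rw [e, smul_eq_mul]
  have hpos : ∀ r : ℝ, 0 < t ^ 2 + r ^ 2 := fun r => by positivity
  have h1 : ∫ r in Ioi (0 : ℝ), r * (Real.exp (-(κ * √(t ^ 2 + r ^ 2))) /
      (4 * Real.pi * √(t ^ 2 + r ^ 2))) = Real.exp (-(κ * |t|)) / (4 * Real.pi * κ) := by
    have hd : ∀ r ∈ Ici (0 : ℝ), HasDerivAt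
        (fun r => -(Real.exp (-(κ * √(t ^ 2 + r ^ 2))) / (4 * Real.pi * κ)))
        (r * (Real.exp (-(κ * √(t ^ 2 + r ^ 2))) / (4 * Real.pi * √(t ^ 2 + r ^ 2)))) r := by
      intro r _
      have h2 : HasDerivAt (fun r : ℝ => t ^ 2 + r ^ 2) (2 * r) r := by
        simpa using (hasDerivAt_pow 2 r).const_add (t ^ 2)
      have h3 := ((((h2.sqrt (hpos r).ne').const_mul κ).neg.exp).div_const
        (4 * Real.pi * κ)).neg
      refine HasDerivAt.congr_deriv h3 ?_
      have := (Real.sqrt_pos.2 (hpos r)).ne'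
      have := Real.pi_ne_zero
      simp only [Pi.neg_apply]
      field_simp
    have hl : Tendsto (fun r : ℝ => -(Real.exp (-(κ * √(t ^ 2 + r ^ 2))) / (4 * Real.pi * κ)))
        atTop (𝓝 0) := by
      have h2 : Tendsto (fun r : ℝ => √(t ^ 2 + r ^ 2)) atTop atTop :=
        Real.tendsto_sqrt_atTop.comp
          (tendsto_atTop_add_const_left _ _ (tendsto_pow_atTop two_ne_zero))
      have h3 := Real.tendsto_exp_atBot.comp
        (tendsto_neg_atTop_atBot.comp (h2.const_mul_atTop hκ))
      simpa using (h3.div_const (4 * Real.pi * κ)).neg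
    rw [integral_Ioi_of_hasDerivAt_of_nonneg' hd (fun r (hr : 0 < r) => by positivity) hl]
    simp [Real.sqrt_sq_eq_abs]
  have h2 := setIntegral_prod_mul (μ := (volume : Measure ℝ)) (ν := (volume : Measure ℝ))
    (fun r : ℝ => r * (Real.exp (-(κ * √(t ^ 2 + r ^ 2))) / (4 * Real.pi * √(t ^ 2 + r ^ 2))))
    (fun _ : ℝ => (1 : ℝ)) (Ioi 0) (Ioo (-Real.pi) Real.pi)
  simp only [mul_one] at h2
  rw [Measure.volume_eq_prod, h2, h1]
  have := Real.pi_ne_zero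
  simp [Real.pi_pos.le]
  field_simp
  norm_num

/-- The Fourier transform of the one-dimensional Green function, computed on the two half-lines
separately. -/
theorem integral_exp_abs (hκ : 0 < κ) (s : ℝ) :
    ∫ t : ℝ, Complex.exp ((-2 * Real.pi * (s * t) : ℝ) * Complex.I) *
      ((Real.exp (-(κ * |t|)) / (2 * κ) : ℝ) : ℂ)
      = (((2 * Real.pi) ^ 2 * s ^ 2 + κ ^ 2)⁻¹ : ℝ) := by
  set a : ℂ := -(2 * Real.pi * s) * Complex.I with ha
  have e1 : ∀ t ∈ Ioi (0 : ℝ), Complex.exp ((a - κ) * t) / (2 * κ)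
      = Complex.exp ((-2 * Real.pi * (s * t) : ℝ) * Complex.I) *
        ((Real.exp (-(κ * |t|)) / (2 * κ) : ℝ) : ℂ) := fun t (ht : 0 < t) => by
    rw [abs_of_pos ht]
    push_cast
    rw [← mul_div_assoc, ← Complex.exp_add]
    congr 2
    rw [ha]; ring
  have e2 : ∀ t ∈ Iic (0 : ℝ), Complex.exp ((a + κ) * t) / (2 * κ)
      = Complex.exp ((-2 * Real.pi * (s * t) : ℝ) * Complex.I) *
        ((Real.exp (-(κ * |t|)) / (2 * κ) : ℝ) : ℂ) := fun t (ht : t ≤ 0) => by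
    rw [abs_of_nonpos ht]
    push_cast
    rw [← mul_div_assoc, ← Complex.exp_add]
    congr 2
    rw [ha]; ring
  have hr1 : (a - κ).re < 0 := by simp [ha, hκ]
  have hr2 : 0 < (a + κ).re := by simp [ha, hκ]
  have i1 := IntegrableOn.congr_fun
    ((integrableOn_exp_mul_complex_Ioi hr1 0).div_const (2 * (κ : ℂ))) e1 measurableSet_Ioi
  have i2 := IntegrableOn.congr_fun
    ((integrableOn_exp_mul_complex_Iic hr2 0).div_const (2 * (κ : ℂ))) e2 measurableSet_Iic
  rw [← intervalIntegral.integral_Iic_add_Ioi i2 i1, ← setIntegral_congr_fun measurableSet_Iic e2,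
    ← setIntegral_congr_fun measurableSet_Ioi e1, integral_div, integral_div,
    integral_exp_mul_complex_Ioi hr1, integral_exp_mul_complex_Iic hr2]
  have n1 : a - κ ≠ 0 := fun h => by rw [h] at hr1; simp at hr1
  have n2 : a + κ ≠ 0 := fun h => by rw [h] at hr2; simp at hr2
  have n3 : (κ : ℂ) ≠ 0 := by exact_mod_cast hκ.ne'
  have h3 : (((2 * Real.pi) ^ 2 * s ^ 2 + κ ^ 2 : ℝ) : ℂ) = -((a - κ) * (a + κ)) := by
    rw [ha]
    push_cast
    linear_combination (2 * (Real.pi : ℂ) * s) ^ 2 * Complex.I_sq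
  rw [Complex.ofReal_inv, h3]
  simp only [Complex.ofReal_zero, mul_zero, Complex.exp_zero]
  field_simp
  ring

/-- Cartesian coordinates on three-dimensional space. -/
def coordEquiv : R3 ≃ᵐ ℝ × (ℝ × ℝ) :=
  ((MeasurableEquiv.toLp 2 (Fin 3 → ℝ)).symm.trans
    (MeasurableEquiv.piFinSuccAbove (fun _ : Fin 3 => ℝ) 0)).trans
    ((MeasurableEquiv.refl ℝ).prodCongr MeasurableEquiv.finTwoArrow)

theorem coordEquiv_apply (x : R3) : coordEquiv x = (x 0, (x 1, x 2)) := rfl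

theorem measurePreserving_coordEquiv : MeasurePreserving coordEquiv volume volume :=
  (((MeasurePreserving.id volume).prod (volume_preserving_finTwoArrow ℝ)).comp
    (volume_preserving_piFinSuccAbove (fun _ : Fin 3 => ℝ) 0)).comp
    (PiLp.volume_preserving_ofLp (Fin 3))

/-- For a frequency on the first axis the phase depends on one coordinate only, so Fubini integrates
out the orthogonal plane and leaves the one-dimensional transform. -/
theorem fourier_yukawa_single (hκ : 0 < κ) (s : ℝ) :
    𝓕 (fun x => (yukawa κ x : ℂ)) (EuclideanSpace.single 0 s : R3)
      = (((2 * Real.pi) ^ 2 * s ^ 2 + κ ^ 2)⁻¹ : ℝ) := by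
  rw [Real.fourier_eq']
  set Φ : ℝ × (ℝ × ℝ) → ℂ := fun q => Complex.exp ((-2 * Real.pi * (s * q.1) : ℝ) * Complex.I) *
    ((Real.exp (-(κ * √(q.1 ^ 2 + q.2.1 ^ 2 + q.2.2 ^ 2))) /
      (4 * Real.pi * √(q.1 ^ 2 + q.2.1 ^ 2 + q.2.2 ^ 2)) : ℝ) : ℂ) with hΦ
  have e : (fun x : R3 => Complex.exp ((-2 * Real.pi *
      inner ℝ x (EuclideanSpace.single 0 s) : ℝ) * Complex.I) • (yukawa κ x : ℂ))
      = fun x => Φ (coordEquiv x) := by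
    ext x
    have hn : ‖x‖ = √(x 0 ^ 2 + x 1 ^ 2 + x 2 ^ 2) := by
      rw [EuclideanSpace.norm_eq, Fin.sum_univ_three]
      simp
    simp only [hΦ, coordEquiv_apply, yukawa, hn, EuclideanSpace.inner_single_right, smul_eq_mul]
    simp
  have hInt : Integrable Φ := by
    rw [← measurePreserving_coordEquiv.integrable_comp_emb coordEquiv.measurableEmbedding]
    change Integrable (fun x => Φ (coordEquiv x))
    rw [← e]
    refine (integrable_yukawa hκ).ofReal.bdd_mul (c := 1) ?_ (Eventually.of_forall fun x => ?_)
    · exact Continuous.aestronglyMeasurable (by fun_prop)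
    · rw [Complex.norm_exp_ofReal_mul_I]
  rw [e, measurePreserving_coordEquiv.integral_comp', Measure.volume_eq_prod, integral_prod _ hInt,
    ← integral_exp_abs hκ s]
  have hne : ∀ᵐ t : ℝ, t ≠ 0 := by simp [ae_iff]
  refine integral_congr_ae ?_
  filter_upwards [hne] with t ht
  simp only [hΦ]
  rw [integral_const_mul, integral_complex_ofReal, integral_radial_section hκ ht]

/-- The potential is radial, so a reflection exchanging `ξ` with a point of the first axis at the
same distance reduces to the previous case. -/
theorem fourier_yukawa (hκ : 0 < κ) (ξ : R3) :
    𝓕 (fun x => (yukawa κ x : ℂ)) ξ = (((symbol κ ξ)⁻¹ : ℝ) : ℂ) := by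
  have hn : ‖(EuclideanSpace.single 0 ‖ξ‖ : R3)‖ = ‖ξ‖ := by simp
  have h := Real.fourier_comp_linearIsometry
    (Submodule.reflection (ℝ ∙ ((EuclideanSpace.single 0 ‖ξ‖ : R3) - ξ))ᗮ)
    (fun x => (yukawa κ x : ℂ)) (EuclideanSpace.single 0 ‖ξ‖)
  rw [Submodule.reflection_sub hn] at h
  have e : (fun x => (yukawa κ x : ℂ)) ∘
      (Submodule.reflection (ℝ ∙ ((EuclideanSpace.single 0 ‖ξ‖ : R3) - ξ))ᗮ)
      = fun x => (yukawa κ x : ℂ) := by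
    ext x
    simp [yukawa]
  rw [e] at h
  rw [← h, symbol, ← fourier_yukawa_single hκ]

open scoped Convolution

/-! ### The integral kernel of the free resolvent -/

theorem ae_eq_of_integral_schwartz_eq {a b : R3 → ℂ} (ha : LocallyIntegrable a)
    (hb : LocallyIntegrable b) (h : ∀ u : 𝓢(R3, ℂ), ∫ x, u x * a x = ∫ x, u x * b x) :
    a =ᵐ[volume] b := by
  apply ae_eq_of_integral_contDiff_smul_eq ha hb
  intro u u_smooth u_cpt
  have hu₁ : HasCompactSupport (Complex.ofRealCLM ∘ u) := u_cpt.comp_left rfl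
  have hu₂ : ContDiff ℝ ∞ (Complex.ofRealCLM ∘ u) := by fun_prop
  simpa using h (hu₁.toSchwartzMap hu₂)

theorem integral_schwartz_mul_fourier_L2 (u : 𝓢(R3, ℂ)) (g : L2) :
    ∫ x, u x * (𝓕 g : L2) x = ∫ x, (𝓕 u) x * g x := by
  have h := congrArg (fun T : 𝓢'(R3, ℂ) => T u) (fourier_distr g)
  simp only [TemperedDistribution.fourier_apply, Lp.toTemperedDistribution_apply,
    smul_eq_mul] at h
  exact h.symm

theorem integral_schwartz_mul_fourier (u : 𝓢(R3, ℂ)) {a : R3 → ℂ} (ha : Integrable a) :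
    ∫ x, u x * 𝓕 a x = ∫ x, (𝓕 u) x * a x := by
  have h := VectorFourier.integral_fourierIntegral_smul_eq_flip (L := innerₗ R3)
    (μ := volume) (ν := volume) Real.continuous_fourierChar continuous_inner u.integrable ha
  rw [SchwartzMap.fourier_coe]
  simpa using! h.symm

/-- The Yukawa potential as an element of `L²`. -/
def yukawaL2 (hκ : 0 < κ) : L2 := ((memLp_yukawa hκ).ofReal (K := ℂ)).toLp _

theorem yukawaL2_coeFn (hκ : 0 < κ) : yukawaL2 hκ =ᵐ[volume] fun x => (yukawa κ x : ℂ) :=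
  MemLp.coeFn_toLp _

theorem fourier_yukawaL2 (hκ : 0 < κ) :
    ∀ᵐ ξ, (𝓕 (yukawaL2 hκ) : L2) ξ = (((symbol κ ξ)⁻¹ : ℝ) : ℂ) := by
  refine ae_eq_of_integral_schwartz_eq ((Lp.memLp _).locallyIntegrable (by norm_num)) ?_
    fun u => ?_
  · refine Continuous.locallyIntegrable (Complex.continuous_ofReal.comp
      ((continuous_symbol κ).inv₀ fun ξ => (symbol_pos hκ ξ).ne'))
  · simp_rw [integral_schwartz_mul_fourier_L2, ← fourier_yukawa hκ]
    have hG : Integrable fun y => (yukawa κ y : ℂ) := (integrable_yukawa hκ).ofReal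
    rw [integral_schwartz_mul_fourier u hG]
    refine integral_congr_ae ?_
    filter_upwards [yukawaL2_coeFn hκ] with x hx
    rw [hx]

/-- The convolution of `f` with the Yukawa potential. -/
def yukawaConv (κ : ℝ) (f : R3 → ℂ) (x : R3) : ℂ := ∫ y, (yukawa κ (x - y) : ℂ) * f y

theorem yukawaConv_congr {f g : R3 → ℂ} (h : f =ᵐ[volume] g) (x : R3) :
    yukawaConv κ f x = yukawaConv κ g x := by
  refine integral_congr_ae ?_
  filter_upwards [h] with y hy
  rw [hy]

theorem memLp_yukawa_sub (hκ : 0 < κ) (x : R3) :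
    MemLp (fun y => (yukawa κ (x - y) : ℂ)) 2 :=
  ((memLp_yukawa hκ).ofReal (K := ℂ)).comp_measurePreserving
    (Measure.measurePreserving_sub_left volume x)

theorem yukawaConv_eq_inner (hκ : 0 < κ) (f : L2) (x : R3) :
    yukawaConv κ f x = inner ℂ ((memLp_yukawa_sub hκ x).toLp _) f := by
  rw [inner_eq_integral]
  refine integral_congr_ae ?_
  filter_upwards [(memLp_yukawa_sub hκ x).coeFn_toLp] with y hy
  rw [hy, Complex.conj_ofReal]

theorem norm_toLp_yukawa_sub (hκ : 0 < κ) (x : R3) :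
    ‖(memLp_yukawa_sub hκ x).toLp _‖ = ‖yukawaL2 hκ‖ := by
  rw [yukawaL2, Lp.norm_toLp, Lp.norm_toLp]
  congr 1
  exact eLpNorm_comp_measurePreserving (g := fun y => (yukawa κ y : ℂ))
    ((memLp_yukawa hκ).ofReal (K := ℂ)).1 (Measure.measurePreserving_sub_left volume x)

/-- The value at `x` is an inner product with a translate of the Yukawa potential, whose norm does
not depend on `x`. This sup bound gives point values to the free resolvent on `L²`. -/
theorem norm_yukawaConv_le (hκ : 0 < κ) (f : L2) (x : R3) :
    ‖yukawaConv κ f x‖ ≤ ‖yukawaL2 hκ‖ * ‖f‖ := by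
  rw [yukawaConv_eq_inner hκ, ← norm_toLp_yukawa_sub hκ x]
  exact norm_inner_le_norm _ _

theorem norm_yukawaConv_sub_le (hκ : 0 < κ) (f g : L2) (x : R3) :
    ‖yukawaConv κ f x - yukawaConv κ g x‖ ≤ ‖yukawaL2 hκ‖ * ‖f - g‖ := by
  rw [yukawaConv_eq_inner hκ, yukawaConv_eq_inner hκ, ← inner_sub_right,
    ← norm_toLp_yukawa_sub hκ x]
  exact norm_inner_le_norm _ _

theorem yukawaConv_zero (hκ : 0 < κ) (f : L2) : yukawaConv κ f 0 = inner ℂ (yukawaL2 hκ) f := by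
  rw [inner_eq_integral]
  refine integral_congr_ae ?_
  filter_upwards [yukawaL2_coeFn hκ] with y hy
  rw [hy, Complex.conj_ofReal, zero_sub, yukawa_neg]

theorem yukawaConv_eq_convolution (f : R3 → ℂ) :
    yukawaConv κ f = (fun y => (yukawa κ y : ℂ)) ⋆[ContinuousLinearMap.mul ℂ ℂ] f := by
  ext x
  rw [convolution_mul_swap]
  rfl

theorem freeRes_schwartz (hκ : 0 < κ) (f : 𝓢(R3, ℂ)) :
    freeRes κ (f.toLp 2) =ᵐ[volume] yukawaConv κ f := by
  have hG : Integrable fun y => (yukawa κ y : ℂ) := (integrable_yukawa hκ).ofReal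
  have hInt : Integrable (yukawaConv κ f) := by
    rw [yukawaConv_eq_convolution]
    exact hG.integrable_convolution _ f.integrable
  refine ae_eq_of_integral_schwartz_eq ((Lp.memLp _).locallyIntegrable (by norm_num))
    hInt.locallyIntegrable fun u => ?_
  obtain ⟨w, rfl⟩ : ∃ w : 𝓢(R3, ℂ), u = 𝓕 w :=
    ⟨𝓕⁻ u, (FourierTransform.fourier_fourierInv_eq u).symm⟩
  rw [← integral_schwartz_mul_fourier_L2, ← integral_schwartz_mul_fourier w hInt]
  refine integral_congr_ae ?_
  have h1 := fourier_freeRes hκ (f.toLp 2)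
  rw [SchwartzMap.toLp_fourier_eq] at h1
  filter_upwards [h1, (𝓕 f).coeFn_toLp 2 volume] with ξ h2 h3
  rw [h2, h3, yukawaConv_eq_convolution, Real.fourier_mul_convolution_eq hG f.integrable,
    fourier_yukawa hκ, SchwartzMap.fourier_coe]

theorem continuous_yukawaConv_schwartz (hκ : 0 < κ) (f : 𝓢(R3, ℂ)) :
    Continuous (yukawaConv κ f) := by
  rw [yukawaConv_eq_convolution]
  refine BddAbove.continuous_convolution_right_of_integrable _ ?_ (integrable_yukawa hκ).ofReal
    f.continuous
  obtain ⟨C, hC⟩ := f.toBoundedContinuousFunction.isBounded_range.exists_norm_le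
  exact ⟨C, by rintro _ ⟨x, rfl⟩; exact hC _ ⟨x, rfl⟩⟩

theorem exists_schwartz_tendsto (f : L2) :
    ∃ u : ℕ → 𝓢(R3, ℂ), Tendsto (fun n => ((u n).toLp 2 volume : L2)) atTop (𝓝 f) := by
  have h : f ∈ closure (range (SchwartzMap.toLpCLM ℝ ℂ 2 (volume : Measure R3))) :=
    SchwartzMap.denseRange_toLpCLM (by norm_num) f
  obtain ⟨x, hx, hlim⟩ := mem_closure_iff_seq_limit.1 h
  choose u hu using hx
  exact ⟨u, hlim.congr fun n => (hu n).symm⟩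

/-- By the sup bound, approximating `f` by Schwartz functions in `L²` gives uniform convergence of
the convolutions. -/
theorem continuous_yukawaConv (hκ : 0 < κ) (f : L2) : Continuous (yukawaConv κ f) := by
  obtain ⟨u, hu⟩ := exists_schwartz_tendsto f
  have hlim : TendstoUniformly (fun n => yukawaConv κ (u n)) (yukawaConv κ f) atTop := by
    rw [Metric.tendstoUniformly_iff]
    intro δ hδ
    have h0 : Tendsto (fun n => ‖yukawaL2 hκ‖ * ‖f - ((u n).toLp 2 volume : L2)‖) atTop (𝓝 0) := by
      simpa using (((tendsto_const_nhds (x := f)).sub hu).norm).const_mul ‖yukawaL2 hκ‖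
    filter_upwards [h0.eventually_lt_const hδ] with n hn x
    rw [dist_eq_norm, ← yukawaConv_congr ((u n).coeFn_toLp 2 volume)]
    exact (norm_yukawaConv_sub_le hκ _ _ x).trans_lt hn
  exact hlim.continuous (Frequently.of_forall fun n => continuous_yukawaConv_schwartz hκ (u n))

/-- The free resolvent is convolution with the Yukawa potential. -/
theorem freeRes_coeFn (hκ : 0 < κ) (f : L2) : freeRes κ f =ᵐ[volume] yukawaConv κ f := by
  obtain ⟨u, hu⟩ := exists_schwartz_tendsto f
  have h1 : Tendsto (fun n => freeRes κ ((u n).toLp 2)) atTop (𝓝 (freeRes κ f)) :=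
    ((freeRes κ).continuous.tendsto f).comp hu
  -- Along a subsequence the `L²` limit is also an almost everywhere limit, to be compared with the
  -- pointwise limit of the convolutions.
  obtain ⟨ns, hns, hae⟩ := (tendstoInMeasure_of_tendsto_Lp h1).exists_seq_tendsto_ae
  filter_upwards [hae, ae_all_iff.2 fun n => freeRes_schwartz hκ (u n)] with x h2 h3
  refine tendsto_nhds_unique h2 ?_
  rw [tendsto_iff_norm_sub_tendsto_zero]
  have h0 : Tendsto (fun n => ‖yukawaL2 hκ‖ * ‖((u (ns n)).toLp 2 volume : L2) - f‖)
      atTop (𝓝 0) := by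
    have := ((hu.comp hns.tendsto_atTop).sub_const f).norm.const_mul ‖yukawaL2 hκ‖
    simpa using this
  refine squeeze_zero (fun _ => norm_nonneg _) (fun n => ?_) h0
  rw [h3, ← yukawaConv_congr ((u (ns n)).coeFn_toLp 2 volume)]
  exact norm_yukawaConv_sub_le hκ _ _ x

/-! ### The point interaction -/

theorem not_memLp_const {c : ℂ} (hc : c ≠ 0) : ¬ MemLp (fun _ : R3 => c) 2 volume := by
  rw [memLp_const_iff (by norm_num) (by norm_num)]
  simp [hc]

theorem isSelfAdjoint_rankOne (a : L2) : IsSelfAdjoint (rankOne a a) := by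
  rw [ContinuousLinearMap.isSelfAdjoint_iff', eq_comm, ContinuousLinearMap.eq_adjoint_iff]
  intro x y
  rw [rankOne_apply, rankOne_apply, inner_smul_left, inner_smul_right, inner_conj_symm]
  ring

theorem freeRes_add_smul_yukawaL2_coeFn (hκ : 0 < κ) (f : L2) (c : ℂ) :
    (freeRes κ f + c • yukawaL2 hκ : L2) =ᵐ[volume]
      fun x => freeRes κ f x + c * (yukawa κ x : ℂ) := by
  filter_upwards [Lp.coeFn_add (freeRes κ f) (c • yukawaL2 hκ),
    Lp.coeFn_smul c (yukawaL2 hκ), yukawaL2_coeFn hκ] with x h1 h2 h3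
  rw [h1, Pi.add_apply, h2, Pi.smul_apply, h3, smul_eq_mul]

/-- The Yukawa potential is the free resolvent of the delta function: `f` would have the constant
`c` as its Fourier transform, and a nonzero constant is not square integrable. -/
theorem eq_zero_of_freeRes_eq_smul_yukawaL2 (hκ : 0 < κ) {f : L2} {c : ℂ}
    (h : freeRes κ f = c • yukawaL2 hκ) : c = 0 := by
  have h2 : ∀ᵐ ξ, (𝓕 f : L2) ξ = c := by
    have h3 := fourier_freeRes hκ f
    rw [h, show (𝓕 (c • yukawaL2 hκ) : L2) = c • (𝓕 (yukawaL2 hκ) : L2) from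
      (Lp.fourierTransformₗᵢ R3 ℂ).map_smul c (yukawaL2 hκ)] at h3
    filter_upwards [h3, Lp.coeFn_smul c (𝓕 (yukawaL2 hκ) : L2), fourier_yukawaL2 hκ]
      with ξ h4 h5 h6
    rw [h5, Pi.smul_apply, h6, smul_eq_mul, mul_comm] at h4
    refine (mul_left_cancel₀ ?_ h4).symm
    exact_mod_cast (inv_pos.2 (symbol_pos hκ ξ)).ne'
  by_contra hc0
  exact not_memLp_const hc0 ((Lp.memLp (𝓕 f : L2)).ae_eq h2)

/-- Krein's formula for the resolvent of the point interaction. -/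
def pointRes (hκ : 0 < κ) (a : ℝ) : L2 →L[ℂ] L2 :=
  freeRes κ + ((a⁻¹ : ℝ) : ℂ) • rankOne (yukawaL2 hκ) (yukawaL2 hκ)

theorem pointRes_apply (hκ : 0 < κ) (a : ℝ) (f : L2) :
    pointRes hκ a f = freeRes κ f + (yukawaConv κ f 0 / (a : ℂ)) • yukawaL2 hκ := by
  rw [pointRes, add_apply, smul_apply, rankOne_apply, smul_smul, Complex.ofReal_inv, mul_comm,
    div_eq_mul_inv, yukawaConv_zero hκ]

theorem isSelfAdjoint_pointRes (hκ : 0 < κ) (a : ℝ) : IsSelfAdjoint (pointRes hκ a) := by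
  refine (isSelfAdjoint_freeRes hκ).add (IsSelfAdjoint.smul ?_ (isSelfAdjoint_rankOne _))
  exact Complex.conj_ofReal _

theorem pointRes_injective (hκ : 0 < κ) (a : ℝ) (f : L2) (hf : pointRes hκ a f = 0) : f = 0 := by
  rw [pointRes_apply] at hf
  have h1 := (eq_neg_of_add_eq_zero_left hf).trans (neg_smul _ _).symm
  have h2 := eq_zero_of_freeRes_eq_smul_yukawaL2 hκ h1
  rw [h2, zero_smul] at h1
  exact freeRes_injective hκ f h1

theorem sub_ofReal_neg_smul {E : Type*} [AddCommGroup E] [Module ℂ E] (ν : ℝ) (x y : E) :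
    x - ((-ν : ℝ) : ℂ) • y = x + (ν : ℂ) • y := by
  rw [Complex.ofReal_neg, neg_smul, sub_neg_eq_add]

theorem mem_negLaplacianGraph_iff {ν : ℝ} (hν : 0 < ν) (q : L2 × L2) :
    q ∈ negLaplacianGraph ↔ q.1 = freeRes √ν (q.2 + (ν : ℂ) • q.1) := by
  have h := (hasRealResolvent_negLaplacian (Real.sqrt_pos.2 hν)).mem_iff q
  rwa [Real.sq_sqrt hν.le, sub_ofReal_neg_smul] at h

/-- With `h = p.2 + ν p.1`, the regular part is the free resolvent of `h`. Its continuous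
representative is unique, hence equals the convolution, and its value at the origin is `⟪G, h⟫`, the
coefficient in Krein's formula. -/
theorem mem_pointInteractionGraph_iff {α ν : ℝ} (hν : 0 < ν) (p : L2 × L2) :
    p ∈ pointInteractionGraph α ν ↔
      p.1 = pointRes (Real.sqrt_pos.2 hν) (α + √ν / (4 * Real.pi)) (p.2 + (ν : ℂ) • p.1) := by
  have hκ : 0 < √ν := Real.sqrt_pos.2 hν
  have hae := fun h : L2 => freeRes_add_smul_yukawaL2_coeFn hκ h
    (yukawaConv √ν h 0 / ((α + √ν / (4 * Real.pi) : ℝ) : ℂ))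
  rw [pointRes_apply]
  constructor
  · rintro ⟨q, hq, c, hc, hqc, hp, e⟩
    rw [mem_negLaplacianGraph_iff hν, ← e] at hq
    generalize p.2 + (ν : ℂ) • p.1 = h at hq ⊢
    have hceq : c = yukawaConv √ν h :=
      (Continuous.ae_eq_iff_eq volume hc (continuous_yukawaConv hκ h)).1
        (hqc.symm.trans (by rw [hq]; exact freeRes_coeFn hκ h))
    refine Lp.ext (hp.trans ?_)
    rw [hq, hceq, green_eq_yukawa]
    exact (hae h).symm
  · intro hp
    generalize hh : p.2 + (ν : ℂ) • p.1 = h at hp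
    refine ⟨(freeRes √ν h, h - (ν : ℂ) • freeRes √ν h), ?_, yukawaConv √ν h,
      continuous_yukawaConv hκ h, freeRes_coeFn hκ h, ?_, ?_⟩
    · rw [mem_negLaplacianGraph_iff hν, sub_add_cancel]
    · rw [hp, green_eq_yukawa]
      exact hae h
    · rw [hh, sub_add_cancel]

theorem hasRealResolvent_pointInteraction {α ν : ℝ} (hν : 0 < ν) :
    HasRealResolvent (pointInteractionGraph α ν) (-ν)
      (pointRes (Real.sqrt_pos.2 hν) (α + √ν / (4 * Real.pi))) :=
  ⟨isSelfAdjoint_pointRes _ _, pointRes_injective _ _, fun p => by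
    rw [mem_pointInteractionGraph_iff hν, sub_ofReal_neg_smul]⟩

/-! ### Hilbert–Schmidt integral operators -/

/-- The measure on `ℝ³ × ℝ³` underlying integral kernels. -/
abbrev vol2 : Measure (R3 × R3) := (volume : Measure R3).prod volume

/-- The integral of `f` against the kernel `k`. -/
def kernelInt (k : R3 × R3 → ℝ) (f : R3 → ℂ) (x : R3) : ℂ := ∫ y, (k (x, y) : ℂ) * f y

variable {k k' : R3 × R3 → ℝ}

theorem ae_memLp_section (hk : MemLp k 2 vol2) :
    ∀ᵐ x, MemLp (fun y => (k (x, y) : ℂ)) 2 (volume : Measure R3) := by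
  have h1 : Integrable (fun p => k p ^ 2) vol2 := hk.integrable_sq
  filter_upwards [h1.prod_right_ae, hk.1.prodMk_left] with x h2 h3
  exact MemLp.ofReal ((memLp_two_iff_integrable_sq h3).2 h2)

theorem norm_toLp_sq {f : R3 → ℂ} (hf : MemLp f 2) : ‖(hf.toLp f : L2)‖ ^ 2 = ∫ x, ‖f x‖ ^ 2 := by
  have h : (‖(hf.toLp f : L2)‖ ^ 2 : ℝ) = (inner ℂ (hf.toLp f) (hf.toLp f) : ℂ).re :=
    norm_sq_eq_re_inner (𝕜 := ℂ) _
  rw [h, inner_eq_integral]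
  have h2 : ∫ x, conj (hf.toLp f x) * hf.toLp f x = ∫ x, ((‖f x‖ ^ 2 : ℝ) : ℂ) := by
    refine integral_congr_ae ?_
    filter_upwards [hf.coeFn_toLp] with x hx
    rw [hx, Complex.conj_mul', Complex.ofReal_pow]
  rw [h2, integral_complex_ofReal, Complex.ofReal_re]

theorem norm_sq_eq_integral (f : L2) : ‖f‖ ^ 2 = ∫ x, ‖f x‖ ^ 2 := by
  conv_lhs => rw [← Lp.toLp_coeFn f (Lp.memLp f)]
  exact norm_toLp_sq _

theorem kernelInt_eq_inner {x : R3} (hx : MemLp (fun y => (k (x, y) : ℂ)) 2 (volume : Measure R3))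
    (f : L2) : kernelInt k f x = inner ℂ (hx.toLp _) f := by
  rw [inner_eq_integral]
  refine integral_congr_ae ?_
  filter_upwards [hx.coeFn_toLp] with y hy
  rw [hy, Complex.conj_ofReal]

theorem norm_kernelInt_sq_le (hk : MemLp k 2 vol2) (f : L2) :
    ∀ᵐ x, ‖kernelInt k f x‖ ^ 2 ≤ (∫ y, k (x, y) ^ 2) * ‖f‖ ^ 2 := by
  filter_upwards [ae_memLp_section hk] with x hx
  have h : (∫ y, k (x, y) ^ 2) = ‖(hx.toLp _ : L2)‖ ^ 2 := by
    rw [norm_toLp_sq]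
    simp
  rw [kernelInt_eq_inner hx, h, ← mul_pow]
  exact pow_le_pow_left₀ (norm_nonneg _) (norm_inner_le_norm _ _) 2

theorem aestronglyMeasurable_kernelInt (hk : AEStronglyMeasurable k vol2) (f : L2) :
    AEStronglyMeasurable (kernelInt k f) volume := by
  refine AEStronglyMeasurable.integral_prod_right' (f := fun p : R3 × R3 => (k p : ℂ) * f p.2) ?_
  exact (Complex.continuous_ofReal.comp_aestronglyMeasurable hk).mul
    (Lp.aestronglyMeasurable f).comp_snd

theorem memLp_kernelInt (hk : MemLp k 2 vol2) (f : L2) : MemLp (kernelInt k f) 2 := by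
  have hm := aestronglyMeasurable_kernelInt hk.1 f
  rw [memLp_two_iff_integrable_sq_norm hm]
  refine (hk.integrable_sq.integral_prod_left.mul_const (‖f‖ ^ 2)).mono' (hm.norm.pow 2) ?_
  filter_upwards [norm_kernelInt_sq_le hk f] with x hx
  rwa [Real.norm_of_nonneg (by positivity)]

theorem integral_norm_kernelInt_sq_le (hk : MemLp k 2 vol2) (f : L2) :
    ∫ x, ‖kernelInt k f x‖ ^ 2 ≤ (∫ p, k p ^ 2 ∂vol2) * ‖f‖ ^ 2 := by
  rw [integral_prod _ hk.integrable_sq, ← integral_mul_const]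
  exact integral_mono_ae
    ((memLp_two_iff_integrable_sq_norm (memLp_kernelInt hk f).1).1 (memLp_kernelInt hk f))
    (hk.integrable_sq.integral_prod_left.mul_const _) (norm_kernelInt_sq_le hk f)

theorem ae_integrable_kernel_mul (hk : MemLp k 2 vol2) (f : L2) :
    ∀ᵐ x, Integrable fun y => (k (x, y) : ℂ) * f y := by
  filter_upwards [ae_memLp_section hk] with x hx
  exact hx.integrable_mul (Lp.memLp f)

theorem kernelInt_add (hk : MemLp k 2 vol2) (f g : L2) :
    kernelInt k (f + g : L2) =ᵐ[volume] kernelInt k f + kernelInt k g := by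
  filter_upwards [ae_integrable_kernel_mul hk f, ae_integrable_kernel_mul hk g] with x h1 h2
  rw [Pi.add_apply, kernelInt, kernelInt, kernelInt, ← integral_add h1 h2]
  refine integral_congr_ae ?_
  filter_upwards [Lp.coeFn_add f g] with y hy
  rw [hy, Pi.add_apply, mul_add]

theorem kernelInt_smul (k : R3 × R3 → ℝ) (c : ℂ) (f : L2) :
    kernelInt k (c • f : L2) = c • kernelInt k f := by
  ext x
  rw [Pi.smul_apply, kernelInt, kernelInt, smul_eq_mul, ← integral_const_mul]
  refine integral_congr_ae ?_
  filter_upwards [Lp.coeFn_smul c f] with y hy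
  rw [hy, Pi.smul_apply, smul_eq_mul, mul_left_comm]

/-- The linear map with square integrable kernel `k`. -/
def hsLin (hk : MemLp k 2 vol2) : L2 →ₗ[ℂ] L2 where
  toFun f := (memLp_kernelInt hk f).toLp _
  map_add' f g := (MemLp.toLp_congr _ ((memLp_kernelInt hk f).add (memLp_kernelInt hk g))
    (kernelInt_add hk f g)).trans (MemLp.toLp_add _ _)
  map_smul' c f := (MemLp.toLp_congr _ ((memLp_kernelInt hk f).const_smul c)
    (Eventually.of_forall fun x => congrFun (kernelInt_smul k c f) x)).trans
      (MemLp.toLp_const_smul c _)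

theorem norm_hsLin_le (hk : MemLp k 2 vol2) (f : L2) :
    ‖hsLin hk f‖ ≤ √(∫ p, k p ^ 2 ∂vol2) * ‖f‖ := by
  refine (abs_le_of_sq_le_sq' ?_ (by positivity)).2
  rw [mul_pow, Real.sq_sqrt (integral_nonneg fun _ => sq_nonneg _)]
  exact (norm_toLp_sq (memLp_kernelInt hk f)).trans_le (integral_norm_kernelInt_sq_le hk f)

open Classical in
/-- The Hilbert–Schmidt operator with kernel `k`, which is zero unless `k` is square integrable. -/
def hsOp (k : R3 × R3 → ℝ) : L2 →L[ℂ] L2 :=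
  if hk : MemLp k 2 vol2 then (hsLin hk).mkContinuous √(∫ p, k p ^ 2 ∂vol2) (norm_hsLin_le hk)
  else 0

theorem hsOp_coeFn (hk : MemLp k 2 vol2) (f : L2) : hsOp k f =ᵐ[volume] kernelInt k f := by
  rw [hsOp, dif_pos hk]
  exact (memLp_kernelInt hk f).coeFn_toLp

theorem norm_hsOp_le (k : R3 × R3 → ℝ) : ‖hsOp k‖ ≤ √(∫ p, k p ^ 2 ∂vol2) := by
  rw [hsOp]
  split_ifs
  · exact LinearMap.mkContinuous_norm_le _ (Real.sqrt_nonneg _) _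
  · rw [norm_zero]
    exact Real.sqrt_nonneg _

/-- A bounded operator given by a square integrable kernel is `hsOp`. -/
theorem eq_hsOp (hk : MemLp k 2 vol2) {K : L2 →L[ℂ] L2}
    (h : ∀ f : L2, K f =ᵐ[volume] kernelInt k f) : K = hsOp k :=
  ContinuousLinearMap.ext fun f => Lp.ext ((h f).trans (hsOp_coeFn hk f).symm)

theorem hsOp_sub (hk : MemLp k 2 vol2) (hk' : MemLp k' 2 vol2) :
    hsOp (fun p => k p - k' p) = hsOp k - hsOp k' := by
  have hkk : MemLp (fun p => k p - k' p) 2 vol2 := hk.sub hk'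
  refine (eq_hsOp hkk fun f => ?_).symm
  filter_upwards [Lp.coeFn_sub (hsOp k f) (hsOp k' f), hsOp_coeFn hk f, hsOp_coeFn hk' f,
    ae_integrable_kernel_mul hk f, ae_integrable_kernel_mul hk' f] with x h1 h2 h3 h4 h5
  rw [sub_apply, h1, Pi.sub_apply, h2, h3, kernelInt, kernelInt, kernelInt, ← integral_sub h4 h5]
  refine integral_congr_ae (Eventually.of_forall fun y => ?_)
  simp only [Complex.ofReal_sub]
  ring

theorem hsOp_const_mul (hk : MemLp k 2 vol2) (c : ℝ) :
    hsOp (fun p => c * k p) = (c : ℂ) • hsOp k := by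
  refine (eq_hsOp (hk.const_mul c) fun f => ?_).symm
  filter_upwards [Lp.coeFn_smul (c : ℂ) (hsOp k f), hsOp_coeFn hk f] with x h1 h2
  rw [smul_apply, h1, Pi.smul_apply, h2, kernelInt, kernelInt, smul_eq_mul, ← integral_const_mul]
  refine integral_congr_ae (Eventually.of_forall fun y => ?_)
  simp only [Complex.ofReal_mul]
  ring

/-- The operator norm is at most the `L²` norm of the kernel, so dominated convergence of kernels
gives norm convergence of operators. -/
theorem tendsto_hsOp {ι : Type*} {l : Filter ι} [l.IsCountablyGenerated]
    {K : ι → R3 × R3 → ℝ} {g : R3 × R3 → ℝ} (hK : ∀ᶠ i in l, AEStronglyMeasurable (K i) vol2)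
    (hk : AEStronglyMeasurable k vol2) (hg : MemLp g 2 vol2)
    (hKg : ∀ᶠ i in l, ∀ᵐ p ∂vol2, |K i p| ≤ g p) (hkg : ∀ᵐ p ∂vol2, |k p| ≤ g p)
    (hlim : ∀ᵐ p ∂vol2, Tendsto (fun i => K i p) l (𝓝 (k p))) :
    Tendsto (fun i => hsOp (K i)) l (𝓝 (hsOp k)) := by
  have hk2 : MemLp k 2 vol2 := hg.mono' hk hkg
  rw [tendsto_iff_norm_sub_tendsto_zero]
  have h0 : Tendsto (fun i => √(∫ p, (K i p - k p) ^ 2 ∂vol2)) l (𝓝 0) := by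
    rw [← Real.sqrt_zero]
    refine (Real.continuous_sqrt.tendsto 0).comp ?_
    rw [← integral_zero (R3 × R3) ℝ (μ := vol2)]
    refine tendsto_integral_filter_of_dominated_convergence (fun p => (2 * g p) ^ 2) ?_ ?_
      (hg.const_mul 2).integrable_sq ?_
    · filter_upwards [hK] with i hi
      exact (hi.sub hk).pow 2
    · filter_upwards [hKg] with i hi
      filter_upwards [hi, hkg] with p h1 h2
      rw [norm_pow, Real.norm_eq_abs]
      refine pow_le_pow_left₀ (abs_nonneg _) ((abs_sub _ _).trans ?_) 2
      linarith
    · filter_upwards [hlim] with p hp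
      have := (hp.sub_const (k p)).pow 2
      simpa using this
  refine squeeze_zero' (Eventually.of_forall fun _ => norm_nonneg _) ?_ h0
  filter_upwards [hK, hKg] with i h1 h2
  rw [← hsOp_sub (hg.mono' h1 h2) hk2]
  exact norm_hsOp_le _

theorem memLp_mul_prod {a b : R3 → ℝ} (ha : MemLp a 2) (hb : MemLp b 2) :
    MemLp (fun p : R3 × R3 => a p.1 * b p.2) 2 vol2 := by
  refine (memLp_two_iff_integrable_sq (ha.1.comp_fst.mul hb.1.comp_snd)).2 ?_
  simpa only [Pi.mul_apply, mul_pow] using ha.integrable_sq.mul_prod hb.integrable_sq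

theorem hsOp_mul_prod {a b : R3 → ℝ} (ha : MemLp a 2) (hb : MemLp b 2) :
    hsOp (fun p => a p.1 * b p.2) =
      rankOne ((ha.ofReal (K := ℂ)).toLp _) ((hb.ofReal (K := ℂ)).toLp _) := by
  refine (eq_hsOp (memLp_mul_prod ha hb) fun f => ?_).symm
  have ha' : MemLp (fun x => (a x : ℂ)) 2 volume := ha.ofReal
  have hb' : MemLp (fun x => (b x : ℂ)) 2 volume := hb.ofReal
  have h2 : inner ℂ (hb'.toLp _) f = ∫ y, (b y : ℂ) * f y := by
    rw [inner_eq_integral]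
    refine integral_congr_ae ?_
    filter_upwards [hb'.coeFn_toLp] with y hy
    rw [hy, Complex.conj_ofReal]
  filter_upwards [Lp.coeFn_smul (inner ℂ (hb'.toLp _) f) (ha'.toLp _), ha'.coeFn_toLp] with x h1 h3
  refine (congrArg (fun g : L2 => g x) (rankOne_apply (ha'.toLp _) (hb'.toLp _) f)).trans ?_
  rw [h1, Pi.smul_apply, h3, h2, kernelInt, smul_eq_mul, ← integral_mul_const]
  refine integral_congr_ae (Eventually.of_forall fun y => ?_)
  simp only [Complex.ofReal_mul]
  ring

/-- An operator that is square summable on a Hilbert basis is compact. -/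
theorem isCompactOperator_of_summable_norm_sq {H ι : Type*} [NormedAddCommGroup H]
    [InnerProductSpace ℂ H] [CompleteSpace H] (b : HilbertBasis ι ℂ H) (K : H →L[ℂ] H)
    (hK : Summable fun i => ‖K (b i)‖ ^ 2) : IsCompactOperator K := by
  classical
  have hmem : K ∈ closure {T : H →L[ℂ] H | IsCompactOperator T} := by
    rw [Metric.mem_closure_iff]
    intro δ hδ
    obtain ⟨F, hF⟩ := summable_iff_vanishing_norm.1 hK ((δ / 2) ^ 2) (by positivity)
    -- The finite-rank operator that agrees with `K` on the basis vectors in `F`. Cauchy–Schwarz and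
    -- Bessel bound the remainder by the tail of the sum of squares.
    refine ⟨∑ i ∈ F, rankOne (K (b i)) (b i), ?_, ?_⟩
    · have : ∀ s : Finset ι,
          IsCompactOperator (∑ i ∈ s, rankOne (K (b i)) (b i) : H →L[ℂ] H) := by
        intro s
        induction s using Finset.induction_on with
        | empty => simpa using! isCompactOperator_zero
        | insert i s hi ih =>
          rw [Finset.sum_insert hi]
          exact (isCompactOperator_rankOne _ _).add ih
      exact this F
    · rw [dist_eq_norm]
      refine lt_of_le_of_lt ?_ (half_lt_self hδ)
      refine ContinuousLinearMap.opNorm_le_bound _ (by positivity) fun f => ?_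
      have h1 : HasSum (fun i => inner ℂ (b i) f • K (b i)) (K f) := by
        have := (b.hasSum_repr f).mapL K
        simpa [b.repr_apply_apply] using this
      have h2 : Tendsto (fun s : Finset ι => ‖∑ i ∈ s, inner ℂ (b i) f • K (b i)
          - ∑ i ∈ F, inner ℂ (b i) f • K (b i)‖) atTop
          (𝓝 ‖K f - ∑ i ∈ F, inner ℂ (b i) f • K (b i)‖) := (h1.sub_const _).norm
      rw [sub_apply, sum_apply]
      simp_rw [rankOne_apply]
      refine le_of_tendsto h2 ?_
      filter_upwards [eventually_ge_atTop F] with s hs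
      rw [← Finset.sum_sdiff hs, add_sub_cancel_right]
      have h3 : (∑ i ∈ s \ F, ‖K (b i)‖ ^ 2) ≤ (δ / 2) ^ 2 :=
        (le_abs_self _).trans (hF _ Finset.sdiff_disjoint).le
      have h4 : (∑ i ∈ s \ F, ‖inner ℂ (b i) f‖ ^ 2) ≤ ‖f‖ ^ 2 :=
        b.orthonormal.sum_inner_products_le f
      refine (norm_sum_le _ _).trans ?_
      simp_rw [norm_smul]
      refine (abs_le_of_sq_le_sq' ?_ (by positivity)).2
      calc (∑ i ∈ s \ F, ‖inner ℂ (b i) f‖ * ‖K (b i)‖) ^ 2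
          ≤ (∑ i ∈ s \ F, ‖inner ℂ (b i) f‖ ^ 2) * ∑ i ∈ s \ F, ‖K (b i)‖ ^ 2 :=
            Finset.sum_mul_sq_le_sq_mul_sq _ _ _
        _ ≤ ‖f‖ ^ 2 * (δ / 2) ^ 2 := by gcongr
        _ = (δ / 2 * ‖f‖) ^ 2 := by ring
  rwa [(isClosed_setOfPred_isCompactOperator (σ₁₂ := RingHom.id ℂ)).closure_eq] at hmem

/-- Bessel's inequality for almost every section `k(x, ·)`, integrated in `x`. -/
theorem sum_norm_hsOp_sq_le (hk : MemLp k 2 vol2) {ι : Type*} {b : ι → L2}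
    (hb : Orthonormal ℂ b) (s : Finset ι) :
    ∑ i ∈ s, ‖hsOp k (b i)‖ ^ 2 ≤ ∫ p, k p ^ 2 ∂vol2 := by
  have h1 : ∀ i, ‖hsOp k (b i)‖ ^ 2 = ∫ x, ‖kernelInt k (b i) x‖ ^ 2 := fun i => by
    rw [norm_sq_eq_integral]
    refine integral_congr_ae ?_
    filter_upwards [hsOp_coeFn hk (b i)] with x hx
    rw [hx]
  have h2 : ∀ i, Integrable fun x => ‖kernelInt k (b i) x‖ ^ 2 := fun i =>
    (memLp_two_iff_integrable_sq_norm (memLp_kernelInt hk (b i)).1).1 (memLp_kernelInt hk (b i))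
  simp_rw [h1]
  rw [← integral_finsetSum _ fun i _ => h2 i, integral_prod _ hk.integrable_sq]
  refine integral_mono_ae (integrable_finsetSum _ fun i _ => h2 i)
    hk.integrable_sq.integral_prod_left ?_
  filter_upwards [ae_memLp_section hk] with x hx
  have h : (∫ y, k (x, y) ^ 2) = ‖(hx.toLp _ : L2)‖ ^ 2 := by
    rw [norm_toLp_sq]
    simp
  simp_rw [h, kernelInt_eq_inner hx, norm_inner_symm (hx.toLp _)]
  exact hb.sum_inner_products_le _

theorem isCompactOperator_hsOp (k : R3 × R3 → ℝ) : IsCompactOperator (hsOp k) := by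
  by_cases hk : MemLp k 2 vol2
  · obtain ⟨w, b, -⟩ := exists_hilbertBasis ℂ L2
    exact isCompactOperator_of_summable_norm_sq b _
      (summable_of_sum_le (fun _ => sq_nonneg _) (sum_norm_hsOp_sq_le hk b.orthonormal))
  · rw [hsOp, dif_neg hk]
    exact isCompactOperator_zero

/-! ### Dilations -/

section Dilation

variable {ε κ : ℝ}

theorem ae_comp_smul (hε : 0 < ε) {P : R3 → Prop} (h : ∀ᵐ x, P x) : ∀ᵐ x : R3, P (ε • x) :=
  (Measure.quasiMeasurePreserving_smul (volume : Measure R3) hε.ne').ae h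

theorem integral_comp_smul_R3 {F : Type*} [NormedAddCommGroup F] [NormedSpace ℝ F]
    (hε : 0 < ε) (f : R3 → F) : ∫ x, f (ε • x) = (ε ^ 3)⁻¹ • ∫ x, f x := by
  rw [Measure.integral_comp_smul_of_nonneg volume f ε (hR := hε.le), finrank_R3]

theorem memLp_comp_smul (hε : 0 < ε) {f : R3 → ℂ} (hf : MemLp f 2) :
    MemLp (fun x => ((√(ε ^ 3) : ℝ) : ℂ) * f (ε • x)) 2 := by
  refine MemLp.const_mul ?_ _
  have hm : AEStronglyMeasurable (fun x => f (ε • x)) volume :=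
    hf.1.comp_quasiMeasurePreserving (Measure.quasiMeasurePreserving_smul volume hε.ne')
  rw [memLp_two_iff_integrable_sq_norm hm]
  exact ((memLp_two_iff_integrable_sq_norm hf.1).1 hf).comp_smul hε.ne'

theorem norm_toLp_comp_smul (hε : 0 < ε) (f : L2) :
    ‖(memLp_comp_smul hε (Lp.memLp f)).toLp _‖ = ‖f‖ := by
  refine (sq_eq_sq₀ (norm_nonneg _) (norm_nonneg _)).1 ?_
  rw [norm_toLp_sq, norm_sq_eq_integral f]
  have h : ∀ x, ‖((√(ε ^ 3) : ℝ) : ℂ) * f (ε • x)‖ ^ 2 = ε ^ 3 * ‖f (ε • x)‖ ^ 2 := fun x => by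
    rw [norm_mul, mul_pow, Complex.norm_real, Real.norm_eq_abs, sq_abs,
      Real.sq_sqrt (by positivity)]
  simp_rw [h]
  rw [integral_const_mul, integral_comp_smul_R3 hε fun x => ‖f x‖ ^ 2, smul_eq_mul, ← mul_assoc,
    mul_inv_cancel₀ (by positivity), one_mul]

/-- The unitary dilation `f ↦ ε^{3/2} f(ε ·)`, as a linear map. -/
def dilLin (hε : 0 < ε) : L2 →ₗ[ℂ] L2 where
  toFun f := (memLp_comp_smul hε (Lp.memLp f)).toLp _
  map_add' f g := by
    refine (MemLp.toLp_congr _ ((memLp_comp_smul hε (Lp.memLp f)).add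
      (memLp_comp_smul hε (Lp.memLp g))) ?_).trans (MemLp.toLp_add _ _)
    filter_upwards [ae_comp_smul hε (Lp.coeFn_add f g)] with x hx
    rw [hx, Pi.add_apply, Pi.add_apply, mul_add]
  map_smul' c f := by
    refine (MemLp.toLp_congr _ ((memLp_comp_smul hε (Lp.memLp f)).const_smul c) ?_).trans
      (MemLp.toLp_const_smul c _)
    filter_upwards [ae_comp_smul hε (Lp.coeFn_smul c f)] with x hx
    rw [hx, Pi.smul_apply, Pi.smul_apply, smul_eq_mul, smul_eq_mul, mul_left_comm]

/-- The unitary dilation `f ↦ ε^{3/2} f(ε ·)`. -/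
def dil (hε : 0 < ε) : L2 →L[ℂ] L2 :=
  (dilLin hε).mkContinuous 1 fun f => by
    rw [one_mul]
    exact (norm_toLp_comp_smul hε f).le

theorem dil_coeFn (hε : 0 < ε) (f : L2) :
    dil hε f =ᵐ[volume] fun x => ((√(ε ^ 3) : ℝ) : ℂ) * f (ε • x) :=
  (memLp_comp_smul hε (Lp.memLp f)).coeFn_toLp

theorem star_dil (hε : 0 < ε) : star (dil hε) = dil (inv_pos.2 hε) := by
  rw [ContinuousLinearMap.star_eq_adjoint, eq_comm, ContinuousLinearMap.eq_adjoint_iff]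
  intro f g
  rw [inner_eq_integral, inner_eq_integral]
  have h1 : ∫ x, conj (dil (inv_pos.2 hε) f x) * g x
      = ∫ x, ((√(ε⁻¹ ^ 3) : ℝ) : ℂ) * (conj (f (ε⁻¹ • x)) * g (ε • (ε⁻¹ • x))) := by
    refine integral_congr_ae ?_
    filter_upwards [dil_coeFn (inv_pos.2 hε) f] with x hx
    rw [hx, map_mul, Complex.conj_ofReal, mul_assoc, smul_inv_smul₀ hε.ne']
  have h2 : ∫ x, conj (f x) * dil hε g x
      = ∫ x, ((√(ε ^ 3) : ℝ) : ℂ) * (conj (f x) * g (ε • x)) := by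
    refine integral_congr_ae ?_
    filter_upwards [dil_coeFn hε g] with x hx
    rw [hx]
    ring
  rw [h1, h2, integral_const_mul, integral_const_mul,
    integral_comp_smul_R3 (inv_pos.2 hε) fun x => conj (f x) * g (ε • x), Complex.real_smul,
    ← mul_assoc, ← Complex.ofReal_mul]
  congr 3
  rw [inv_pow, inv_inv, Real.sqrt_inv, inv_mul_eq_div, Real.div_sqrt]

theorem yukawa_smul (hε : 0 < ε) (κ : ℝ) (x : R3) :
    yukawa κ (ε • x) = ε⁻¹ * yukawa (κ * ε) x := by
  rw [yukawa, yukawa, norm_smul, Real.norm_of_nonneg hε.le, inv_mul_eq_div, div_div]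
  congr 1 <;> ring_nf

theorem yukawaConv_smul (hε : 0 < ε) (f : R3 → ℂ) (x : R3) :
    yukawaConv κ (fun y => f (ε⁻¹ • y)) (ε • x) = ((ε ^ 2 : ℝ) : ℂ) * yukawaConv (κ * ε) f x := by
  have h : ∀ y : R3, (yukawa κ (ε • x - y) : ℂ) * f (ε⁻¹ • y)
      = (fun z => ((ε⁻¹ : ℝ) : ℂ) * ((yukawa (κ * ε) (x - z) : ℂ) * f z)) (ε⁻¹ • y) := fun y => by
    have e : ε • x - y = ε • (x - ε⁻¹ • y) := by rw [smul_sub, smul_inv_smul₀ hε.ne']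
    rw [e, yukawa_smul hε, Complex.ofReal_mul, mul_assoc]
  simp_rw [yukawaConv, h]
  rw [integral_comp_smul_R3 (inv_pos.2 hε)
      fun z => ((ε⁻¹ : ℝ) : ℂ) * ((yukawa (κ * ε) (x - z) : ℂ) * f z),
    integral_const_mul, Complex.real_smul, ← mul_assoc, ← Complex.ofReal_mul]
  congr 2
  field_simp

/-- On kernels this is `G_κ(εx) = ε⁻¹ G_{κε}(x)` together with the Jacobian `ε³`. -/
theorem dil_mul_freeRes_mul_star (hε : 0 < ε) (hκ : 0 < κ) :
    dil hε * freeRes κ * star (dil hε) = ((ε ^ 2 : ℝ) : ℂ) • freeRes (κ * ε) := by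
  rw [star_dil]
  refine ContinuousLinearMap.ext fun f => Lp.ext ?_
  rw [mul_apply_eq_comp, mul_apply_eq_comp, smul_apply]
  filter_upwards [dil_coeFn hε (freeRes κ (dil (inv_pos.2 hε) f)),
    ae_comp_smul hε (freeRes_coeFn hκ (dil (inv_pos.2 hε) f)),
    Lp.coeFn_smul ((ε ^ 2 : ℝ) : ℂ) (freeRes (κ * ε) f), freeRes_coeFn (mul_pos hκ hε) f]
    with x h1 h2 h3 h4
  rw [h1, h2, h3, Pi.smul_apply, h4, yukawaConv_congr (dil_coeFn (inv_pos.2 hε) f),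
    smul_eq_mul, ← yukawaConv_smul hε, yukawaConv, yukawaConv, ← integral_const_mul]
  refine integral_congr_ae (Eventually.of_forall fun y => ?_)
  have hc : ((√(ε ^ 3) : ℝ) : ℂ) * ((√(ε⁻¹ ^ 3) : ℝ) : ℂ) = 1 := by
    rw [← Complex.ofReal_mul, inv_pow, Real.sqrt_inv, mul_inv_cancel₀ (by positivity),
      Complex.ofReal_one]
  dsimp only
  rw [mul_left_comm, ← mul_assoc ((√(ε ^ 3) : ℝ) : ℂ), hc, one_mul]

/-- The operator `ε^{1/2} ((-Δ + κ²)^{-1/2} f)(ε ·)`. -/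
def dilRes (κ : ℝ) (hε : 0 < ε) : L2 →L[ℂ] L2 := ((ε⁻¹ : ℝ) : ℂ) • (dil hε * sqrtRes κ)

theorem ofReal_smul_mul_star {A : Type*} [Ring A] [StarRing A] [Algebra ℂ A] [StarModule ℂ A]
    (c : ℝ) (d : A) {j : A} (hj : IsSelfAdjoint j) :
    ((c : ℂ) • (d * j)) * star ((c : ℂ) • (d * j)) =
      ((c * c : ℝ) : ℂ) • (d * (j * j) * star d) := by
  rw [star_smul, star_mul, hj.star_eq, smul_mul_smul_comm, Complex.ofReal_mul]
  simp only [mul_assoc]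
  congr 2
  exact Complex.conj_ofReal _

/-- The prefactor `ε⁻¹` in `dilRes` is chosen so that the `ε²` from the dilation cancels exactly. -/
theorem dilRes_mul_star (hε : 0 < ε) (hκ : 0 < κ) :
    dilRes κ hε * star (dilRes κ hε) = freeRes (κ * ε) := by
  rw [dilRes, ofReal_smul_mul_star ε⁻¹ (dil hε) (isSelfAdjoint_sqrtRes hκ), sqrtRes_mul_self hκ,
    dil_mul_freeRes_mul_star hε hκ, smul_smul, ← Complex.ofReal_mul,
    show ε⁻¹ * ε⁻¹ * ε ^ 2 = 1 by field_simp, Complex.ofReal_one, one_smul]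

theorem dilRes_coeFn (hε : 0 < ε) (κ : ℝ) (f : L2) :
    dilRes κ hε f =ᵐ[volume] fun x => ((√ε : ℝ) : ℂ) * sqrtRes κ f (ε • x) := by
  rw [dilRes, smul_apply, mul_apply_eq_comp]
  filter_upwards [Lp.coeFn_smul ((ε⁻¹ : ℝ) : ℂ) (dil hε (sqrtRes κ f)),
    dil_coeFn hε (sqrtRes κ f)] with x h1 h2
  rw [h1, Pi.smul_apply, h2, smul_eq_mul, ← mul_assoc, ← Complex.ofReal_mul]
  congr 2
  rw [show ε ^ 3 = ε ^ 2 * ε by ring, Real.sqrt_mul (by positivity), Real.sqrt_sq hε.le,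
    inv_mul_cancel_left₀ hε.ne']

end Dilation

/-! ### The Birman–Schwinger kernel -/

/-- The kernel `w(x) G_κ(x - y) w(y)`. -/
def bsKernel (w : R3 → ℝ) (κ : ℝ) (p : R3 × R3) : ℝ := w p.1 * yukawa κ (p.1 - p.2) * w p.2

section BirmanSchwinger

variable {w w' : R3 → ℝ} {κ : ℝ}

theorem yukawa_le_yukawa_zero (hκ : 0 ≤ κ) (x : R3) : yukawa κ x ≤ yukawa 0 x := by
  unfold yukawa
  gcongr

theorem aestronglyMeasurable_bsKernel (hw : AEStronglyMeasurable w volume) (κ : ℝ) :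
    AEStronglyMeasurable (bsKernel w κ) vol2 := by
  refine (hw.comp_fst.mul ?_).mul hw.comp_snd
  exact ((measurable_yukawa κ).comp (measurable_fst.sub measurable_snd)).aestronglyMeasurable

theorem abs_bsKernel_le (hκ : 0 ≤ κ) (h : ∀ x, |w x| ≤ |w' x|) (p : R3 × R3) :
    |bsKernel w κ p| ≤ |bsKernel w' 0 p| := by
  simp only [bsKernel, abs_mul, abs_of_nonneg (yukawa_nonneg _ _)]
  have := yukawa_le_yukawa_zero hκ (p.1 - p.2)
  have h0 := yukawa_nonneg κ (p.1 - p.2)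
  have h1 := yukawa_nonneg 0 (p.1 - p.2)
  exact mul_le_mul (mul_le_mul (h _) this h0 (abs_nonneg _)) (h _) (abs_nonneg _)
    (mul_nonneg (abs_nonneg _) h1)

theorem memLp_bsKernel (hw : AEStronglyMeasurable w volume) (hw' : MemLp (bsKernel w' 0) 2 vol2)
    (hκ : 0 ≤ κ) (h : ∀ x, |w x| ≤ |w' x|) : MemLp (bsKernel w κ) 2 vol2 :=
  hw'.mono (aestronglyMeasurable_bsKernel hw κ) (Eventually.of_forall fun p =>
    abs_bsKernel_le hκ h p)

theorem memLp_top_ofReal (hw : AEStronglyMeasurable w volume) {C : ℝ} (hC : ∀ x, |w x| ≤ C) :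
    MemLp (fun x => (w x : ℂ)) ⊤ volume :=
  memLp_top_of_bound (Complex.continuous_ofReal.comp_aestronglyMeasurable hw) C
    (Eventually.of_forall fun x => by rw [Complex.norm_real]; exact hC x)

theorem mulOp_mul_freeRes_mul_mulOp (hm : MemLp (fun x => (w x : ℂ)) ⊤ volume)
    (hk : MemLp (bsKernel w κ) 2 vol2) (hκ : 0 < κ) :
    mulOp (fun x => (w x : ℂ)) * freeRes κ * mulOp (fun x => (w x : ℂ)) = hsOp (bsKernel w κ) := by
  refine eq_hsOp hk fun f => ?_
  rw [mul_apply_eq_comp, mul_apply_eq_comp]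
  filter_upwards [mulOp_coeFn hm (freeRes κ (mulOp (fun x => (w x : ℂ)) f)),
    freeRes_coeFn hκ (mulOp (fun x => (w x : ℂ)) f)] with x h1 h2
  rw [h1, h2, yukawaConv_congr (mulOp_coeFn hm f), yukawaConv, kernelInt, ← integral_const_mul]
  refine integral_congr_ae (Eventually.of_forall fun y => ?_)
  simp only [bsKernel, Complex.ofReal_mul]
  ring

theorem mulOp_sub {m m' : R3 → ℂ} (hm : MemLp m ⊤ volume) (hm' : MemLp m' ⊤ volume) :
    mulOp m - mulOp m' = mulOp fun x => m x - m' x := by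
  have hmm : MemLp (fun x => m x - m' x) ⊤ volume := hm.sub hm'
  refine ContinuousLinearMap.ext fun f => Lp.ext ?_
  rw [sub_apply]
  filter_upwards [Lp.coeFn_sub (mulOp m f) (mulOp m' f), mulOp_coeFn hm f, mulOp_coeFn hm' f,
    mulOp_coeFn hmm f] with x h1 h2 h3 h4
  rw [h1, h4, Pi.sub_apply, h2, h3, sub_mul]

theorem mul_mul_star_mul {A : Type*} [Ring A] [StarRing A] {m q : A} (hm : IsSelfAdjoint m) :
    (m * q) * star (m * q) = m * (q * star q) * m := by
  rw [star_mul, hm.star_eq]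
  simp only [mul_assoc]

theorem mulOp_mul_self_star (hm : MemLp (fun x => (w x : ℂ)) ⊤ volume)
    (hk : MemLp (bsKernel w κ) 2 vol2) (hκ : 0 < κ) {Q : L2 →L[ℂ] L2}
    (hQ : Q * star Q = freeRes κ) :
    (mulOp (fun x => (w x : ℂ)) * Q) * star (mulOp (fun x => (w x : ℂ)) * Q)
      = hsOp (bsKernel w κ) := by
  rw [mul_mul_star_mul (isSelfAdjoint_mulOp_ofReal hm), hQ, mulOp_mul_freeRes_mul_mulOp hm hk hκ]

theorem norm_eq_sqrt_norm_mul_star {H : Type*} [NormedAddCommGroup H] [InnerProductSpace ℂ H]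
    [CompleteSpace H] (X : H →L[ℂ] H) : ‖X‖ = √‖X * star X‖ := by
  rw [CStarRing.norm_self_mul_star, Real.sqrt_mul_self (norm_nonneg _)]

theorem norm_mulOp_mul_le (hm : MemLp (fun x => (w x : ℂ)) ⊤ volume)
    (hk : MemLp (bsKernel w κ) 2 vol2) (hκ : 0 < κ) {Q : L2 →L[ℂ] L2}
    (hQ : Q * star Q = freeRes κ) :
    ‖mulOp (fun x => (w x : ℂ)) * Q‖ ≤ √‖hsOp (bsKernel w κ)‖ := by
  rw [← mulOp_mul_self_star hm hk hκ hQ]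
  exact (norm_eq_sqrt_norm_mul_star _).le

theorem sqrt_integral_bsKernel_le (hw : AEStronglyMeasurable w volume)
    (hw' : MemLp (bsKernel w' 0) 2 vol2) (hκ : 0 ≤ κ) (h : ∀ x, |w x| ≤ |w' x|) :
    ‖hsOp (bsKernel w κ)‖ ≤ √(∫ p, bsKernel w' 0 p ^ 2 ∂vol2) := by
  refine (norm_hsOp_le _).trans (Real.sqrt_le_sqrt ?_)
  refine integral_mono (memLp_bsKernel hw hw' hκ h).integrable_sq hw'.integrable_sq fun p => ?_
  exact sq_le_sq.2 (abs_bsKernel_le hκ h p)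

theorem tendsto_integral_bsKernel_tail (hw : AEStronglyMeasurable w volume) (hw0 : ∀ x, 0 ≤ w x)
    (hk : MemLp (bsKernel w 0) 2 vol2) :
    Tendsto (fun n : ℕ => ∫ p, bsKernel (fun x => w x - min (w x) n) 0 p ^ 2 ∂vol2)
      atTop (𝓝 0) := by
  rw [show 𝓝 (0 : ℝ) = 𝓝 (∫ _, (0 : ℝ) ∂vol2) by rw [integral_zero]]
  have hle : ∀ (n : ℕ) x, |w x - min (w x) n| ≤ |w x| := fun n x => by
    have h1 := min_le_left (w x) n
    have h2 : 0 ≤ min (w x) n := le_min (hw0 x) n.cast_nonneg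
    rw [abs_of_nonneg (by linarith), abs_of_nonneg (hw0 x)]
    linarith
  refine tendsto_integral_of_dominated_convergence (fun p => bsKernel w 0 p ^ 2) (fun n => ?_)
    hk.integrable_sq (fun n => ?_) ?_
  · have hmeas : AEStronglyMeasurable (fun x => w x - min (w x) n) volume :=
      hw.sub (hw.inf aestronglyMeasurable_const)
    exact (aestronglyMeasurable_bsKernel hmeas 0).pow 2
  · refine Eventually.of_forall fun p => ?_
    rw [norm_pow, Real.norm_eq_abs, sq_abs]
    exact sq_le_sq.2 (abs_bsKernel_le le_rfl (hle n) p)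
  · refine Eventually.of_forall fun p => ?_
    obtain ⟨N, hN⟩ := exists_nat_ge (w p.1)
    refine tendsto_const_nhds.congr' ?_
    filter_upwards [eventually_ge_atTop N] with n hn
    have : (N : ℝ) ≤ n := by exact_mod_cast hn
    simp [bsKernel, min_eq_left (hN.trans this)]

theorem tendsto_hsOp_bsKernel_min (hw : AEStronglyMeasurable w volume) (hw0 : ∀ x, 0 ≤ w x)
    (hk : MemLp (bsKernel w 0) 2 vol2) (hκ : 0 ≤ κ) :
    Tendsto (fun n : ℕ => hsOp (bsKernel (fun x => min (w x) n) κ)) atTop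
      (𝓝 (hsOp (bsKernel w κ))) := by
  refine tendsto_hsOp (g := fun p => |bsKernel w 0 p|) (Eventually.of_forall fun n => ?_)
    (aestronglyMeasurable_bsKernel hw κ) hk.abs (Eventually.of_forall fun n =>
      Eventually.of_forall fun p => abs_bsKernel_le hκ (fun x => ?_) p)
    (Eventually.of_forall fun p => abs_bsKernel_le hκ (fun x => le_rfl) p)
    (Eventually.of_forall fun p => ?_)
  · exact aestronglyMeasurable_bsKernel (hw.inf aestronglyMeasurable_const) κ
  · rw [abs_of_nonneg (le_min (hw0 x) n.cast_nonneg), abs_of_nonneg (hw0 x)]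
    exact min_le_left _ _
  · obtain ⟨N, hN⟩ := exists_nat_ge (max (w p.1) (w p.2))
    refine tendsto_const_nhds.congr' ?_
    filter_upwards [eventually_ge_atTop N] with n hn
    have : (N : ℝ) ≤ n := by exact_mod_cast hn
    simp only [bsKernel, min_eq_left (((le_max_left _ _).trans hN).trans this),
      min_eq_left (((le_max_right _ _).trans hN).trans this)]

theorem abs_min_natCast_le (hw0 : ∀ x, 0 ≤ w x) (n : ℕ) (x : R3) : |min (w x) n| ≤ n := by
  rw [abs_of_nonneg (le_min (hw0 x) n.cast_nonneg)]
  exact min_le_right _ _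

/-- As `w` may be unbounded, `w Q` is built from truncations of `w`. A difference of two truncations
beyond level `N` is dominated by the tail `w - min w N`, whose Birman–Schwinger kernel tends to zero
in `L²`. -/
theorem cauchySeq_mulOp_min_mul (hw : AEStronglyMeasurable w volume) (hw0 : ∀ x, 0 ≤ w x)
    (hk : MemLp (bsKernel w 0) 2 vol2) (hκ : 0 < κ) {Q : L2 →L[ℂ] L2}
    (hQ : Q * star Q = freeRes κ) :
    CauchySeq fun n : ℕ => mulOp (fun x => ((min (w x) n : ℝ) : ℂ)) * Q := by
  have hm : ∀ n : ℕ, MemLp (fun x => ((min (w x) n : ℝ) : ℂ)) ⊤ volume := fun n =>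
    memLp_top_ofReal (hw.inf aestronglyMeasurable_const) (abs_min_natCast_le hw0 n)
  refine cauchySeq_of_le_tendsto_0
    -- One square root comes from the Hilbert–Schmidt norm, the other from `‖X‖² = ‖X X*‖`.
    (fun N => √√(∫ p, bsKernel (fun x => w x - min (w x) N) 0 p ^ 2 ∂vol2)) ?_ ?_
  · intro n m N hn hm'
    have hn' : (N : ℝ) ≤ n := by exact_mod_cast hn
    have hm'' : (N : ℝ) ≤ m := by exact_mod_cast hm'
    have hle : ∀ x, |min (w x) n - min (w x) m| ≤ |w x - min (w x) N| := fun x => by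
      have h1 := min_le_left (w x) n
      have h2 := min_le_left (w x) m
      have h3 : min (w x) N ≤ min (w x) n := min_le_min_left _ hn'
      have h4 : min (w x) N ≤ min (w x) m := min_le_min_left _ hm''
      rw [abs_of_nonneg (a := w x - min (w x) N) (by linarith)]
      exact abs_le.2 ⟨by linarith, by linarith⟩
    have hmeas : AEStronglyMeasurable (fun x => min (w x) n - min (w x) m) volume :=
      (hw.inf aestronglyMeasurable_const).sub (hw.inf aestronglyMeasurable_const)
    have hmeasN : AEStronglyMeasurable (fun x => w x - min (w x) N) volume :=
      hw.sub (hw.inf aestronglyMeasurable_const)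
    have hkN : MemLp (bsKernel (fun x => w x - min (w x) N) 0) 2 vol2 := by
      refine memLp_bsKernel hmeasN hk le_rfl fun x => ?_
      have h1 := min_le_left (w x) N
      have h2 : 0 ≤ min (w x) N := le_min (hw0 x) N.cast_nonneg
      rw [abs_of_nonneg (by linarith), abs_of_nonneg (hw0 x)]
      linarith
    have hd : MemLp (fun x => ((min (w x) n - min (w x) m : ℝ) : ℂ)) ⊤ volume := by
      simpa using! (hm n).sub (hm m)
    have e : mulOp (fun x => ((min (w x) n : ℝ) : ℂ)) * Q
        - mulOp (fun x => ((min (w x) m : ℝ) : ℂ)) * Q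
        = mulOp (fun x => ((min (w x) n - min (w x) m : ℝ) : ℂ)) * Q := by
      rw [← sub_mul, mulOp_sub (hm n) (hm m)]
      simp only [Complex.ofReal_sub]
    rw [dist_eq_norm, e]
    refine (norm_mulOp_mul_le hd (memLp_bsKernel hmeas hkN hκ.le hle) hκ hQ).trans
      (Real.sqrt_le_sqrt (sqrt_integral_bsKernel_le hmeas hkN hκ.le hle))
  · have h := tendsto_integral_bsKernel_tail hw hw0 hk
    have h2 := (Real.continuous_sqrt.tendsto _).comp ((Real.continuous_sqrt.tendsto _).comp h)
    simpa using! h2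

/-- The operator `w Q` is bounded, and `w Q Q* w` is the Birman–Schwinger operator. -/
theorem exists_mul_eq_hsOp_bsKernel (hw : AEStronglyMeasurable w volume) (hw0 : ∀ x, 0 ≤ w x)
    (hk : MemLp (bsKernel w 0) 2 vol2) (hκ : 0 < κ) {Q : L2 →L[ℂ] L2}
    (hQ : Q * star Q = freeRes κ) :
    ∃ T : L2 →L[ℂ] L2, (∀ h, T h =ᵐ[volume] fun x => (w x : ℂ) * Q h x) ∧
      T * star T = hsOp (bsKernel w κ) := by
  have hm : ∀ n : ℕ, MemLp (fun x => ((min (w x) n : ℝ) : ℂ)) ⊤ volume := fun n =>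
    memLp_top_ofReal (hw.inf aestronglyMeasurable_const) (abs_min_natCast_le hw0 n)
  obtain ⟨T, hT⟩ := cauchySeq_tendsto_of_complete (cauchySeq_mulOp_min_mul hw hw0 hk hκ hQ)
  refine ⟨T, fun h => ?_, ?_⟩
  · have h1 : Tendsto (fun n : ℕ => (mulOp (fun x => ((min (w x) n : ℝ) : ℂ)) * Q) h) atTop
        (𝓝 (T h)) := ((ContinuousLinearMap.apply ℂ L2 h).continuous.tendsto T).comp hT
    obtain ⟨ns, hns, hae⟩ := (tendstoInMeasure_of_tendsto_Lp h1).exists_seq_tendsto_ae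
    filter_upwards [hae, ae_all_iff.2 fun n : ℕ => mulOp_coeFn (hm n) (Q h)] with x h2 h3
    refine tendsto_nhds_unique h2 ?_
    obtain ⟨N, hN⟩ := exists_nat_ge (w x)
    refine tendsto_const_nhds.congr' ?_
    filter_upwards [hns.tendsto_atTop.eventually_ge_atTop N] with n hn
    have : (N : ℝ) ≤ ns n := by exact_mod_cast hn
    rw [mul_apply_eq_comp, h3, min_eq_left (hN.trans this)]
  · have h1 : Tendsto (fun n : ℕ => (mulOp (fun x => ((min (w x) n : ℝ) : ℂ)) * Q)
        * star (mulOp (fun x => ((min (w x) n : ℝ) : ℂ)) * Q)) atTop (𝓝 (T * star T)) :=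
      hT.mul ((continuous_star.tendsto T).comp hT)
    refine tendsto_nhds_unique h1 ?_
    refine (tendsto_hsOp_bsKernel_min hw hw0 hk hκ.le).congr fun n => ?_
    refine (mulOp_mul_self_star (hm n) ?_ hκ hQ).symm
    refine memLp_bsKernel (hw.inf aestronglyMeasurable_const) hk hκ.le fun x => ?_
    rw [abs_of_nonneg (le_min (hw0 x) n.cast_nonneg), abs_of_nonneg (hw0 x)]
    exact min_le_left _ _

end BirmanSchwinger

/-! ### Birman–Schwinger operators of a potential -/

/-- `v = √|V|`. -/
def sqrtAbs (V : R3 → ℝ) (x : R3) : ℝ := √|V x|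

/-- Multiplication by the sign of `V`. -/
def signOp (V : R3 → ℝ) : L2 →L[ℂ] L2 := mulOp fun x => (Real.sign (V x) : ℂ)

/-- The operator `v (-Δ + κ²)⁻¹ v`. -/
def bsOp (V : R3 → ℝ) (κ : ℝ) : L2 →L[ℂ] L2 := hsOp (bsKernel (sqrtAbs V) κ)

/-- The kernel `v(x) G_κ(ε x - y)`. -/
def sideKernel (V : R3 → ℝ) (κ ε : ℝ) (p : R3 × R3) : ℝ :=
  sqrtAbs V p.1 * yukawa κ (ε • p.1 - p.2)

/-- The operator with kernel `v(x) G_κ(ε x - y)`. -/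
def sideOp (V : R3 → ℝ) (κ ε : ℝ) : L2 →L[ℂ] L2 := hsOp (sideKernel V κ ε)

section Potential

variable {V : R3 → ℝ} {κ ε : ℝ}

theorem sqrtAbs_nonneg (V : R3 → ℝ) (x : R3) : 0 ≤ sqrtAbs V x := Real.sqrt_nonneg _

theorem sqrtAbs_sq (V : R3 → ℝ) (x : R3) : sqrtAbs V x ^ 2 = |V x| := Real.sq_sqrt (abs_nonneg _)

theorem sign_mul_abs_self (a : ℝ) : Real.sign a * |a| = a := by
  rcases lt_trichotomy a 0 with h | rfl | h
  · rw [Real.sign_of_neg h, abs_of_neg h]; ring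
  · simp
  · rw [Real.sign_of_pos h, abs_of_pos h, one_mul]

theorem abs_sign_le_one (a : ℝ) : |Real.sign a| ≤ 1 := by
  rcases Real.sign_apply_eq a with h | h | h <;> simp [h]

theorem measurable_real_sign : Measurable Real.sign :=
  Measurable.ite measurableSet_Iio measurable_const
    (Measurable.ite measurableSet_Ioi measurable_const measurable_const)

theorem aestronglyMeasurable_sqrtAbs (hV : AEStronglyMeasurable V volume) :
    AEStronglyMeasurable (sqrtAbs V) volume :=
  Real.continuous_sqrt.comp_aestronglyMeasurable (continuous_abs.comp_aestronglyMeasurable hV)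

theorem memLp_sign (hV : AEStronglyMeasurable V volume) :
    MemLp (fun x => (Real.sign (V x) : ℂ)) ⊤ volume :=
  memLp_top_ofReal (measurable_real_sign.comp_aemeasurable hV.aemeasurable).aestronglyMeasurable
    fun x => abs_sign_le_one (V x)

theorem signOp_coeFn (hV : AEStronglyMeasurable V volume) (f : L2) :
    signOp V f =ᵐ[volume] fun x => (Real.sign (V x) : ℂ) * f x := mulOp_coeFn (memLp_sign hV) f

theorem isSelfAdjoint_signOp (hV : AEStronglyMeasurable V volume) : IsSelfAdjoint (signOp V) :=
  isSelfAdjoint_mulOp_ofReal (memLp_sign hV)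

theorem norm_signOp_le (hV : AEStronglyMeasurable V volume) : ‖signOp V‖ ≤ 1 :=
  norm_mulOp_le (memLp_sign hV) zero_le_one (Eventually.of_forall fun x => by
    rw [Complex.norm_real]; exact abs_sign_le_one _)

theorem memLp_sqrtAbs (hV : Integrable V) : MemLp (sqrtAbs V) 2 := by
  rw [memLp_two_iff_integrable_sq (aestronglyMeasurable_sqrtAbs hV.1)]
  simpa only [sqrtAbs_sq] using hV.abs

theorem memLp_bsKernel_of_rollnik (hV : Rollnik V) : MemLp (bsKernel (sqrtAbs V) 0) 2 vol2 := by
  have hm := aestronglyMeasurable_bsKernel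
    (aestronglyMeasurable_sqrtAbs hV.1.aestronglyMeasurable) 0
  have hm2 : AEStronglyMeasurable (fun p => bsKernel (sqrtAbs V) 0 p ^ 2) vol2 := hm.pow 2
  rw [memLp_two_iff_integrable_sq hm]
  refine ⟨hm2, ?_⟩
  rw [HasFiniteIntegral, lintegral_prod _ hm2.enorm]
  refine lt_of_le_of_lt (lintegral_mono fun x => lintegral_mono fun y => ?_) hV.2
  -- On the diagonal the kernel is zero, by the convention for division by zero.
  rcases eq_or_ne x y with rfl | hxy
  · simp [bsKernel, yukawa]
  have hn : 0 < ‖x - y‖ := norm_pos_iff.2 (sub_ne_zero.2 hxy)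
  have h1 : bsKernel (sqrtAbs V) 0 (x, y) ^ 2 = |V x| * |V y| / (4 * Real.pi * ‖x - y‖) ^ 2 := by
    simp only [bsKernel, yukawa, mul_pow, sqrtAbs_sq, div_pow, zero_mul, neg_zero, Real.exp_zero]
    ring
  have h2 : ‖V x‖ₑ * ‖V y‖ₑ / ‖x - y‖ₑ ^ 2 = ENNReal.ofReal (|V x| * |V y| / ‖x - y‖ ^ 2) := by
    rw [ENNReal.ofReal_div_of_pos (by positivity), ENNReal.ofReal_mul (abs_nonneg _),
      ENNReal.ofReal_pow hn.le, ← Real.norm_eq_abs, ← Real.norm_eq_abs, ofReal_norm, ofReal_norm,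
      ofReal_norm]
  rw [h2, h1, Real.enorm_of_nonneg (by positivity)]
  refine ENNReal.ofReal_le_ofReal ?_
  gcongr
  have := Real.pi_gt_three
  nlinarith

theorem measurable_sideKernel (hV : AEStronglyMeasurable V volume) (κ ε : ℝ) :
    AEStronglyMeasurable (sideKernel V κ ε) vol2 := by
  refine (aestronglyMeasurable_sqrtAbs hV).comp_fst.mul ?_
  exact ((measurable_yukawa κ).comp
    ((measurable_fst.const_smul ε).sub measurable_snd)).aestronglyMeasurable

theorem integral_yukawa_sub_sq (κ : ℝ) (a : R3) :
    ∫ y, yukawa κ (a - y) ^ 2 = ∫ y, yukawa κ y ^ 2 :=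
  (Measure.measurePreserving_sub_left volume a).integral_comp'
    (f := MeasurableEquiv.subLeft a) fun y => yukawa κ y ^ 2

theorem integrable_yukawa_sub_sq (hκ : 0 < κ) (a : R3) :
    Integrable fun y => yukawa κ (a - y) ^ 2 :=
  (Measure.measurePreserving_sub_left volume a).integrable_comp_of_integrable
    (integrable_yukawa_sq hκ)

theorem memLp_sideKernel (hV : Integrable V) (hκ : 0 < κ) (ε : ℝ) :
    MemLp (sideKernel V κ ε) 2 vol2 := by
  have hm := measurable_sideKernel hV.1 κ ε
  have hm2 : AEStronglyMeasurable (fun p => sideKernel V κ ε p ^ 2) vol2 := hm.pow 2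
  rw [memLp_two_iff_integrable_sq hm, integrable_prod_iff hm2]
  have h : ∀ x y, sideKernel V κ ε (x, y) ^ 2 = |V x| * yukawa κ (ε • x - y) ^ 2 := fun x y => by
    rw [sideKernel, mul_pow, sqrtAbs_sq]
  simp_rw [h]
  refine ⟨Eventually.of_forall fun x => (integrable_yukawa_sub_sq hκ _).const_mul _, ?_⟩
  have h2 : ∀ x, ∫ y, ‖|V x| * yukawa κ (ε • x - y) ^ 2‖
      = |V x| * ∫ y, yukawa κ y ^ 2 := fun x => by
    rw [← integral_yukawa_sub_sq κ (ε • x), ← integral_const_mul]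
    refine integral_congr_ae (Eventually.of_forall fun y => ?_)
    exact Real.norm_of_nonneg (by positivity)
  simp_rw [h2]
  exact hV.abs.mul_const _

/-- Translation invariance in `y` removes `ε` from the Hilbert–Schmidt norm, which gives a bound
uniform in `ε`. -/
theorem norm_sideOp_le (hV : Integrable V) (hκ : 0 < κ) (ε : ℝ) :
    ‖sideOp V κ ε‖ ≤ √((∫ x, |V x|) * ∫ y, yukawa κ y ^ 2) := by
  refine (norm_hsOp_le _).trans (Real.sqrt_le_sqrt (le_of_eq ?_))
  rw [integral_prod _ (memLp_sideKernel hV hκ ε).integrable_sq, ← integral_mul_const]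
  refine integral_congr_ae (Eventually.of_forall fun x => ?_)
  simp only [sideKernel, mul_pow, sqrtAbs_sq]
  rw [integral_const_mul, integral_yukawa_sub_sq]

/-- A second factor `J` completes the free resolvent, whose integral kernel is then evaluated at
`εx`; the amplitude `√ε` is that of the dilation. -/
theorem mul_sqrtRes_eq_sideOp (hV : Integrable V) (hκ : 0 < κ) (hε : 0 < ε) {T : L2 →L[ℂ] L2}
    (hT : ∀ h, T h =ᵐ[volume] fun x => (sqrtAbs V x : ℂ) * dilRes κ hε h x) :
    T * sqrtRes κ = ((√ε : ℝ) : ℂ) • sideOp V κ ε := by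
  refine ContinuousLinearMap.ext fun f => Lp.ext ?_
  rw [mul_apply_eq_comp, smul_apply]
  have hJ : sqrtRes κ (sqrtRes κ f) = freeRes κ f := by
    rw [← sqrtRes_mul_self hκ, mul_apply_eq_comp]
  have h2 := dilRes_coeFn hε κ (sqrtRes κ f)
  rw [hJ] at h2
  filter_upwards [hT (sqrtRes κ f), h2, ae_comp_smul hε (freeRes_coeFn hκ f),
    Lp.coeFn_smul ((√ε : ℝ) : ℂ) (sideOp V κ ε f),
    hsOp_coeFn (memLp_sideKernel hV hκ ε) f] with x h3 h4 h5 h6 h7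
  rw [h3, h4, h5, h6, Pi.smul_apply, sideOp, h7, smul_eq_mul, kernelInt, yukawaConv,
    mul_left_comm, ← integral_const_mul]
  congr 1
  refine integral_congr_ae (Eventually.of_forall fun y => ?_)
  simp only [sideKernel, Complex.ofReal_mul]
  ring

theorem inner_smul_star_mul_mul {H : Type*} [NormedAddCommGroup H] [InnerProductSpace ℂ H]
    [CompleteSpace H] (c : ℂ) (T S : H →L[ℂ] H) (k h : H) :
    inner ℂ k ((c • (star T * S * T)) h) = c * inner ℂ (T k) (S (T h)) := by
  rw [smul_apply, inner_smul_right, mul_apply_eq_comp, mul_apply_eq_comp,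
    ContinuousLinearMap.star_eq_adjoint, ContinuousLinearMap.adjoint_inner_right]

theorem potential_mul_ae_eq (hV : AEStronglyMeasurable V volume) (hε : 0 < ε) {T : L2 →L[ℂ] L2}
    (hT : ∀ h, T h =ᵐ[volume] fun x => (sqrtAbs V x : ℂ) * dilRes κ hε h x) (k h : L2) :
    (fun x => (V x : ℂ) * conj (sqrtRes κ k (ε • x)) * sqrtRes κ h (ε • x)) =ᵐ[volume]
      fun x => ((ε⁻¹ : ℝ) : ℂ) * (conj (T k x) * signOp V (T h) x) := by
  filter_upwards [hT k, hT h, dilRes_coeFn hε κ k, dilRes_coeFn hε κ h,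
    signOp_coeFn hV (T h)] with x h1 h2 h3 h4 h5
  have e1 : (V x : ℂ) = (Real.sign (V x) : ℂ) * (sqrtAbs V x : ℂ) ^ 2 := by
    rw [← Complex.ofReal_pow, sqrtAbs_sq, ← Complex.ofReal_mul, sign_mul_abs_self]
  have e2 : ((√ε : ℝ) : ℂ) ^ 2 = (ε : ℂ) := by
    rw [← Complex.ofReal_pow, Real.sq_sqrt hε.le]
  have e3 : (ε : ℂ)⁻¹ * (ε : ℂ) = 1 := inv_mul_cancel₀ (by exact_mod_cast hε.ne')
  rw [h5, h1, h2, h3, h4, map_mul, map_mul, Complex.conj_ofReal, Complex.conj_ofReal,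
    Complex.ofReal_inv, e1]
  generalize conj (sqrtRes κ k (ε • x)) = a
  generalize sqrtRes κ h (ε • x) = b
  linear_combination (Real.sign (V x) : ℂ) * (sqrtAbs V x : ℂ) ^ 2 * a * b *
    (-e3 - (ε : ℂ)⁻¹ * e2)

theorem integral_mul_comp_inv_smul (hε : 0 < ε) (c : ℝ) {F g : R3 → ℂ}
    (h : F =ᵐ[volume] fun x => ((ε⁻¹ : ℝ) : ℂ) * g x) :
    ∫ x, (c : ℂ) * F (ε⁻¹ • x) = ((c * ε ^ 2 : ℝ) : ℂ) * ∫ x, g x := by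
  rw [integral_const_mul, integral_comp_smul_R3 (inv_pos.2 hε) F, integral_congr_ae h,
    integral_const_mul, Complex.real_smul, ← mul_assoc, ← mul_assoc, ← Complex.ofReal_mul,
    ← Complex.ofReal_mul]
  congr 2
  field_simp

/-- Write `V = sign(V) v²` and substitute `x = ε x'`. The Jacobian `ε³` and the factor `ε⁻¹` that
undoes the amplitude of `dilRes` leave `ε²`. -/
theorem representsPotential_dilation (hV : AEStronglyMeasurable V volume) (hε : 0 < ε)
    {T : L2 →L[ℂ] L2}
    (hT : ∀ h, T h =ᵐ[volume] fun x => (sqrtAbs V x : ℂ) * dilRes κ hε h x) (c : ℝ) :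
    RepresentsPotential κ (fun x => c * V (ε⁻¹ • x))
      (((c * ε ^ 2 : ℝ) : ℂ) • (star T * signOp V * T)) := by
  intro k h
  have hF := potential_mul_ae_eq hV hε hT k h
  have hFi := ((integrable_conj_mul (T k) (signOp V (T h))).const_mul ((ε⁻¹ : ℝ) : ℂ)).congr
    hF.symm
  have e : ∀ x, ((c * V (ε⁻¹ • x) : ℝ) : ℂ) * conj (sqrtRes κ k x) * sqrtRes κ h x
      = (c : ℂ) * ((V (ε⁻¹ • x) : ℂ) * conj (sqrtRes κ k (ε • ε⁻¹ • x))
        * sqrtRes κ h (ε • ε⁻¹ • x)) := fun x => by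
    rw [smul_inv_smul₀ hε.ne', Complex.ofReal_mul, mul_assoc, mul_assoc, mul_assoc]
  refine ⟨((hFi.comp_smul (inv_ne_zero hε.ne')).const_mul (c : ℂ)).congr
    (Eventually.of_forall fun x => (e x).symm), ?_⟩
  refine (integral_congr_ae (Eventually.of_forall e)).trans
    ((integral_mul_comp_inv_smul hε c hF).trans ?_)
  rw [inner_smul_star_mul_mul, inner_eq_integral]

end Potential

/-! ### The resolvent of the scaled form sum -/

section Sandwich

variable {A : Type*} [Ring A] [StarRing A] [Algebra ℂ A]

/-- The push-through identity with `x = l T*` and `y = S T`. -/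
theorem inverse_one_add_sandwich (l : ℂ) {T S : A} (hu : IsUnit (1 + l • (S * (T * star T)))) :
    IsUnit (1 + l • (star T * S * T)) ∧ Ring.inverse (1 + l • (star T * S * T))
      = 1 - l • (star T * Ring.inverse (1 + l • (S * (T * star T))) * S * T) := by
  have e1 : (S * T) * (l • star T) = l • (S * (T * star T)) := by
    rw [mul_smul_comm, mul_assoc]
  have e2 : (l • star T) * (S * T) = l • (star T * S * T) := by
    rw [smul_mul_assoc, mul_assoc]
  have h := one_add_mul_woodbury (x := l • star T) (y := S * T)
    (n := Ring.inverse (1 + l • (S * (T * star T))))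
    (by rw [e1, Ring.mul_inverse_cancel _ hu]) (by rw [e1, Ring.inverse_mul_cancel _ hu])
  have e3 : (l • star T) * Ring.inverse (1 + l • (S * (T * star T))) * (S * T)
      = l • (star T * Ring.inverse (1 + l • (S * (T * star T))) * S * T) := by
    rw [smul_mul_assoc, smul_mul_assoc, mul_assoc _ S T]
  rw [e2, e3] at h
  have hu' : IsUnit (1 + l • (star T * S * T)) := ⟨⟨_, _, h.1, h.2⟩, rfl⟩
  exact ⟨hu', (left_inv_eq_right_inv (Ring.inverse_mul_cancel _ hu') h.1)⟩

theorem sandwich_krein [StarModule ℂ A] (l : ℂ) (r : ℝ) {T S J N X : A} (hJ : IsSelfAdjoint J)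
    (hTJ : T * J = (r : ℂ) • X) :
    J * (1 - l • (star T * N * S * T)) * J
      = J * J - (l * ((r * r : ℝ) : ℂ)) • (star X * N * S * X) := by
  have h1 : J * star T = (r : ℂ) • star X := by
    have h := congrArg star hTJ
    rw [star_mul, hJ.star_eq, star_smul] at h
    rw [h]
    congr 1
    exact Complex.conj_ofReal _
  have h2 : J * (star T * N * S * T) * J = (J * star T) * N * S * (T * J) := by
    simp only [mul_assoc]
  rw [mul_sub, mul_one, sub_mul, mul_smul_comm, smul_mul_assoc, h2, h1, hTJ]
  simp only [smul_mul_assoc, mul_smul_comm, smul_smul, Complex.ofReal_mul, mul_assoc]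

/-- Krein's resolvent formula. -/
theorem krein_formula [StarModule ℂ A] {l ε : ℝ} (hε : 0 ≤ ε) {T S J X R B : A}
    (hJ : IsSelfAdjoint J) (hTJ : T * J = ((√ε : ℝ) : ℂ) • X) (hTT : T * star T = B)
    (hJJ : J * J = R) (hu : IsUnit (1 + (l : ℂ) • (S * B))) :
    IsUnit (1 + (l : ℂ) • (star T * S * T)) ∧
      J * Ring.inverse (1 + (l : ℂ) • (star T * S * T)) * J = R - ((l * ε : ℝ) : ℂ) •
        (star X * Ring.inverse (1 + (l : ℂ) • (S * B)) * S * X) := by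
  subst hTT
  obtain ⟨hu', hinv⟩ := inverse_one_add_sandwich _ hu
  refine ⟨hu', ?_⟩
  rw [hinv, sandwich_krein _ _ hJ hTJ, hJJ, Real.mul_self_sqrt hε, ← Complex.ofReal_mul]

theorem isSelfAdjoint_sandwich [StarModule ℂ A] (l : ℝ) (T : A) {S : A} (hS : IsSelfAdjoint S) :
    IsSelfAdjoint ((l : ℂ) • (star T * S * T)) := by
  refine IsSelfAdjoint.smul (Complex.conj_ofReal l) ?_
  rw [IsSelfAdjoint, star_mul, star_mul, star_star, hS.star_eq, mul_assoc]

end Sandwich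

section Hilbert

variable {H : Type*} [NormedAddCommGroup H] [InnerProductSpace ℂ H] [CompleteSpace H]

theorem isUnit_one_add_smul_mul_of_norm_lt {l : ℝ} {S B : H →L[ℂ] H} (hS : ‖S‖ ≤ 1)
    (h : |l| * ‖B‖ < 1) : IsUnit (1 + (l : ℂ) • (S * B)) := by
  have h1 : ‖-((l : ℂ) • (S * B))‖ < 1 := by
    rw [norm_neg, norm_smul, Complex.norm_real]
    refine lt_of_le_of_lt ?_ h
    rw [Real.norm_eq_abs]
    refine mul_le_mul_of_nonneg_left ((norm_mul_le _ _).trans ?_) (abs_nonneg _)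
    exact mul_le_of_le_one_left (norm_nonneg _) hS
  have := isUnit_one_sub_of_norm_lt_one h1
  rwa [sub_neg_eq_add] at this

/-- The perturbation contributes `l ⟪T f, S T f⟫`, of modulus at most `|l| ‖T‖² ‖f‖²`, and `‖T‖² =
‖T T*‖`. -/
theorem re_inner_one_add_sandwich_nonneg {l : ℝ} {S T : H →L[ℂ] H} (hS : ‖S‖ ≤ 1)
    (h : |l| * ‖T * star T‖ < 1) (f : H) :
    0 ≤ (inner ℂ f ((1 + (l : ℂ) • (star T * S * T)) f)).re := by
  have h1 : ‖inner ℂ f (((l : ℂ) • (star T * S * T)) f)‖ ≤ ‖f‖ ^ 2 := by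
    rw [inner_smul_star_mul_mul, norm_mul, Complex.norm_real, Real.norm_eq_abs]
    have h2 : ‖inner ℂ (T f) (S (T f))‖ ≤ ‖T * star T‖ * ‖f‖ ^ 2 := by
      rw [CStarRing.norm_self_mul_star]
      have h3 : ‖S (T f)‖ ≤ ‖T f‖ := by
        refine (S.le_opNorm _).trans ?_
        exact mul_le_of_le_one_left (norm_nonneg _) hS
      calc ‖inner ℂ (T f) (S (T f))‖ ≤ ‖T f‖ * ‖S (T f)‖ := norm_inner_le_norm _ _
        _ ≤ ‖T f‖ * ‖T f‖ := by gcongr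
        _ ≤ (‖T‖ * ‖f‖) * (‖T‖ * ‖f‖) := by gcongr <;> exact T.le_opNorm f
        _ = ‖T‖ * ‖T‖ * ‖f‖ ^ 2 := by ring
    calc |l| * ‖inner ℂ (T f) (S (T f))‖ ≤ |l| * (‖T * star T‖ * ‖f‖ ^ 2) := by gcongr
      _ = |l| * ‖T * star T‖ * ‖f‖ ^ 2 := by ring
      _ ≤ 1 * ‖f‖ ^ 2 := by gcongr
      _ = ‖f‖ ^ 2 := one_mul _
  have h4 : (inner ℂ f f : ℂ).re = ‖f‖ ^ 2 := (norm_sq_eq_re_inner (𝕜 := ℂ) f).symm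
  rw [add_apply, one_apply_eq_self, inner_add_right, Complex.add_re, h4]
  have h5 := (abs_le.1 ((Complex.abs_re_le_norm _).trans h1)).1
  linarith

end Hilbert

/-- The resolvent at `-κ²` of `-Δ + l ε⁻² V(ε⁻¹ ·)`. -/
def kreinRes (V : R3 → ℝ) (κ ε l : ℝ) : L2 →L[ℂ] L2 :=
  freeRes κ - ((l * ε : ℝ) : ℂ) • (star (sideOp V κ ε) *
    Ring.inverse (1 + (l : ℂ) • (signOp V * bsOp V (κ * ε))) * signOp V * sideOp V κ ε)

section Resolvent

variable {V : R3 → ℝ} {κ ε : ℝ}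

theorem exists_dilation_factor (hVR : Rollnik V) (hκ : 0 < κ) (hε : 0 < ε) :
    ∃ T : L2 →L[ℂ] L2, (∀ h, T h =ᵐ[volume] fun x => (sqrtAbs V x : ℂ) * dilRes κ hε h x) ∧
      T * star T = bsOp V (κ * ε) :=
  exists_mul_eq_hsOp_bsKernel (aestronglyMeasurable_sqrtAbs hVR.1.aestronglyMeasurable)
    (sqrtAbs_nonneg V) (memLp_bsKernel_of_rollnik hVR) (mul_pos hκ hε) (dilRes_mul_star hε hκ)

theorem hasRealResolvent_dilation (hVR : Rollnik V) (hV : Integrable V) (hκ : 0 < κ) (hε : 0 < ε)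
    (c : ℝ) (hu : IsUnit (1 + ((c * ε ^ 2 : ℝ) : ℂ) • (signOp V * bsOp V (κ * ε)))) :
    HasRealResolvent (formSumGraph fun x => c * V (ε⁻¹ • x)) (-κ ^ 2)
      (kreinRes V κ ε (c * ε ^ 2)) := by
  obtain ⟨T, hT, hTT⟩ := exists_dilation_factor hVR hκ hε
  obtain ⟨hu', e⟩ := krein_formula hε.le (isSelfAdjoint_sqrtRes hκ)
    (mul_sqrtRes_eq_sideOp hV hκ hε hT) hTT (sqrtRes_mul_self hκ) hu
  have h := hasRealResolvent_formSum hκ (representsPotential_dilation hV.1 hε hT c)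
    (isSelfAdjoint_sandwich _ _ (isSelfAdjoint_signOp hV.1)) hu'
  rw [kreinRes, ← e]
  exact h

theorem isSelfAdjoint_and_lowerSemibounded (hVR : Rollnik V) (hV : Integrable V) (hκ : 0 < κ)
    (hε : 0 < ε) (c : ℝ) (h : |c * ε ^ 2| * ‖bsOp V (κ * ε)‖ < 1) :
    IsSelfAdjoint (formSum fun x => c * V (ε⁻¹ • x)) ∧
      LowerSemibounded (formSum fun x => c * V (ε⁻¹ • x)) := by
  have hS := norm_signOp_le hV.1
  have hu := isUnit_one_add_smul_mul_of_norm_lt hS h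
  refine ⟨(hasRealResolvent_dilation hVR hV hκ hε c hu).isSelfAdjoint, ?_⟩
  obtain ⟨T, hT, hTT⟩ := exists_dilation_factor hVR hκ hε
  rw [← hTT] at hu h
  exact lowerSemibounded_formSum hκ (representsPotential_dilation hV.1 hε hT c)
    (isSelfAdjoint_sandwich _ _ (isSelfAdjoint_signOp hV.1)) (inverse_one_add_sandwich _ hu).1
    (re_inner_one_add_sandwich_nonneg hS h)

theorem hsOp_zero : hsOp (fun _ => 0) = 0 := by
  refine norm_le_zero_iff.1 ((norm_hsOp_le _).trans ?_)
  simp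

/-- The kernel at zero mass dominates all others and is square integrable by the Rollnik condition,
so pointwise convergence of kernels is enough. -/
theorem tendsto_bsOp {ι : Type*} {l : Filter ι} [l.IsCountablyGenerated] {K : ι → ℝ}
    {k : R3 × R3 → ℝ} (hVR : Rollnik V) (hK : ∀ᶠ i in l, 0 ≤ K i)
    (hk : AEStronglyMeasurable k vol2) (hkle : ∀ p, |k p| ≤ |bsKernel (sqrtAbs V) 0 p|)
    (hlim : ∀ p, Tendsto (fun i => bsKernel (sqrtAbs V) (K i) p) l (𝓝 (k p))) :
    Tendsto (fun i => bsOp V (K i)) l (𝓝 (hsOp k)) := by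
  have hm := aestronglyMeasurable_sqrtAbs hVR.1.aestronglyMeasurable
  refine tendsto_hsOp (Eventually.of_forall fun i => aestronglyMeasurable_bsKernel hm _) hk
    (memLp_bsKernel_of_rollnik hVR).abs ?_ (Eventually.of_forall hkle) (Eventually.of_forall hlim)
  filter_upwards [hK] with i hi
  exact Eventually.of_forall fun p => abs_bsKernel_le hi (fun _ => le_rfl) p

theorem tendsto_yukawa_atTop (x : R3) : Tendsto (fun κ => yukawa κ x) atTop (𝓝 0) := by
  rcases eq_or_ne x 0 with rfl | hx
  · simp [yukawa]
  have h : Tendsto (fun κ : ℝ => κ * ‖x‖) atTop atTop :=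
    tendsto_id.atTop_mul_const (norm_pos_iff.2 hx)
  have h2 := (Real.tendsto_exp_neg_atTop_nhds_zero.comp h).div_const (4 * Real.pi * ‖x‖)
  rw [zero_div] at h2
  exact h2

theorem tendsto_bsOp_atTop (hVR : Rollnik V) : Tendsto (bsOp V) atTop (𝓝 0) := by
  rw [← hsOp_zero]
  refine tendsto_bsOp hVR (eventually_ge_atTop 0) aestronglyMeasurable_const
    (fun p => by simp) fun p => ?_
  have := ((tendsto_yukawa_atTop (p.1 - p.2)).const_mul (sqrtAbs V p.1)).mul_const (sqrtAbs V p.2)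
  simpa [bsKernel] using! this

theorem continuous_yukawa_left (x : R3) : Continuous fun κ => yukawa κ x := by
  unfold yukawa
  fun_prop

theorem tendsto_bsOp_zero (hVR : Rollnik V) (hκ : 0 < κ) :
    Tendsto (fun ε => bsOp V (κ * ε)) (𝓝[>] 0) (𝓝 (bsOp V 0)) := by
  have hm := aestronglyMeasurable_sqrtAbs hVR.1.aestronglyMeasurable
  refine tendsto_bsOp hVR ?_ (aestronglyMeasurable_bsKernel hm 0) (fun p => le_rfl) fun p => ?_
  · filter_upwards [self_mem_nhdsWithin] with ε hε
    exact mul_nonneg hκ.le (le_of_lt hε)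
  · have h : Continuous fun ε => bsKernel (sqrtAbs V) (κ * ε) p := by
      have := (continuous_yukawa_left (p.1 - p.2)).comp (continuous_const_mul κ)
      exact (continuous_const.mul this).mul continuous_const
    have h2 := h.tendsto 0
    rw [mul_zero] at h2
    exact h2.mono_left nhdsWithin_le_nhds

/-- No smallness of `c` is needed: for fixed `ε` the Birman–Schwinger operator tends to zero as `κ →
∞`, so `κ` is chosen after `c` and `ε`. -/
theorem isSelfAdjoint_formSum_dilation (hVR : Rollnik V) (hV : Integrable V) (hε : 0 < ε) (c : ℝ) :
    IsSelfAdjoint (formSum fun x => c * V (ε⁻¹ • x)) ∧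
      LowerSemibounded (formSum fun x => c * V (ε⁻¹ • x)) := by
  have h1 : Tendsto (fun κ => |c * ε ^ 2| * ‖bsOp V (κ * ε)‖) atTop (𝓝 0) := by
    have := ((tendsto_bsOp_atTop hVR).comp (tendsto_id.atTop_mul_const hε)).norm.const_mul
      |c * ε ^ 2|
    simpa using! this
  obtain ⟨κ, h2, h3⟩ := ((h1.eventually_lt_const zero_lt_one).and (eventually_gt_atTop 0)).exists
  exact isSelfAdjoint_and_lowerSemibounded hVR hV h3 hε c h2

end Resolvent

/-! ### Norm resolvent convergence to the free Laplacian -/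

theorem tendsto_smul_sandwich_zero {ι H : Type*} [NormedAddCommGroup H] [InnerProductSpace ℂ H]
    [CompleteSpace H] {f : Filter ι} {c : ι → ℂ} {X N : ι → H →L[ℂ] H} {N₀ : H →L[ℂ] H}
    (S : H →L[ℂ] H) {C : ℝ} (hc : Tendsto c f (𝓝 0)) (hX : ∀ i, ‖X i‖ ≤ C)
    (hN : Tendsto N f (𝓝 N₀)) :
    Tendsto (fun i => c i • (star (X i) * N i * S * X i)) f (𝓝 0) := by
  have h0 : Tendsto (fun i => ‖c i‖ * (C * ‖N i‖ * ‖S‖ * C)) f (𝓝 0) := by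
    have := hc.norm.mul (((hN.norm.const_mul C).mul_const ‖S‖).mul_const C)
    simpa using this
  refine squeeze_zero_norm (fun i => ?_) h0
  have hC : 0 ≤ C := (norm_nonneg _).trans (hX i)
  rw [norm_smul]
  refine mul_le_mul_of_nonneg_left ?_ (norm_nonneg _)
  have h1 : ‖star (X i)‖ ≤ C := by rw [norm_star]; exact hX i
  calc ‖star (X i) * N i * S * X i‖ ≤ ‖star (X i)‖ * ‖N i‖ * ‖S‖ * ‖X i‖ := by
        refine (norm_mul_le _ _).trans ?_
        gcongr
        refine (norm_mul_le _ _).trans ?_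
        gcongr
        exact norm_mul_le _ _
    _ ≤ C * ‖N i‖ * ‖S‖ * C := by gcongr; exact hX i

theorem tendsto_inverse_one_add_smul {ι A : Type*} [NormedRing A] [NormedAlgebra ℂ A]
    [HasSummableGeomSeries A] {f : Filter ι} {l : ι → ℝ} {l₀ : ℝ} {B : ι → A} {B₀ : A} (S : A)
    (hl : Tendsto l f (𝓝 l₀)) (hB : Tendsto B f (𝓝 B₀))
    (hu : IsUnit (1 + (l₀ : ℂ) • (S * B₀))) :
    (∀ᶠ i in f, IsUnit (1 + (l i : ℂ) • (S * B i))) ∧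
      Tendsto (fun i => Ring.inverse (1 + (l i : ℂ) • (S * B i))) f
        (𝓝 (Ring.inverse (1 + (l₀ : ℂ) • (S * B₀)))) := by
  have h : Tendsto (fun i => 1 + (l i : ℂ) • (S * B i)) f (𝓝 (1 + (l₀ : ℂ) • (S * B₀))) :=
    (((Complex.continuous_ofReal.tendsto l₀).comp hl).smul (hB.const_mul S)).const_add 1
  refine ⟨h.eventually (Units.isOpen.mem_nhds hu), ?_⟩
  obtain ⟨u, hu⟩ := hu
  rw [← hu] at h ⊢
  exact (NormedRing.inverse_continuousAt u).tendsto.comp h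

section Convergence

variable {V : R3 → ℝ} {κ : ℝ}

/-- The inverse in Krein's formula stays bounded near an invertible limit, and its prefactor `l ε`
tends to zero. -/
theorem tendsto_kreinRes (hVR : Rollnik V) (hV : Integrable V) (hκ : 0 < κ) {l : ℝ → ℝ} {l₀ : ℝ}
    (hl : Tendsto l (𝓝[>] 0) (𝓝 l₀)) (hu : IsUnit (1 + (l₀ : ℂ) • (signOp V * bsOp V 0))) :
    (∀ᶠ ε in 𝓝[>] 0, IsUnit (1 + (l ε : ℂ) • (signOp V * bsOp V (κ * ε)))) ∧
      Tendsto (fun ε => kreinRes V κ ε (l ε)) (𝓝[>] 0) (𝓝 (freeRes κ)) := by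
  obtain ⟨h1, h2⟩ := tendsto_inverse_one_add_smul (signOp V) hl (tendsto_bsOp_zero hVR hκ) hu
  refine ⟨h1, ?_⟩
  have hε : Tendsto (fun ε : ℝ => ε) (𝓝[>] 0) (𝓝 0) := tendsto_id.mono_left nhdsWithin_le_nhds
  have hc : Tendsto (fun ε => ((l ε * ε : ℝ) : ℂ)) (𝓝[>] 0) (𝓝 0) := by
    have := (Complex.continuous_ofReal.tendsto _).comp (hl.mul hε)
    rwa [mul_zero] at this
  have h3 := tendsto_smul_sandwich_zero (signOp V) hc (norm_sideOp_le hV hκ) h2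
  have h4 := h3.const_sub (freeRes κ)
  rw [sub_zero] at h4
  exact h4

/-- The coupling constant `η(ε) ε^{2 - σ}`. -/
def coupling (η : ℝ → ℝ) (σ ε : ℝ) : ℝ := η ε / ε ^ σ * ε ^ 2

/-- The limit `0 ^ (2 - σ)` treats both regimes at once: it is `1` for `σ = 2` and `0` for `σ < 2`.
-/
theorem tendsto_coupling {η : ℝ → ℝ} (hη : ContinuousWithinAt η (Icc 0 1) 0) (hη0 : η 0 = 1)
    {σ : ℝ} (hσ : σ ≤ 2) : Tendsto (coupling η σ) (𝓝[>] 0) (𝓝 (0 ^ (2 - σ))) := by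
  have h1 : Tendsto η (𝓝[>] 0) (𝓝 1) := by
    rw [← hη0]
    exact hη.tendsto.mono_left (nhdsWithin_le_of_mem (Icc_mem_nhdsGT one_pos))
  have h2 : Tendsto (fun ε : ℝ => ε ^ (2 - σ)) (𝓝[>] 0) (𝓝 (0 ^ (2 - σ))) :=
    ((Real.continuous_rpow_const (by linarith)).tendsto 0).mono_left nhdsWithin_le_nhds
  have h3 := h1.mul h2
  rw [one_mul] at h3
  refine h3.congr' ?_
  filter_upwards [self_mem_nhdsWithin] with ε hε
  rw [coupling, Real.rpow_sub hε, Real.rpow_two]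
  ring

theorem bsOp_zero_coeFn (hVR : Rollnik V) (f : L2) :
    bsOp V 0 f =ᵐ[volume] fun x => (sqrtAbs V x : ℂ) * resonanceFunction V f x := by
  filter_upwards [hsOp_coeFn (memLp_bsKernel_of_rollnik hVR) f] with x hx
  rw [bsOp, hx, kernelInt, resonanceFunction, newtonPotential, ← integral_const_mul]
  refine integral_congr_ae (Eventually.of_forall fun y => ?_)
  simp only [bsKernel, yukawa, sqrtAbs, zero_mul, neg_zero, Real.exp_zero, one_div,
    Complex.ofReal_mul]
  ring

/-- Since `u = sign(V) v`, the operator `u (-Δ)⁻¹ v` is `S B₀`. -/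
theorem isBirmanSchwingerSolution_iff (hVR : Rollnik V) (f : L2) :
    IsBirmanSchwingerSolution V f ↔ f + (signOp V * bsOp V 0) f = 0 := by
  have h : (signOp V * bsOp V 0) f =ᵐ[volume]
      fun x => ((√|V x| * Real.sign (V x) : ℝ) : ℂ) * resonanceFunction V f x := by
    rw [mul_apply_eq_comp]
    filter_upwards [signOp_coeFn hVR.1.aestronglyMeasurable (bsOp V 0 f),
      bsOp_zero_coeFn hVR f] with x h1 h2
    rw [h1, h2, sqrtAbs, Complex.ofReal_mul]
    ring
  rw [add_comm, add_eq_zero_iff_eq_neg, Lp.ext_iff]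
  constructor
  · intro hf
    filter_upwards [h, hf, Lp.coeFn_neg f] with x h1 h2 h3
    rw [h1, h2, h3, Pi.neg_apply]
  · intro hf
    filter_upwards [h, hf, Lp.coeFn_neg f] with x h1 h2 h3
    rw [← h1, h2, h3, Pi.neg_apply]

theorem isCompactOperator_signOp_mul_bsOp (V : R3 → ℝ) (κ : ℝ) :
    IsCompactOperator (signOp V * bsOp V κ) :=
  (isCompactOperator_hsOp _).clm_comp (signOp V)

theorem isUnit_of_not_hasEigenvalueNegOne (hVR : Rollnik V) (h : ¬ HasEigenvalueNegOne V) :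
    IsUnit (1 + signOp V * bsOp V 0) := by
  refine isUnit_one_add_of_isCompactOperator (isCompactOperator_signOp_mul_bsOp V 0) fun f hf => ?_
  by_contra hf0
  exact h ⟨f, hf0, (isBirmanSchwingerSolution_iff hVR f).2 hf⟩

theorem normResolventConverges_negLaplacian (hVR : Rollnik V) (hV : Integrable V) {η : ℝ → ℝ}
    (hη : ContinuousWithinAt η (Icc 0 1) 0) (hη0 : η 0 = 1) {σ : ℝ} (hσ : σ ≤ 2)
    (hV2 : σ = 2 → ¬ HasEigenvalueNegOne V) :
    NormResolventConverges (fun ε => formSum (scaledPotential V η σ ε)) negLaplacian := by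
  have hu : IsUnit (1 + (((0 : ℝ) ^ (2 - σ) : ℝ) : ℂ) • (signOp V * bsOp V 0)) := by
    rcases eq_or_lt_of_le hσ with rfl | hσ'
    · rw [sub_self, Real.rpow_zero, Complex.ofReal_one, one_smul]
      exact isUnit_of_not_hasEigenvalueNegOne hVR (hV2 rfl)
    · rw [Real.zero_rpow (by linarith), Complex.ofReal_zero, zero_smul, add_zero]
      exact isUnit_one
  obtain ⟨h1, h2⟩ := tendsto_kreinRes hVR hV one_pos (tendsto_coupling hη hη0 hσ) hu
  refine normResolventConverges_of_hasRealResolvent ?_ (hasRealResolvent_negLaplacian one_pos) h2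
  filter_upwards [h1, self_mem_nhdsWithin] with ε h3 hε
  exact hasRealResolvent_dilation hVR hV one_pos hε _ h3

end Convergence

/-! ### Strong resolvent convergence for positive potentials -/

/-- If `g` is orthogonal to `J (G^⊥)`, then `J g` lies in the double orthogonal complement of `G`,
hence `J g = c G`. So `c = 0`, and `g = 0` by injectivity. -/
theorem dense_image_orthogonal {H : Type*} [NormedAddCommGroup H] [InnerProductSpace ℂ H]
    [CompleteSpace H] {J : H →L[ℂ] H} (hJ : IsSelfAdjoint J) (hinj : ∀ g, J g = 0 → g = 0) {G : H}
    (hG : ∀ (g : H) (c : ℂ), J g = c • G → c = 0) :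
    Dense {k | ∃ f, inner ℂ G f = 0 ∧ J f = k} := by
  let K : Submodule ℂ H := (ℂ ∙ G)ᗮ.map (J : H →ₗ[ℂ] H)
  have hK : (K : Set H) ⊆ {k | ∃ f, inner ℂ G f = 0 ∧ J f = k} := by
    rintro _ ⟨f, hf, rfl⟩
    exact ⟨f, Submodule.mem_orthogonal_singleton_iff_inner_right.1 hf, rfl⟩
  refine Dense.mono hK ?_
  rw [Submodule.dense_iff_topologicalClosure_eq_top, Submodule.topologicalClosure_eq_top_iff,
    Submodule.eq_bot_iff]
  intro g hg
  have h1 : J g ∈ (ℂ ∙ G)ᗮᗮ := by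
    rw [Submodule.mem_orthogonal]
    intro f hf
    refine (hJ.isSymmetric f g).symm.trans ?_
    exact (Submodule.mem_orthogonal _ _).1 hg _ ⟨f, hf, rfl⟩
  rw [Submodule.orthogonal_orthogonal] at h1
  obtain ⟨c, hc⟩ := Submodule.mem_span_singleton.1 h1
  have h0 := hG g c hc.symm
  rw [h0, zero_smul] at hc
  exact hinj g hc.symm

section Strong

variable {V : R3 → ℝ} {κ ε : ℝ}

theorem not_integrable_inv_symbol (hκ : 0 < κ) : ¬ Integrable fun ξ => (symbol κ ξ)⁻¹ := by
  intro h
  have h1 := (integrable_fun_norm_addHaar (volume : Measure R3)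
    (f := fun r : ℝ => ((2 * Real.pi) ^ 2 * r ^ 2 + κ ^ 2)⁻¹)).1 h
  rw [finrank_R3] at h1
  have h2 := h1.mono_set (Ioi_subset_Ioi (zero_le_one (α := ℝ)))
  have h3 : IntegrableOn (fun _ : ℝ => ((2 * Real.pi) ^ 2 + κ ^ 2)⁻¹) (Ioi 1) := by
    refine Integrable.mono' h2 aestronglyMeasurable_const ?_
    filter_upwards [ae_restrict_mem measurableSet_Ioi] with r hr
    have hr : 1 < r := hr
    rw [Real.norm_of_nonneg (by positivity), smul_eq_mul, ← div_eq_mul_inv,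
      inv_le_iff_one_le_mul₀ (by positivity), div_mul_eq_mul_div, le_div_iff₀ (by positivity)]
    simp only [Nat.add_one_sub_one]
    nlinarith [mul_nonneg (sq_nonneg κ) (show (0 : ℝ) ≤ r ^ 2 - 1 by nlinarith)]
  rw [integrableOn_const_iff] at h3
  rcases h3 with h3 | h3
  · have : 0 < ((2 * Real.pi) ^ 2 + κ ^ 2)⁻¹ := by positivity
    simp [this.ne'] at h3
  · simp at h3

/-- Such a `g` has Fourier transform `c (4π²|ξ|² + κ²)^{-1/2}`, which is not square integrable in
dimension three. In other words, `H¹` functions have no point values. -/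
theorem eq_zero_of_sqrtRes_eq_smul_yukawaL2 (hκ : 0 < κ) (g : L2) (c : ℂ)
    (h : sqrtRes κ g = c • yukawaL2 hκ) : c = 0 := by
  have h2 : ∀ᵐ ξ, (𝓕 g : L2) ξ = c * (((√(symbol κ ξ))⁻¹ : ℝ) : ℂ) := by
    have h3 := fourier_sqrtRes hκ g
    rw [h, show (𝓕 (c • yukawaL2 hκ) : L2) = c • (𝓕 (yukawaL2 hκ) : L2) from
      (Lp.fourierTransformₗᵢ R3 ℂ).map_smul c (yukawaL2 hκ)] at h3
    filter_upwards [h3, Lp.coeFn_smul c (𝓕 (yukawaL2 hκ) : L2), fourier_yukawaL2 hκ]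
      with ξ h4 h5 h6
    have hs : 0 < √(symbol κ ξ) := Real.sqrt_pos.2 (symbol_pos hκ ξ)
    have e : (symbol κ ξ)⁻¹ = (√(symbol κ ξ))⁻¹ * (√(symbol κ ξ))⁻¹ := by
      rw [← mul_inv, Real.mul_self_sqrt (symbol_pos hκ ξ).le]
    rw [h5, Pi.smul_apply, h6, smul_eq_mul, e, Complex.ofReal_mul, mul_left_comm] at h4
    refine (mul_left_cancel₀ ?_ h4).symm
    exact_mod_cast (inv_pos.2 hs).ne'
  by_contra hc0
  refine not_integrable_inv_symbol hκ ?_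
  have h3 := (memLp_two_iff_integrable_sq_norm (Lp.memLp (𝓕 g : L2)).1).1 (Lp.memLp (𝓕 g : L2))
  have h4 := h3.const_mul (‖c‖ ^ 2)⁻¹
  refine h4.congr ?_
  filter_upwards [h2] with ξ hξ
  have hc : ‖c‖ ≠ 0 := norm_ne_zero_iff.2 hc0
  rw [hξ, norm_mul, mul_pow, Complex.norm_real, Real.norm_eq_abs, sq_abs, inv_pow,
    Real.sq_sqrt (symbol_pos hκ ξ).le]
  field_simp

theorem sideOp_coeFn (hV : Integrable V) (hκ : 0 < κ) (ε : ℝ) (f : L2) :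
    sideOp V κ ε f =ᵐ[volume] fun x => (sqrtAbs V x : ℂ) * yukawaConv κ f (ε • x) := by
  filter_upwards [hsOp_coeFn (memLp_sideKernel hV hκ ε) f] with x hx
  rw [sideOp, hx, kernelInt, yukawaConv, ← integral_const_mul]
  refine integral_congr_ae (Eventually.of_forall fun y => ?_)
  simp only [sideKernel, Complex.ofReal_mul]
  ring

theorem norm_sideOp_apply_sq (hV : Integrable V) (hκ : 0 < κ) (ε : ℝ) (f : L2) :
    ‖sideOp V κ ε f‖ ^ 2 = ∫ x, |V x| * ‖yukawaConv κ f (ε • x)‖ ^ 2 := by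
  rw [norm_sq_eq_integral]
  refine integral_congr_ae ?_
  filter_upwards [sideOp_coeFn hV hκ ε f] with x hx
  rw [hx, norm_mul, mul_pow, Complex.norm_real, Real.norm_of_nonneg (sqrtAbs_nonneg V x),
    sqrtAbs_sq]

/-- The image of `f` is `v(x) (G * f)(εx)`, and `(G * f)(0) = ⟪G, f⟫ = 0`. The sup bound on `G * f`
and `V ∈ L¹` give the domination. -/
theorem tendsto_sideOp_apply (hV : Integrable V) (hκ : 0 < κ) {f : L2}
    (hf : inner ℂ (yukawaL2 hκ) f = 0) :
    Tendsto (fun ε => ‖sideOp V κ ε f‖) (𝓝[>] 0) (𝓝 0) := by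
  have hc := continuous_yukawaConv hκ f
  have h : Tendsto (fun ε : ℝ => ∫ x, |V x| * ‖yukawaConv κ f (ε • x)‖ ^ 2) (𝓝[>] 0)
      (𝓝 (∫ _ : R3, (0 : ℝ))) := by
    refine tendsto_integral_filter_of_dominated_convergence
      (fun x => |V x| * (‖yukawaL2 hκ‖ * ‖f‖) ^ 2) (Eventually.of_forall fun ε => ?_)
      (Eventually.of_forall fun ε => Eventually.of_forall fun x => ?_) (hV.abs.mul_const _)
      (Eventually.of_forall fun x => ?_)
    · exact hV.abs.1.mul (((hc.comp (continuous_const_smul ε)).norm.pow 2).aestronglyMeasurable)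
    · rw [Real.norm_of_nonneg (by positivity)]
      gcongr
      exact norm_yukawaConv_le hκ f _
    · have h1 : Continuous fun ε : ℝ => |V x| * ‖yukawaConv κ f (ε • x)‖ ^ 2 := by fun_prop
      have h2 := h1.tendsto 0
      rw [zero_smul, yukawaConv_zero hκ, hf, norm_zero, zero_pow two_ne_zero, mul_zero] at h2
      exact h2.mono_left nhdsWithin_le_nhds
  rw [integral_zero] at h
  have h3 := (Real.continuous_sqrt.tendsto 0).comp h
  rw [Real.sqrt_zero] at h3
  refine h3.congr fun ε => ?_
  rw [Function.comp_apply, ← norm_sideOp_apply_sq hV hκ, Real.sqrt_sq (norm_nonneg _)]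

theorem signOp_eq_one (hV : AEStronglyMeasurable V volume) (hpos : ∀ᵐ x, 0 < V x) :
    signOp V = 1 := by
  refine ContinuousLinearMap.ext fun f => Lp.ext ?_
  rw [one_apply_eq_self]
  filter_upwards [signOp_coeFn hV f, hpos] with x h1 h2
  rw [h1, Real.sign_of_pos h2, Complex.ofReal_one, one_mul]

theorem smul_star_mul_one_mul {A : Type*} [Ring A] [StarRing A] [Algebra ℂ A] [StarModule ℂ A]
    {l : ℝ} (hl : 0 ≤ l) (T : A) :
    (l : ℂ) • (star T * 1 * T) = star (((√l : ℝ) : ℂ) • T) * (((√l : ℝ) : ℂ) • T) := by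
  rw [star_smul, smul_mul_smul_comm, mul_one]
  congr 1
  rw [show star ((√l : ℝ) : ℂ) = ((√l : ℝ) : ℂ) from Complex.conj_ofReal _, ← Complex.ofReal_mul,
    Real.mul_self_sqrt hl]

/-- For `V > 0` the sign operator is the identity, so the perturbation is `X* X` with `X = √l T`,
and `1 + X* X` is invertible however large `l` is. -/
theorem exists_positive_resolvent (hVR : Rollnik V) (hV : Integrable V) (hpos : ∀ᵐ x, 0 < V x)
    (hκ : 0 < κ) (hε : 0 < ε) {c : ℝ} (hc : 0 ≤ c * ε ^ 2) :
    ∃ X : L2 →L[ℂ] L2, HasRealResolvent (formSumGraph fun x => c * V (ε⁻¹ • x)) (-κ ^ 2)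
        (sqrtRes κ * Ring.inverse (1 + star X * X) * sqrtRes κ) ∧
      ∀ f, ‖X (sqrtRes κ f)‖ = √(c * ε ^ 2 * ε) * ‖sideOp V κ ε f‖ := by
  obtain ⟨T, hT, -⟩ := exists_dilation_factor hVR hκ hε
  have hrep := representsPotential_dilation hV.1 hε hT c
  have hsa := isSelfAdjoint_sandwich (c * ε ^ 2) T (isSelfAdjoint_signOp hV.1)
  rw [signOp_eq_one hV.1 hpos, smul_star_mul_one_mul hc] at hrep hsa
  refine ⟨((√(c * ε ^ 2) : ℝ) : ℂ) • T, hasRealResolvent_formSum hκ hrep hsa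
    (isUnit_one_add_adjoint_mul _), fun f => ?_⟩
  have h1 := congrArg (fun K : L2 →L[ℂ] L2 => K f) (mul_sqrtRes_eq_sideOp hV hκ hε hT)
  simp only [mul_apply_eq_comp, smul_apply] at h1
  rw [smul_apply, h1, norm_smul, norm_smul, Complex.norm_real, Complex.norm_real,
    Real.norm_of_nonneg (Real.sqrt_nonneg _), Real.norm_of_nonneg (Real.sqrt_nonneg _),
    ← mul_assoc, ← Real.sqrt_mul hc]

/-- An extra `ε` lowers `σ` by one. This is where the threshold `σ = 3` comes from: up to it `η(ε)
ε^{3-σ}` stays bounded. -/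
theorem tendsto_coupling_mul {η : ℝ → ℝ} (hη : ContinuousWithinAt η (Icc 0 1) 0) (hη0 : η 0 = 1)
    {σ : ℝ} (hσ : σ ≤ 3) :
    Tendsto (fun ε => coupling η σ ε * ε) (𝓝[>] 0) (𝓝 (0 ^ (3 - σ))) := by
  refine (tendsto_coupling hη hη0 (σ := σ - 1) (by linarith)).congr' ?_ |>.trans_eq ?_
  · filter_upwards [self_mem_nhdsWithin] with ε hε
    rw [coupling, coupling, Real.rpow_sub_one (ne_of_gt hε)]
    have : (0 : ℝ) < ε := hε
    field_simp
  · congr 2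
    ring

theorem strongResolventConverges_negLaplacian (hVR : Rollnik V) (hV : Integrable V)
    (hpos : ∀ᵐ x, 0 < V x) {η : ℝ → ℝ} (hη : ContinuousWithinAt η (Icc 0 1) 0)
    (hη_nonneg : ∀ t ∈ Icc (0 : ℝ) 1, 0 ≤ η t) (hη0 : η 0 = 1) {σ : ℝ} (hσ : σ ≤ 3) :
    StrongResolventConverges (fun ε => formSum (scaledPotential V η σ ε)) negLaplacian := by
  have hex : ∀ ε : ℝ, ∃ X : L2 →L[ℂ] L2, ε ∈ Ioc (0 : ℝ) 1 →
      HasRealResolvent (formSumGraph (scaledPotential V η σ ε)) (-1 ^ 2)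
        (sqrtRes 1 * Ring.inverse (1 + star X * X) * sqrtRes 1) ∧
      ∀ f, ‖X (sqrtRes 1 f)‖ = √(coupling η σ ε * ε) * ‖sideOp V 1 ε f‖ := fun ε => by
    by_cases hε : ε ∈ Ioc (0 : ℝ) 1
    · have h0 : 0 ≤ η ε / ε ^ σ * ε ^ 2 :=
        mul_nonneg (div_nonneg (hη_nonneg _ ⟨hε.1.le, hε.2⟩) (Real.rpow_nonneg hε.1.le _))
          (sq_nonneg _)
      obtain ⟨X, h1, h2⟩ := exists_positive_resolvent hVR hV hpos one_pos hε.1 h0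
      exact ⟨X, fun _ => ⟨h1, h2⟩⟩
    · exact ⟨0, fun h => absurd h hε⟩
  choose X hX using hex
  have hev : ∀ᶠ ε in 𝓝[>] (0 : ℝ), ε ∈ Ioc (0 : ℝ) 1 := Ioc_mem_nhdsGT one_pos
  -- The dense set consists of the vectors `J f` with `f ⊥ G`, on which `X J f` tends to zero.
  have hlim := tendsto_inverse_one_add_adjoint_mul (X := X) (l := 𝓝[>] (0 : ℝ))
    (dense_image_orthogonal (isSelfAdjoint_sqrtRes one_pos) (sqrtRes_injective one_pos)
      (eq_zero_of_sqrtRes_eq_smul_yukawaL2 one_pos)) (by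
    rintro _ ⟨f, hf, rfl⟩
    rw [tendsto_zero_iff_norm_tendsto_zero]
    have h1 := ((Real.continuous_sqrt.tendsto _).comp (tendsto_coupling_mul hη hη0 hσ)).mul
      (tendsto_sideOp_apply hV one_pos hf)
    rw [mul_zero] at h1
    refine h1.congr' ?_
    filter_upwards [hev] with ε hε
    exact ((hX ε hε).2 f).symm)
  refine strongResolventConverges_of_hasRealResolvent (hev.mono fun ε hε => (hX ε hε).1)
    (hasRealResolvent_negLaplacian one_pos) fun f => ?_
  have h2 := ((sqrtRes 1).continuous.tendsto _).comp (hlim (sqrtRes 1 f))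
  rw [← mul_apply_eq_comp, sqrtRes_mul_self one_pos] at h2
  exact h2

end Strong

/-! ### Expansions as `ε ↓ 0` -/

/-- `v = √|V|` as an element of `L²`. -/
def sqrtAbsL2 {V : R3 → ℝ} (hV : Integrable V) : L2 := ((memLp_sqrtAbs hV).ofReal (K := ℂ)).toLp _

section Expansion

variable {V : R3 → ℝ} {κ : ℝ}

theorem sqrtAbsL2_coeFn (hV : Integrable V) :
    sqrtAbsL2 hV =ᵐ[volume] fun x => (sqrtAbs V x : ℂ) := MemLp.coeFn_toLp _

theorem integrable_yukawa_mul_sub (hκ : 0 < κ) (a : R3) :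
    Integrable fun y => yukawa κ (a - y) * yukawa κ y := by
  have h : MemLp (fun y => yukawa κ (a - y)) 2 volume :=
    (memLp_yukawa hκ).comp_measurePreserving (Measure.measurePreserving_sub_left volume a)
  exact h.integrable_mul (memLp_yukawa hκ)

/-- The squared `L²` modulus of continuity of the Yukawa potential. -/
def yukawaModulus (κ : ℝ) (a : R3) : ℝ := ∫ y, (yukawa κ (a - y) - yukawa κ y) ^ 2

theorem yukawaModulus_eq (hκ : 0 < κ) (a : R3) :
    yukawaModulus κ a = 2 * (∫ y, yukawa κ y ^ 2) - 2 * (yukawaConv κ (yukawaL2 hκ) a).re := by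
  have h1 : yukawaConv κ (yukawaL2 hκ) a = ((∫ y, yukawa κ (a - y) * yukawa κ y : ℝ) : ℂ) := by
    rw [yukawaConv_congr (yukawaL2_coeFn hκ), yukawaConv, ← integral_complex_ofReal]
    simp only [Complex.ofReal_mul]
  have h2 : ∀ y, (yukawa κ (a - y) - yukawa κ y) ^ 2 = yukawa κ (a - y) ^ 2 + yukawa κ y ^ 2
      - 2 * (yukawa κ (a - y) * yukawa κ y) := fun y => by ring
  rw [h1, Complex.ofReal_re, yukawaModulus]
  simp_rw [h2]
  have h3 : Integrable fun y => yukawa κ (a - y) ^ 2 + yukawa κ y ^ 2 :=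
    (integrable_yukawa_sub_sq hκ a).add (integrable_yukawa_sq hκ)
  rw [integral_sub h3 ((integrable_yukawa_mul_sub hκ a).const_mul 2),
    integral_add (integrable_yukawa_sub_sq hκ a) (integrable_yukawa_sq hκ), integral_const_mul,
    integral_yukawa_sub_sq]
  ring

theorem continuous_yukawaModulus (hκ : 0 < κ) : Continuous (yukawaModulus κ) := by
  rw [show yukawaModulus κ = _ from funext (yukawaModulus_eq hκ)]
  have := continuous_yukawaConv hκ (yukawaL2 hκ)
  fun_prop

theorem yukawaModulus_zero (κ : ℝ) : yukawaModulus κ 0 = 0 := by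
  simp [yukawaModulus, yukawa_neg]

theorem yukawaModulus_nonneg (κ : ℝ) (a : R3) : 0 ≤ yukawaModulus κ a :=
  integral_nonneg fun _ => sq_nonneg _

/-- The cross term in the expanded square is subtracted and is nonnegative, because the Yukawa
potential is. -/
theorem yukawaModulus_le (hκ : 0 < κ) (a : R3) :
    yukawaModulus κ a ≤ 2 * ∫ y, yukawa κ y ^ 2 := by
  rw [yukawaModulus_eq hκ, yukawaConv_congr (yukawaL2_coeFn hκ)]
  have h : 0 ≤ (yukawaConv κ (fun y => (yukawa κ y : ℂ)) a).re := by
    simp only [yukawaConv, ← Complex.ofReal_mul]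
    rw [integral_complex_ofReal, Complex.ofReal_re]
    exact integral_nonneg fun y => mul_nonneg (yukawa_nonneg _ _) (yukawa_nonneg _ _)
  linarith

theorem norm_sideOp_sub_le (hV : Integrable V) (hκ : 0 < κ) (ε : ℝ) :
    ‖sideOp V κ ε - rankOne (sqrtAbsL2 hV) (yukawaL2 hκ)‖
      ≤ √(∫ x, |V x| * yukawaModulus κ (ε • x)) := by
  have h1 : rankOne (sqrtAbsL2 hV) (yukawaL2 hκ) = hsOp fun p => sqrtAbs V p.1 * yukawa κ p.2 :=
    (hsOp_mul_prod (memLp_sqrtAbs hV) (memLp_yukawa hκ)).symm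
  have hk := memLp_sideKernel hV hκ ε
  have hk' := memLp_mul_prod (memLp_sqrtAbs hV) (memLp_yukawa hκ)
  have hd : MemLp (fun p => sideKernel V κ ε p - sqrtAbs V p.1 * yukawa κ p.2) 2 vol2 := hk.sub hk'
  rw [h1, sideOp, ← hsOp_sub hk hk']
  refine (norm_hsOp_le _).trans (Real.sqrt_le_sqrt (le_of_eq ?_))
  rw [integral_prod _ hd.integrable_sq]
  refine integral_congr_ae (Eventually.of_forall fun x => ?_)
  dsimp only
  rw [yukawaModulus, ← integral_const_mul]
  refine integral_congr_ae (Eventually.of_forall fun y => ?_)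
  dsimp only
  rw [sideKernel, ← mul_sub, mul_pow, sqrtAbs_sq]

/-- As `G` is even, the limit kernel is `v(x) G(y)`. The squared error is the `|V|`-weighted modulus
of continuity of `G` in `L²`, which is continuous, bounded, and zero at the origin. -/
theorem tendsto_sideOp (hV : Integrable V) (hκ : 0 < κ) :
    Tendsto (sideOp V κ) (𝓝[>] 0) (𝓝 (rankOne (sqrtAbsL2 hV) (yukawaL2 hκ))) := by
  rw [tendsto_iff_norm_sub_tendsto_zero]
  have hc := continuous_yukawaModulus hκ
  have h : Tendsto (fun ε : ℝ => ∫ x, |V x| * yukawaModulus κ (ε • x)) (𝓝[>] 0)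
      (𝓝 (∫ _ : R3, (0 : ℝ))) := by
    refine tendsto_integral_filter_of_dominated_convergence
      (fun x => |V x| * (2 * ∫ y, yukawa κ y ^ 2)) (Eventually.of_forall fun ε => ?_)
      (Eventually.of_forall fun ε => Eventually.of_forall fun x => ?_) (hV.abs.mul_const _)
      (Eventually.of_forall fun x => ?_)
    · exact hV.abs.1.mul (hc.comp (continuous_const_smul ε)).aestronglyMeasurable
    · rw [Real.norm_of_nonneg (mul_nonneg (abs_nonneg _) (yukawaModulus_nonneg _ _))]
      exact mul_le_mul_of_nonneg_left (yukawaModulus_le hκ _) (abs_nonneg _)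
    · have h1 : Continuous fun ε : ℝ => |V x| * yukawaModulus κ (ε • x) := by fun_prop
      have h2 := h1.tendsto 0
      rw [zero_smul, yukawaModulus_zero, mul_zero] at h2
      exact h2.mono_left nhdsWithin_le_nhds
  rw [integral_zero] at h
  have h3 := (Real.continuous_sqrt.tendsto 0).comp h
  rw [Real.sqrt_zero] at h3
  exact squeeze_zero (fun _ => norm_nonneg _) (norm_sideOp_sub_le hV hκ) h3

theorem ae_fst_ne_snd : ∀ᵐ p ∂vol2, p.1 ≠ p.2 := by
  rw [ae_iff]
  simp only [ne_eq, not_not]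
  rw [Measure.measure_prod_null (measurableSet_eq_fun measurable_fst measurable_snd)]
  refine Eventually.of_forall fun x => ?_
  have : Prod.mk x ⁻¹' {p : R3 × R3 | p.1 = p.2} = {x} := by
    ext y
    simp [eq_comm]
  exact (congrArg _ this).trans (measure_singleton x)

theorem yukawa_sub_yukawa_zero_div {κ ε : ℝ} (x : R3) :
    (yukawa (κ * ε) x - yukawa 0 x) / ε
      = (Real.exp (-(κ * ‖x‖ * ε)) - 1) / ε * (4 * Real.pi * ‖x‖)⁻¹ := by
  simp only [yukawa, zero_mul, neg_zero, Real.exp_zero]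
  rw [show κ * ε * ‖x‖ = κ * ‖x‖ * ε by ring]
  ring

/-- From `|e^{-s} - 1| ≤ s` with `s = κ ε |x|`; the factor `|x|` cancels the singularity, so the
bound is uniform in `x`. -/
theorem abs_yukawa_sub_yukawa_zero_div_le {κ ε : ℝ} (hκ : 0 < κ) (hε : 0 < ε) (x : R3) :
    |(yukawa (κ * ε) x - yukawa 0 x) / ε| ≤ κ / (4 * Real.pi) := by
  rw [yukawa_sub_yukawa_zero_div]
  rcases eq_or_ne x 0 with rfl | hx
  · simp only [norm_zero, mul_zero, inv_zero, abs_zero]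
    positivity
  have hn : 0 < ‖x‖ := norm_pos_iff.2 hx
  have h1 : |Real.exp (-(κ * ‖x‖ * ε)) - 1| ≤ κ * ‖x‖ * ε := by
    have h2 := Real.add_one_le_exp (-(κ * ‖x‖ * ε))
    have h3 : Real.exp (-(κ * ‖x‖ * ε)) ≤ 1 := Real.exp_le_one_iff.2 (by
      have : 0 ≤ κ * ‖x‖ * ε := by positivity
      linarith)
    exact abs_le.2 ⟨by linarith, by linarith [show 0 ≤ κ * ‖x‖ * ε by positivity]⟩
  rw [abs_mul, abs_div, abs_of_pos hε, abs_of_pos (a := (4 * Real.pi * ‖x‖)⁻¹) (by positivity)]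
  calc |Real.exp (-(κ * ‖x‖ * ε)) - 1| / ε * (4 * Real.pi * ‖x‖)⁻¹
      ≤ κ * ‖x‖ * ε / ε * (4 * Real.pi * ‖x‖)⁻¹ := by gcongr
    _ = κ / (4 * Real.pi) := by field_simp

theorem tendsto_yukawa_sub_yukawa_zero_div (κ : ℝ) {x : R3} (hx : x ≠ 0) :
    Tendsto (fun ε => (yukawa (κ * ε) x - yukawa 0 x) / ε) (𝓝[>] 0)
      (𝓝 (-(κ / (4 * Real.pi)))) := by
  have hn : 0 < ‖x‖ := norm_pos_iff.2 hx
  have h1 : HasDerivAt (fun ε : ℝ => Real.exp (-(κ * ‖x‖ * ε))) (-(κ * ‖x‖)) 0 := by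
    have h2 : HasDerivAt (fun ε : ℝ => -(κ * ‖x‖ * ε)) (-(κ * ‖x‖)) 0 := by
      have h := ((hasDerivAt_id (0 : ℝ)).const_mul (κ * ‖x‖)).neg
      rw [mul_one] at h
      exact h
    simpa using h2.exp
  have h3 := (h1.tendsto_slope_zero_right).mul_const (4 * Real.pi * ‖x‖)⁻¹
  simp only [zero_add, mul_zero, neg_zero, Real.exp_zero, smul_eq_mul] at h3
  have e : -(κ * ‖x‖) * (4 * Real.pi * ‖x‖)⁻¹ = -(κ / (4 * Real.pi)) := by field_simp
  rw [e] at h3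
  refine h3.congr fun ε => ?_
  rw [yukawa_sub_yukawa_zero_div]
  ring

/-- First order expansion of the Birman–Schwinger operator. -/
theorem tendsto_bsOp_sub_div (hVR : Rollnik V) (hV : Integrable V) (hκ : 0 < κ) :
    Tendsto (fun ε : ℝ => ((ε⁻¹ : ℝ) : ℂ) • (bsOp V (κ * ε) - bsOp V 0)) (𝓝[>] 0)
      (𝓝 (((-(κ / (4 * Real.pi)) : ℝ) : ℂ) • rankOne (sqrtAbsL2 hV) (sqrtAbsL2 hV))) := by
  have hm := aestronglyMeasurable_sqrtAbs hV.1
  have hv := memLp_mul_prod (memLp_sqrtAbs hV) (memLp_sqrtAbs hV)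
  have h0 := memLp_bsKernel_of_rollnik hVR
  have e1 : ((-(κ / (4 * Real.pi)) : ℝ) : ℂ) • rankOne (sqrtAbsL2 hV) (sqrtAbsL2 hV)
      = hsOp fun p => -(κ / (4 * Real.pi)) * (sqrtAbs V p.1 * sqrtAbs V p.2) := by
    rw [hsOp_const_mul hv, hsOp_mul_prod (memLp_sqrtAbs hV) (memLp_sqrtAbs hV)]
    rfl
  rw [e1]
  have hlim : Tendsto (fun ε : ℝ => hsOp fun p =>
      ε⁻¹ * (bsKernel (sqrtAbs V) (κ * ε) p - bsKernel (sqrtAbs V) 0 p)) (𝓝[>] 0)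
      (𝓝 (hsOp fun p => -(κ / (4 * Real.pi)) * (sqrtAbs V p.1 * sqrtAbs V p.2))) := by
    have hk : ∀ (ε : ℝ) p, ε⁻¹ * (bsKernel (sqrtAbs V) (κ * ε) p - bsKernel (sqrtAbs V) 0 p)
        = (yukawa (κ * ε) (p.1 - p.2) - yukawa 0 (p.1 - p.2)) / ε
          * (sqrtAbs V p.1 * sqrtAbs V p.2) := fun ε p => by
      simp only [bsKernel]
      ring
    have hvv : ∀ p : R3 × R3, 0 ≤ sqrtAbs V p.1 * sqrtAbs V p.2 := fun p =>
      mul_nonneg (sqrtAbs_nonneg _ _) (sqrtAbs_nonneg _ _)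
    -- The dominating kernel is a multiple of `v ⊗ v`, square integrable because `V ∈ L¹`.
    refine tendsto_hsOp (g := fun p => κ / (4 * Real.pi) * (sqrtAbs V p.1 * sqrtAbs V p.2))
      (Eventually.of_forall fun ε => ?_) (hv.const_mul _).1 (hv.const_mul _) ?_
      (Eventually.of_forall fun p => ?_) ?_
    · exact ((aestronglyMeasurable_bsKernel hm _).sub
        (aestronglyMeasurable_bsKernel hm _)).const_mul _
    · filter_upwards [self_mem_nhdsWithin] with ε hε
      refine Eventually.of_forall fun p => ?_
      rw [hk, abs_mul, abs_of_nonneg (hvv p)]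
      exact mul_le_mul_of_nonneg_right (abs_yukawa_sub_yukawa_zero_div_le hκ hε _) (hvv p)
    · rw [abs_mul, abs_of_nonneg (hvv p), abs_neg, abs_of_nonneg (by positivity)]
    · filter_upwards [ae_fst_ne_snd] with p hp
      simp_rw [hk]
      exact (tendsto_yukawa_sub_yukawa_zero_div κ (sub_ne_zero.2 hp)).mul_const _
  refine hlim.congr' ?_
  filter_upwards [self_mem_nhdsWithin] with ε hε
  have h1 : MemLp (bsKernel (sqrtAbs V) (κ * ε)) 2 vol2 :=
    memLp_bsKernel hm h0 (mul_nonneg hκ.le (le_of_lt hε)) fun _ => le_rfl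
  have h2 : MemLp (fun p => bsKernel (sqrtAbs V) (κ * ε) p - bsKernel (sqrtAbs V) 0 p) 2 vol2 :=
    h1.sub h0
  rw [hsOp_const_mul h2, hsOp_sub h1 h0]
  rfl

end Expansion

/-! ### The behaviour of the resonance function at infinity -/

/-- The radial function `1 / (|x|² (|x|² + t²))`. -/
def radialTail (t : ℝ) (x : R3) : ℝ := (‖x‖ ^ 2 * (‖x‖ ^ 2 + t ^ 2))⁻¹

theorem radialTail_nonneg (t : ℝ) (x : R3) : 0 ≤ radialTail t x := by
  unfold radialTail
  positivity

theorem integrable_radialTail_one : Integrable (radialTail 1) := by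
  have h := (integrable_fun_norm_addHaar (volume : Measure R3)
    (f := fun r : ℝ => (r ^ 2 * (r ^ 2 + 1 ^ 2))⁻¹)).2 ?_
  · exact h
  · rw [finrank_R3]
    refine IntegrableOn.congr_fun integrable_inv_one_add_sq.integrableOn
      (fun r (hr : 0 < r) => ?_) measurableSet_Ioi
    simp only [smul_eq_mul, Nat.add_one_sub_one]
    field_simp
    ring

theorem radialTail_eq {t : ℝ} (ht : 0 < t) (x : R3) :
    radialTail t x = (t ^ 4)⁻¹ * radialTail 1 (t⁻¹ • x) := by
  rw [radialTail, radialTail, norm_smul, Real.norm_of_nonneg (inv_pos.2 ht).le, ← mul_inv]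
  congr 1
  field_simp

theorem integrable_radialTail {t : ℝ} (ht : 0 < t) : Integrable (radialTail t) := by
  rw [show radialTail t = _ from funext (radialTail_eq ht)]
  exact (integrable_radialTail_one.comp_smul (inv_ne_zero ht.ne')).const_mul _

theorem integral_radialTail {t : ℝ} (ht : 0 < t) :
    ∫ x, radialTail t x = t⁻¹ * ∫ x, radialTail 1 x := by
  simp_rw [radialTail_eq ht]
  rw [integral_const_mul, integral_comp_smul_R3 (inv_pos.2 ht), smul_eq_mul, ← mul_assoc]
  congr 1
  field_simp

theorem measurable_radialTail_add : Measurable fun p : R3 × R3 =>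
    ‖p.2‖ ^ 2 * (radialTail ‖p.2‖ p.1 + radialTail ‖p.2‖ (p.1 - p.2)) := by
  unfold radialTail
  fun_prop

/-- For `a > 0` the left side is `(b - a)² / (a² b²)`. The numerator is at most `t²`, and `t ≤ a + b
≤ 2b` gives `a² + t² ≤ 5b²`, the source of the constant. For `a = 0` the convention `0⁻¹ = 0`
applies and `b = t`, so the second term on the right suffices. -/
theorem inv_sub_inv_sq_le_of_le {a b t : ℝ} (ha : 0 ≤ a) (hab : a ≤ b) (h1 : b - a ≤ t)
    (h2 : t ≤ a + b) : (b⁻¹ - a⁻¹) ^ 2 ≤ 5 * (t ^ 2 * (a ^ 2 * (a ^ 2 + t ^ 2))⁻¹)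
      + 5 * (t ^ 2 * (b ^ 2 * (b ^ 2 + t ^ 2))⁻¹) := by
  rcases ha.eq_or_lt with rfl | ha
  · obtain rfl : b = t := by linarith
    rcases hab.eq_or_lt with rfl | hb
    · simp
    · have e : b ^ 2 * (b ^ 2 * (b ^ 2 + b ^ 2))⁻¹ = (b⁻¹) ^ 2 / 2 := by field_simp; norm_num
      rw [e, inv_zero, sub_zero]
      simp only [ne_eq, OfNat.ofNat_ne_zero, not_false_eq_true, zero_pow, zero_mul, inv_zero,
        mul_zero, zero_add]
      nlinarith [sq_nonneg b⁻¹]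
  · have hb : 0 < b := ha.trans_le hab
    have h3 : (b⁻¹ - a⁻¹) ^ 2 ≤ 5 * (t ^ 2 * (a ^ 2 * (a ^ 2 + t ^ 2))⁻¹) := by
      have e : (b⁻¹ - a⁻¹) ^ 2 = (b - a) ^ 2 / (a ^ 2 * b ^ 2) := by field_simp; ring
      have e2 : 5 * (t ^ 2 * (a ^ 2 * (a ^ 2 + t ^ 2))⁻¹)
          = 5 * t ^ 2 / (a ^ 2 * (a ^ 2 + t ^ 2)) := by ring
      have ht : (b - a) ^ 2 ≤ t ^ 2 := by nlinarith
      have hs : a ^ 2 + t ^ 2 ≤ 5 * b ^ 2 := by nlinarith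
      rw [e, e2, div_le_div_iff₀ (by positivity) (by positivity)]
      calc (b - a) ^ 2 * (a ^ 2 * (a ^ 2 + t ^ 2)) ≤ t ^ 2 * (a ^ 2 * (5 * b ^ 2)) := by gcongr
        _ = 5 * t ^ 2 * (a ^ 2 * b ^ 2) := by ring
    have h4 : 0 ≤ 5 * (t ^ 2 * (b ^ 2 * (b ^ 2 + t ^ 2))⁻¹) := by positivity
    linarith

theorem inv_sub_inv_sq_le {a b t : ℝ} (ha : 0 ≤ a) (hb : 0 ≤ b) (h1 : |b - a| ≤ t)
    (h2 : t ≤ a + b) : (b⁻¹ - a⁻¹) ^ 2 ≤ 5 * (t ^ 2 * (a ^ 2 * (a ^ 2 + t ^ 2))⁻¹)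
      + 5 * (t ^ 2 * (b ^ 2 * (b ^ 2 + t ^ 2))⁻¹) := by
  obtain ⟨h3, h4⟩ := abs_le.1 h1
  rcases le_total a b with hab | hab
  · exact inv_sub_inv_sq_le_of_le ha hab h4 h2
  · rw [← neg_sub a⁻¹ b⁻¹, neg_sq, add_comm]
    exact inv_sub_inv_sq_le_of_le hb hab (by linarith) (by linarith)

/-- The preceding estimate for the triangle with sides `|x|`, `|x - y|`, `|y|`; its constant `5` is
absorbed by `(4π)²`. -/
theorem yukawa_zero_sub_sq_le (x y : R3) : (yukawa 0 (x - y) - yukawa 0 x) ^ 2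
    ≤ ‖y‖ ^ 2 * (radialTail ‖y‖ x + radialTail ‖y‖ (x - y)) := by
  have h := inv_sub_inv_sq_le (norm_nonneg x) (norm_nonneg (x - y)) (t := ‖y‖)
    (by have := abs_norm_sub_norm_le (x - y) x; simpa using this)
    (by have := norm_sub_le x (x - y); simpa using this)
  have e : (yukawa 0 (x - y) - yukawa 0 x) ^ 2
      = ((4 * Real.pi) ^ 2)⁻¹ * (‖x - y‖⁻¹ - ‖x‖⁻¹) ^ 2 := by
    simp only [yukawa, zero_mul, neg_zero, Real.exp_zero]
    ring
  have hpi : ((4 * Real.pi) ^ 2)⁻¹ * 5 ≤ 1 := by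
    rw [inv_mul_le_iff₀ (by positivity)]
    nlinarith [Real.pi_gt_three]
  have h0 : 0 ≤ ‖y‖ ^ 2 * (radialTail ‖y‖ x + radialTail ‖y‖ (x - y)) :=
    mul_nonneg (sq_nonneg _) (add_nonneg (radialTail_nonneg _ _) (radialTail_nonneg _ _))
  rw [e]
  calc ((4 * Real.pi) ^ 2)⁻¹ * (‖x - y‖⁻¹ - ‖x‖⁻¹) ^ 2
      ≤ ((4 * Real.pi) ^ 2)⁻¹ *
        (5 * (‖y‖ ^ 2 * (radialTail ‖y‖ x + radialTail ‖y‖ (x - y)))) := by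
        gcongr
        refine h.trans (le_of_eq ?_)
        simp only [radialTail]
        ring
    _ = ((4 * Real.pi) ^ 2)⁻¹ * 5 * (‖y‖ ^ 2 * (radialTail ‖y‖ x + radialTail ‖y‖ (x - y))) := by
        ring
    _ ≤ _ := mul_le_of_le_one_left h0 hpi

section Decay

variable {V : R3 → ℝ}

/-- The kernel `(1 / (4π|x - y|) - 1 / (4π|x|)) v(y)`. -/
def diffKernel (V : R3 → ℝ) (p : R3 × R3) : ℝ :=
  (yukawa 0 (p.1 - p.2) - yukawa 0 p.1) * sqrtAbs V p.2

theorem aestronglyMeasurable_diffKernel (hV : AEStronglyMeasurable V volume) :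
    AEStronglyMeasurable (diffKernel V) vol2 := by
  refine AEStronglyMeasurable.mul ?_ (aestronglyMeasurable_sqrtAbs hV).comp_snd
  exact (((measurable_yukawa 0).comp (measurable_fst.sub measurable_snd)).sub
    ((measurable_yukawa 0).comp measurable_fst)).aestronglyMeasurable

theorem integrable_radialTail_sub {t : ℝ} (ht : 0 < t) (y : R3) :
    Integrable fun x => radialTail t (x - y) :=
  (measurePreserving_sub_right volume y).integrable_comp_of_integrable (integrable_radialTail ht)

/-- By scaling, each tail integrates to a constant over `|y|`, so a single power of `|y|` survives.
This is why the weight `1 + |x|` on `V` is the right one. -/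
theorem integral_sq_mul_radialTail (y : R3) :
    Integrable (fun x => ‖y‖ ^ 2 * (radialTail ‖y‖ x + radialTail ‖y‖ (x - y))) ∧
    ∫ x, ‖y‖ ^ 2 * (radialTail ‖y‖ x + radialTail ‖y‖ (x - y))
      = 2 * ‖y‖ * ∫ x, radialTail 1 x := by
  rcases eq_or_ne y 0 with rfl | hy
  · simp
  have ht : 0 < ‖y‖ := norm_pos_iff.2 hy
  refine ⟨((integrable_radialTail ht).add (integrable_radialTail_sub ht y)).const_mul _, ?_⟩
  rw [integral_const_mul, integral_add (integrable_radialTail ht) (integrable_radialTail_sub ht y),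
    integral_sub_right_eq_self (radialTail ‖y‖) y, integral_radialTail ht]
  field_simp
  ring

theorem integrable_dominating (hV : Integrable V) (hV1 : Integrable fun x => (1 + ‖x‖) * V x) :
    Integrable (fun p : R3 × R3 => |V p.2| *
      (‖p.2‖ ^ 2 * (radialTail ‖p.2‖ p.1 + radialTail ‖p.2‖ (p.1 - p.2)))) vol2 := by
  have hm : AEStronglyMeasurable (fun p : R3 × R3 => |V p.2| *
      (‖p.2‖ ^ 2 * (radialTail ‖p.2‖ p.1 + radialTail ‖p.2‖ (p.1 - p.2)))) vol2 := by
    exact hV.abs.1.comp_snd.mul measurable_radialTail_add.aestronglyMeasurable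
  rw [integrable_prod_iff' hm]
  refine ⟨Eventually.of_forall fun y => (integral_sq_mul_radialTail y).1.const_mul |V y|, ?_⟩
  have h1 : ∀ y : R3, ∫ x, ‖|V y| * (‖y‖ ^ 2 * (radialTail ‖y‖ x + radialTail ‖y‖ (x - y)))‖
      = (2 * ∫ x, radialTail 1 x) * (‖y‖ * |V y|) := fun y => by
    rw [show (2 * ∫ x, radialTail 1 x) * (‖y‖ * |V y|)
      = |V y| * (2 * ‖y‖ * ∫ x, radialTail 1 x) by ring, ← (integral_sq_mul_radialTail y).2,
      ← integral_const_mul]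
    refine integral_congr_ae (Eventually.of_forall fun x => Real.norm_of_nonneg ?_)
    exact mul_nonneg (abs_nonneg _) (mul_nonneg (sq_nonneg _)
      (add_nonneg (radialTail_nonneg _ _) (radialTail_nonneg _ _)))
  simp_rw [h1]
  refine Integrable.const_mul ?_ _
  refine hV1.abs.mono' (continuous_norm.aestronglyMeasurable.mul hV.abs.1)
    (Eventually.of_forall fun y => ?_)
  rw [Real.norm_of_nonneg (by positivity), abs_mul, abs_of_nonneg (a := 1 + ‖y‖) (by positivity)]
  gcongr
  linarith

theorem memLp_diffKernel (hV : Integrable V) (hV1 : Integrable fun x => (1 + ‖x‖) * V x) :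
    MemLp (diffKernel V) 2 vol2 := by
  have hm := aestronglyMeasurable_diffKernel hV.1
  rw [memLp_two_iff_integrable_sq hm]
  refine (integrable_dominating hV hV1).mono' (hm.pow 2) (Eventually.of_forall fun p => ?_)
  rw [Real.norm_of_nonneg (sq_nonneg _), diffKernel, mul_pow, sqrtAbs_sq, mul_comm]
  exact mul_le_mul_of_nonneg_left (yukawa_zero_sub_sq_le _ _) (abs_nonneg _)

theorem inner_sqrtAbsL2 (hV : Integrable V) (φ : L2) :
    inner ℂ (sqrtAbsL2 hV) φ = ∫ x, (sqrtAbs V x : ℂ) * φ x := by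
  rw [inner_eq_integral]
  refine integral_congr_ae ?_
  filter_upwards [sqrtAbsL2_coeFn hV] with x hx
  rw [hx, Complex.conj_ofReal]

/-- If `v` is orthogonal to `φ`, the resonance function is square integrable. -/
theorem memLp_resonanceFunction (hV : Integrable V) (hV1 : Integrable fun x => (1 + ‖x‖) * V x)
    {φ : L2} (h : inner ℂ (sqrtAbsL2 hV) φ = 0) : MemLp (resonanceFunction V φ) 2 volume := by
  have hk := memLp_diffKernel hV hV1
  refine (memLp_kernelInt hk φ).ae_eq ?_
  have hv : MemLp (fun x => (sqrtAbs V x : ℂ)) 2 volume := (memLp_sqrtAbs hV).ofReal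
  have hInt : Integrable fun y => (sqrtAbs V y : ℂ) * φ y := hv.integrable_mul (Lp.memLp φ)
  rw [inner_sqrtAbsL2] at h
  filter_upwards [ae_integrable_kernel_mul hk φ] with x hx
  -- The slowly decaying part of the potential is `(4π|x|)⁻¹ ∫ v φ`, which vanishes; the rest has a
  -- square integrable kernel.
  have e : ∀ y, (((4 * Real.pi * ‖x - y‖)⁻¹ : ℝ) : ℂ) * (((√|V y| : ℝ) : ℂ) * φ y)
      = (diffKernel V (x, y) : ℂ) * φ y + (yukawa 0 x : ℂ) * ((sqrtAbs V y : ℂ) * φ y) :=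
      fun y => by
    simp only [diffKernel, yukawa, sqrtAbs, zero_mul, neg_zero, Real.exp_zero, one_div,
      Complex.ofReal_mul, Complex.ofReal_sub]
    ring
  rw [resonanceFunction, newtonPotential]
  simp_rw [e]
  rw [integral_add hx (hInt.const_mul _), integral_const_mul, h, mul_zero, add_zero, kernelInt]

end Decay

/-! ### The resonant case -/

section AbstractResonance

theorem tendsto_const_sub_of_eq_neg {ι E : Type*} [NormedAddCommGroup E] [NormedSpace ℂ E]
    {l : Filter ι} {F : ι → E} {K : E} {a d : ℝ} (R : E) (h : Tendsto F l (𝓝 ((d : ℂ) • K)))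
    (hd : d = -a) : Tendsto (fun i => R - F i) l (𝓝 (R + (a : ℂ) • K)) := by
  have h4 := h.const_sub R
  rwa [hd, Complex.ofReal_neg, neg_smul, sub_neg_eq_add] at h4

/-- `S² = 1` is available only where `V ≠ 0`, hence the weaker hypothesis that `S²` fixes the range
of `B₀`, whose elements carry a factor `v`. -/
theorem apply_eq_neg_of_resonance {H : Type*} [NormedAddCommGroup H] [NormedSpace ℂ H]
    {S B₀ : H →L[ℂ] H} {φ : H} (hSSB : ∀ f, S (S (B₀ f)) = B₀ f)
    (hφ : φ + (S * B₀) φ = 0) : S φ = -B₀ φ := by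
  have h : φ = -S (B₀ φ) := by
    rw [mul_apply_eq_comp] at hφ
    exact eq_neg_of_add_eq_zero_left hφ
  conv_lhs => rw [h]
  rw [map_neg, hSSB]

variable {H : Type*} [NormedAddCommGroup H] [InnerProductSpace ℂ H] [CompleteSpace H]

theorem star_rankOne (a b : H) : star (rankOne a b) = rankOne b a := by
  rw [ContinuousLinearMap.star_eq_adjoint, eq_comm, ContinuousLinearMap.eq_adjoint_iff]
  intro x y
  rw [rankOne_apply, rankOne_apply, inner_smul_left, inner_smul_right, inner_conj_symm, mul_comm]

theorem inner_apply_comm {S : H →L[ℂ] H} (hS : IsSelfAdjoint S) (f g : H) :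
    inner ℂ (S f) g = inner ℂ f (S g) := hS.isSymmetric f g

/-- `S φ` is the left null vector: `⟪Sφ, S B₀ f⟫ = ⟪φ, B₀ f⟫ = ⟪B₀ φ, f⟫ = -⟪Sφ, f⟫`. -/
theorem inner_resonance_left {S B₀ : H →L[ℂ] H} {φ : H} (hS : IsSelfAdjoint S)
    (hB : IsSelfAdjoint B₀) (hSSB : ∀ f, S (S (B₀ f)) = B₀ f) (hφ : φ + (S * B₀) φ = 0) (f : H) :
    inner ℂ (S φ) ((1 + S * B₀) f) = (0 : ℂ) := by
  rw [add_apply, one_apply_eq_self, mul_apply_eq_comp, inner_add_right,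
    inner_apply_comm hS φ (S (B₀ f)), hSSB, ← inner_apply_comm hB,
    apply_eq_neg_of_resonance hSSB hφ, inner_neg_left, neg_add_cancel]

/-- The normalisation `⟪Sφ, φ⟫ = -1` together with `S φ = -B₀ φ` means `⟪φ, B₀ φ⟫ = 1`, so `b`
enters with coefficient one. -/
theorem inner_resonance_derivative {S B₀ : H →L[ℂ] H} {φ v : H} (hS : IsSelfAdjoint S)
    (hSSB : ∀ f, S (S (B₀ f)) = B₀ f) (hSSv : S (S v) = v)
    (hφ : φ + (S * B₀) φ = 0) (hnorm : inner ℂ (S φ) φ = (-1 : ℂ)) (b k : ℝ) :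
    inner ℂ (S φ) ((S * ((b : ℂ) • B₀ + ((-k : ℝ) : ℂ) • rankOne v v)) φ)
      = ((b - k * ‖(inner ℂ v φ : ℂ)‖ ^ 2 : ℝ) : ℂ) := by
  have h1 : inner ℂ φ (B₀ φ) = (1 : ℂ) := by
    rw [inner_apply_comm hS, apply_eq_neg_of_resonance hSSB hφ, inner_neg_right] at hnorm
    exact neg_injective hnorm
  rw [mul_apply_eq_comp, inner_apply_comm hS, add_apply, smul_apply, smul_apply, rankOne_apply,
    map_add, map_add, map_smul, map_smul, map_smul, map_smul, map_smul, map_smul, hSSB, hSSv,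
    inner_add_right, inner_smul_right, inner_smul_right, inner_smul_right, h1]
  have h2 : inner ℂ v φ * inner ℂ φ v = ((‖(inner ℂ v φ : ℂ)‖ ^ 2 : ℝ) : ℂ) := by
    rw [← inner_conj_symm φ v, Complex.mul_conj', Complex.ofReal_pow]
  rw [h2]
  push_cast
  ring

theorem resonance_sandwich {S : H →L[ℂ] H} {φ v G : H} (hS : IsSelfAdjoint S)
    (hSSv : S (S v) = v) (d : ℝ) :
    star (rankOne v G) * (((d : ℂ))⁻¹ • rankOne φ (S φ)) * S * rankOne v G
      = ((d⁻¹ * ‖(inner ℂ v φ : ℂ)‖ ^ 2 : ℝ) : ℂ) • rankOne G G := by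
  have h2 : inner ℂ φ v * inner ℂ v φ = ((‖(inner ℂ v φ : ℂ)‖ ^ 2 : ℝ) : ℂ) := by
    rw [← inner_conj_symm φ v, Complex.conj_mul', Complex.ofReal_pow]
  refine ContinuousLinearMap.ext fun f => ?_
  rw [star_rankOne, mul_apply_eq_comp, mul_apply_eq_comp, mul_apply_eq_comp, smul_apply,
    smul_apply, rankOne_apply v G, rankOne_apply G v, rankOne_apply φ, rankOne_apply G G, map_smul,
    inner_smul_right, inner_smul_right, inner_smul_right, inner_apply_comm hS, hSSv, smul_smul,
    Complex.ofReal_mul, ← h2, Complex.ofReal_inv]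
  congr 1
  ring

theorem tendsto_resonance {S B₀ : H →L[ℂ] H} {v φ G : H} {B A : ℝ → H →L[ℂ] H} {η : ℝ → ℝ}
    {b k : ℝ} (hS : IsSelfAdjoint S) (hB₀ : IsSelfAdjoint B₀)
    (hSSB : ∀ f, S (S (B₀ f)) = B₀ f) (hSSv : S (S v) = v) (hC : IsCompactOperator (S * B₀))
    (hφ : φ + (S * B₀) φ = 0) (hker : ∀ f, f + (S * B₀) f = 0 → ∃ c : ℂ, f = c • φ)
    (hnorm : inner ℂ (S φ) φ = (-1 : ℂ)) (hB : Tendsto B (𝓝[>] 0) (𝓝 B₀))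
    (hB' : Tendsto (fun ε : ℝ => ((ε⁻¹ : ℝ) : ℂ) • (B ε - B₀)) (𝓝[>] 0)
      (𝓝 (((-k : ℝ) : ℂ) • rankOne v v)))
    (hη : Tendsto η (𝓝[>] 0) (𝓝 1)) (hη' : Tendsto (fun ε => ε⁻¹ * (η ε - 1)) (𝓝[>] 0) (𝓝 b))
    (hA : Tendsto A (𝓝[>] 0) (𝓝 (rankOne v G)))
    (hd : b - k * ‖(inner ℂ v φ : ℂ)‖ ^ 2 ≠ 0) :
    (∀ᶠ ε in 𝓝[>] 0, IsUnit (1 + (η ε : ℂ) • (S * B ε))) ∧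
      Tendsto (fun ε : ℝ => ((η ε * ε : ℝ) : ℂ) •
          (star (A ε) * Ring.inverse (1 + (η ε : ℂ) • (S * B ε)) * S * A ε)) (𝓝[>] 0)
        (𝓝 ((((b - k * ‖(inner ℂ v φ : ℂ)‖ ^ 2)⁻¹ * ‖(inner ℂ v φ : ℂ)‖ ^ 2 : ℝ) : ℂ) •
          rankOne G G)) := by
  have hχ := inner_resonance_left hS hB₀ hSSB hφ
  have hM₀ : ∀ f, (1 + S * B₀) f = f + (S * B₀) f := fun f => by
    rw [add_apply, one_apply_eq_self]
  have hN := inner_resonance_derivative hS hSSB hSSv hφ hnorm b k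
  have hn : Tendsto (fun ε : ℝ => S * (((ε⁻¹ * (η ε - 1) : ℝ) : ℂ) • B ε
      + ((ε⁻¹ : ℝ) : ℂ) • (B ε - B₀))) (𝓝[>] 0)
      (𝓝 (S * ((b : ℂ) • B₀ + ((-k : ℝ) : ℂ) • rankOne v v))) :=
    ((((Complex.continuous_ofReal.tendsto b).comp hη').smul hB).add hB').const_mul S
  have he : Tendsto (fun ε : ℝ => (ε : ℂ)) (𝓝[>] 0) (𝓝 0) := by
    have := (Complex.continuous_ofReal.tendsto 0).mono_left (nhdsWithin_le_nhds (s := Ioi 0))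
    rwa [Complex.ofReal_zero] at this
  have he0 : ∀ᶠ ε : ℝ in 𝓝[>] 0, (ε : ℂ) ≠ 0 := by
    filter_upwards [self_mem_nhdsWithin] with ε hε
    exact_mod_cast (ne_of_gt hε)
  -- An exact decomposition from `η B - B₀ = (η - 1) B + (B - B₀)`, with one factor `ε` taken out.
  have hM : ∀ᶠ ε : ℝ in 𝓝[>] 0, 1 + (η ε : ℂ) • (S * B ε) = (1 + S * B₀)
      + (ε : ℂ) • (S * (((ε⁻¹ * (η ε - 1) : ℝ) : ℂ) • B ε + ((ε⁻¹ : ℝ) : ℂ) • (B ε - B₀))) := by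
    filter_upwards [he0] with ε hε
    rw [← mul_smul_comm (ε : ℂ), smul_add, smul_smul, smul_smul, Complex.ofReal_mul,
      Complex.ofReal_inv,
      mul_inv_cancel_left₀ hε, mul_inv_cancel₀ hε, one_smul, mul_add, mul_sub, mul_smul_comm,
      Complex.ofReal_sub, Complex.ofReal_one, sub_smul, one_smul]
    abel
  obtain ⟨h1, h2⟩ := tendsto_smul_inverse_of_simple_kernel hnorm ((hM₀ φ).trans hφ) hχ
    (isUnit_sub_rankOne_of_simple_kernel hC rfl hnorm hχ fun f hf => hker f ((hM₀ f).symm.trans hf))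
    hn he he0 hM (by rw [hN]; exact_mod_cast hd)
  refine ⟨h1, ?_⟩
  rw [hN] at h2
  have h3 := ((Complex.continuous_ofReal.tendsto 1).comp hη).smul
    ((((continuous_star.tendsto _).comp hA).mul h2).mul_const S |>.mul hA)
  rw [resonance_sandwich hS hSSv, Complex.ofReal_one, one_smul] at h3
  refine h3.congr fun ε => ?_
  simp only [Function.comp_apply, mul_smul_comm, smul_mul_assoc, smul_smul, Complex.ofReal_mul]

end AbstractResonance

section Resonance

variable {V : R3 → ℝ} {κ : ℝ}

/-- At positive mass the operator is `T T*`, and self-adjointness passes to the norm limit. -/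
theorem isSelfAdjoint_bsOp_zero (hVR : Rollnik V) : IsSelfAdjoint (bsOp V 0) := by
  have h := tendsto_bsOp_zero hVR one_pos
  have h2 := (continuous_star.tendsto _).comp h
  refine tendsto_nhds_unique h2 (h.congr' ?_)
  filter_upwards [self_mem_nhdsWithin] with ε hε
  obtain ⟨T, -, hT⟩ := exists_dilation_factor hVR one_pos hε
  rw [Function.comp_apply, ← hT]
  exact (IsSelfAdjoint.mul_star_self T).star_eq.symm

theorem sign_mul_sign_mul_sqrtAbs (V : R3 → ℝ) (x : R3) :
    Real.sign (V x) * (Real.sign (V x) * sqrtAbs V x) = sqrtAbs V x := by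
  rcases lt_trichotomy (V x) 0 with h | h | h
  · rw [Real.sign_of_neg h]; ring
  · simp [sqrtAbs, h]
  · rw [Real.sign_of_pos h]; ring

theorem signOp_signOp_eq (hV : AEStronglyMeasurable V volume) {f : L2} {g : R3 → ℂ}
    (h : f =ᵐ[volume] fun x => (sqrtAbs V x : ℂ) * g x) : signOp V (signOp V f) = f := by
  refine Lp.ext ?_
  filter_upwards [signOp_coeFn hV (signOp V f), signOp_coeFn hV f, h] with x h1 h2 h3
  rw [h1, h2, h3, ← mul_assoc, ← mul_assoc, ← Complex.ofReal_mul, ← Complex.ofReal_mul, mul_assoc,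
    sign_mul_sign_mul_sqrtAbs]

theorem signOp_signOp_sqrtAbsL2 (hV : Integrable V) :
    signOp V (signOp V (sqrtAbsL2 hV)) = sqrtAbsL2 hV :=
  signOp_signOp_eq hV.1 (g := fun _ => 1) (by simpa using sqrtAbsL2_coeFn hV)

theorem inner_signOp_self (hV : AEStronglyMeasurable V volume) (φ : L2) :
    inner ℂ (signOp V φ) φ = ((∫ x, Real.sign (V x) * ‖φ x‖ ^ 2 : ℝ) : ℂ) := by
  rw [inner_eq_integral, ← integral_complex_ofReal]
  refine integral_congr_ae ?_
  filter_upwards [signOp_coeFn hV φ] with x hx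
  rw [hx, map_mul, Complex.conj_ofReal, mul_assoc, Complex.conj_mul', Complex.ofReal_mul,
    Complex.ofReal_pow]

/-- Pointwise `V ψ = v (u ψ) = -v φ`, which identifies the denominator of `α` with `|⟪v, φ⟫|²`. -/
theorem integral_potential_mul_resonanceFunction (hV : Integrable V) {φ : L2}
    (hφ : IsBirmanSchwingerSolution V φ) :
    ∫ x, (V x : ℂ) * resonanceFunction V φ x = -inner ℂ (sqrtAbsL2 hV) φ := by
  rw [inner_sqrtAbsL2, ← integral_neg]
  refine integral_congr_ae ?_
  filter_upwards [hφ] with x hx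
  have e : (V x : ℂ) = (sqrtAbs V x : ℂ) * ((√|V x| * Real.sign (V x) : ℝ) : ℂ) := by
    rw [← Complex.ofReal_mul, sqrtAbs, ← mul_assoc, Real.mul_self_sqrt (abs_nonneg _), mul_comm,
      sign_mul_abs_self]
  rw [e, mul_assoc, hx, mul_neg]

theorem tendsto_slope_of_differentiableWithinAt {η : ℝ → ℝ}
    (hη : DifferentiableWithinAt ℝ η (Icc 0 1) 0) (hη0 : η 0 = 1) :
    Tendsto (fun ε => ε⁻¹ * (η ε - 1)) (𝓝[>] 0) (𝓝 (derivWithin η (Icc 0 1) 0)) := by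
  have h := hη.hasDerivWithinAt.mono_of_mem_nhdsWithin (s := Ioi (0 : ℝ)) (t := Icc 0 1)
    (Icc_mem_nhdsGT one_pos)
  rw [hasDerivWithinAt_iff_tendsto_slope' (by simp)] at h
  refine h.congr fun ε => ?_
  rw [slope_def_field, hη0, sub_zero]
  ring

theorem coupling_two (η : ℝ → ℝ) {ε : ℝ} (hε : 0 < ε) : coupling η 2 ε = η ε := by
  rw [coupling, Real.rpow_two]
  field_simp

/-- With `k = κ / 4π`, the nondegeneracy needed for the inversion is exactly `α + κ / 4π ≠ 0`. -/
theorem resonance_denominator {b m α k : ℝ} (hm : m ≠ 0) (hα : α = -b / m) :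
    b - k * m = -(m * (α + k)) := by
  rw [hα]
  field_simp
  ring

theorem tendsto_kreinRes_resonance (hVR : Rollnik V) (hV : Integrable V) {η : ℝ → ℝ}
    (hη : DifferentiableWithinAt ℝ η (Icc 0 1) 0) (hη0 : η 0 = 1) {φ : L2}
    (hsol : IsBirmanSchwingerSolution V φ)
    (hker : ∀ χ : L2, IsBirmanSchwingerSolution V χ → ∃ c : ℂ, χ = c • φ)
    (hnorm : ∫ x, Real.sign (V x) * ‖φ x‖ ^ 2 = -1)
    (hm : ‖(inner ℂ (sqrtAbsL2 hV) φ : ℂ)‖ ^ 2 ≠ 0) {α : ℝ} (hκ : 0 < κ)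
    (hα : α = -derivWithin η (Icc 0 1) 0 / ‖(inner ℂ (sqrtAbsL2 hV) φ : ℂ)‖ ^ 2)
    (hακ : α + κ / (4 * Real.pi) ≠ 0) :
    (∀ᶠ ε in 𝓝[>] 0, IsUnit (1 + (η ε : ℂ) • (signOp V * bsOp V (κ * ε)))) ∧
      Tendsto (fun ε => kreinRes V κ ε (η ε)) (𝓝[>] 0)
        (𝓝 (pointRes hκ (α + κ / (4 * Real.pi)))) := by
  have hd := resonance_denominator (k := κ / (4 * Real.pi)) hm hα
  have hη1 : Tendsto η (𝓝[>] 0) (𝓝 1) := by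
    rw [← hη0]
    exact hη.continuousWithinAt.tendsto.mono_left
      (nhdsWithin_le_of_mem (Icc_mem_nhdsGT one_pos))
  obtain ⟨h1, h2⟩ := tendsto_resonance (isSelfAdjoint_signOp hV.1) (isSelfAdjoint_bsOp_zero hVR)
    (fun f => signOp_signOp_eq hV.1 (bsOp_zero_coeFn hVR f)) (signOp_signOp_sqrtAbsL2 hV)
    (isCompactOperator_signOp_mul_bsOp V 0) ((isBirmanSchwingerSolution_iff hVR φ).1 hsol)
    (fun f hf => hker f ((isBirmanSchwingerSolution_iff hVR f).2 hf))
    (by rw [inner_signOp_self hV.1, hnorm]; norm_num)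
    (tendsto_bsOp_zero hVR hκ) (tendsto_bsOp_sub_div hVR hV hκ) hη1
    (tendsto_slope_of_differentiableWithinAt hη hη0) (tendsto_sideOp hV hκ)
    (by rw [hd]; exact neg_ne_zero.2 (mul_ne_zero hm hακ))
  exact ⟨h1, tendsto_const_sub_of_eq_neg (freeRes κ) h2 (by
    rw [hd, inv_neg, neg_mul, mul_inv, mul_comm, mul_inv_cancel_left₀ hm])⟩

theorem normResolventConverges_pointInteraction (hVR : Rollnik V) (hV : Integrable V)
    (hV1 : Integrable fun x => (1 + ‖x‖) * V x) {η : ℝ → ℝ}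
    (hη : DifferentiableWithinAt ℝ η (Icc 0 1) 0) (hη0 : η 0 = 1) {φ : L2}
    (hφ : ResonanceCondition V φ) (hnorm : ∫ x, Real.sign (V x) * ‖φ x‖ ^ 2 = -1) {α ν : ℝ}
    (hα : α = -derivWithin η (Icc 0 1) 0 / ‖∫ x, (V x : ℂ) * resonanceFunction V φ x‖ ^ 2)
    (hν : 0 < ν) (hαν : α + √ν / (4 * Real.pi) ≠ 0) :
    NormResolventConverges (fun ε => formSum (scaledPotential V η 2 ε))
      (pointInteraction α ν) := by
  have hκ : 0 < √ν := Real.sqrt_pos.2 hν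
  obtain ⟨-, hsol, hker, -, hnot⟩ := hφ
  -- This is where `ψ ∉ L²`, a resonance rather than an eigenvalue, is used.
  have hm : (inner ℂ (sqrtAbsL2 hV) φ : ℂ) ≠ 0 := fun h => hnot (memLp_resonanceFunction hV hV1 h)
  rw [integral_potential_mul_resonanceFunction hV hsol, norm_neg] at hα
  obtain ⟨h1, h2⟩ := tendsto_kreinRes_resonance hVR hV hη hη0 hsol hker hnorm
    (pow_ne_zero 2 (norm_ne_zero_iff.2 hm)) hκ hα hαν
  have hS : HasRealResolvent (pointInteractionGraph α ν) (-√ν ^ 2)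
      (pointRes hκ (α + √ν / (4 * Real.pi))) := by
    rw [Real.sq_sqrt hν.le]
    exact hasRealResolvent_pointInteraction hν
  refine normResolventConverges_of_hasRealResolvent ?_ hS h2
  filter_upwards [h1, self_mem_nhdsWithin] with ε h5 hε
  rw [← coupling_two η hε] at h5 ⊢
  exact hasRealResolvent_dilation hVR hV hκ hε _ h5

end Resonance

end PointLimit

end

/-! ### Assembly of the four assertions. -/

theorem theorem3p1 (V : R3 → ℝ) (hVR : Rollnik V) (hV : Integrable V)
    (η : ℝ → ℝ) (hη : ContDiffOn ℝ ∞ η (Icc 0 1)) (hη_nonneg : ∀ t ∈ Icc (0 : ℝ) 1, 0 ≤ η t)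
    (hη0 : η 0 = 1) (hη1 : η 1 = 1) (σ : ℝ) (hσ : 0 ≤ σ) :
    (∀ ε ∈ Ioc (0 : ℝ) 1, IsSelfAdjoint (formSum (scaledPotential V η σ ε)) ∧
      LowerSemibounded (formSum (scaledPotential V η σ ε))) ∧
    (σ ≤ 2 → (σ = 2 → ¬ HasEigenvalueNegOne V) →
      NormResolventConverges (fun ε => formSum (scaledPotential V η σ ε)) negLaplacian) ∧
    (2 < σ → σ ≤ 3 → (∀ᵐ x, 0 < V x) →
      StrongResolventConverges (fun ε => formSum (scaledPotential V η σ ε)) negLaplacian) ∧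
    (σ = 2 → Integrable (fun x => (1 + ‖x‖) * V x) →
      ∀ φ : L2, ResonanceCondition V φ → ∫ x, Real.sign (V x) * ‖φ x‖ ^ 2 = -1 →
      ∀ α : ℝ, α = -derivWithin η (Icc 0 1) 0 /
          ‖∫ x, (V x : ℂ) * resonanceFunction V φ x‖ ^ 2 →
      ∀ ν : ℝ, 0 < ν → α + √ν / (4 * Real.pi) ≠ 0 →
        NormResolventConverges (fun ε => formSum (scaledPotential V η σ ε))
          (pointInteraction α ν)) := by
  have hd : DifferentiableWithinAt ℝ η (Icc 0 1) 0 :=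
    hη.differentiableOn (by simp) 0 (left_mem_Icc.2 zero_le_one)
  refine ⟨fun ε hε => isSelfAdjoint_formSum_dilation hVR hV hε.1 _, fun h2 hV2 =>
    normResolventConverges_negLaplacian hVR hV hd.continuousWithinAt hη0 h2 hV2,
    fun _ h3 hpos => strongResolventConverges_negLaplacian hVR hV hpos hd.continuousWithinAt
      hη_nonneg hη0 h3, ?_⟩
  rintro rfl hV1 φ hφ hnorm α hα ν hν hαν
  exact normResolventConverges_pointInteraction hVR hV hV1 hd hη0 hφ hnorm hα hν hαν
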